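/- **Setting.** Let $M=(H,\mathcal X,\mathcal A,(P_h),(r_h),d_1)$ be a finite-horizon MDP with measurable state space $\mathcal X$, finite nonempty action set $\mathcal A$ of size $A$, and rewards in $[0,1]$. Let $\phi_h:\mathcal X\times\mathcal A\to\mathbb R^d$ $(h\in[H])$ be features that are measurable in the state, and $\mathcal B_h=\{\theta\in\mathbb R^d: |\langle\phi_h(x,a),\theta\rangle|\le 1\ \forall x,a\}$. Assume that $M$ is linear Bellman complete: for $h<H$ and each $\theta\in\mathcal B_{h+1}$ there is $\theta'\in\mathcal B_h$ with $\langle\phi_h(x,a),\theta'\rangle=\mathbb E_{x'\sim P_h(x,a)}[\max_{a'}\langle\phi_{h+1}(x',a'),\theta\rangle]$ for all $x,a$; and $r_h(x,a)=\langle\phi_h(x,a),\theta^{\mathsf r}_h\rangle$ with $\theta_h^{\mathsf r}\in\mathcal B_h$. Assume $\|\phi_h(x,a)\|_2\le1$, $\|w\|_2\le B$ for all $w\in\mathcal B_h$, and $\|\theta^{\mathsf r}_h\|_2\le 1$. Write $Q_h^\star(x,a)=\sup_\pi Q_h^\pi(x,a)$ and $V_h^\star(x)=\sup_\pi V_h^\pi(x)$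 for the optimal value functions (suprema over all nonstationary randomized policies). **Parameters.** For $\delta,\varepsilon_{\mathsf{final}}\in(0,1)$ and constants $C_{\mathrm{psd}},C_{\mathrm{cor}},C_{\mathrm{phi}},C_{\mathrm{thm}}$ put $T=\Big\lceil d\Big(\tfrac{C_{\mathrm{thm}}H^4B^3dA^{1/2}\log^{1/2}(HABd/(\varepsilon_{\mathsf{final}}\delta))}{\varepsilon_{\mathsf{final}}}\Big)^{6A+2}\Big\rceil$, $n=3T$, $\lambda=C_{\mathrm{psd}}\,d\log(2THn/\delta)$, $\iota=\log(TH(\lambda d+n)/\delta)$, $\lambda_1=BH$, $\varepsilon_{\mathsf{bkup}}=\frac{\varepsilon_{\mathsf{final}}}{2H}$, $\sigma_{\mathsf{tr}}=\frac{\varepsilon_{\mathsf{bkup}}}{4\lambda_1}$, $\varepsilon_{\mathsf{apx}}=\frac{\varepsilon_{\mathsf{bkup}}}{128\sqrt{2\pi}C_{\mathrm{phi}}\lambda_1^2HBd\sqrt\iota}$, $\beta=4C_{\mathrm{phi}}HB\sqrt{d\iota}\cdot5\lambda_1\sqrt d\,(C_{\mathrm{cor}}/\varepsilon_{\mathsf{apx}})^{2A}$,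 $\xi=\frac{\beta}{4C_{\mathrm{phi}}HB\sqrt{d\iota}\cdot2\sqrt{2\pi}\lambda_1\sqrt d}$. **Algorithm.** In round $t\in[T]$, for $h=H,\dots,1$, trajectories $(x_k^{t,i,h},a_k^{t,i,h})_{k\in[H]}$, $i\in[n]$, are sampled (none if $t=1$), and $$\Sigma_h^t=\lambda I+\sum_i\phi_h(x_h^{t,i,h},a_h^{t,i,h})\phi_h(x_h^{t,i,h},a_h^{t,i,h})^{\top},$$ $$\hat w_h^t=(\Sigma_h^t)^{-1}\sum_i\phi_h(x_h^{t,i,h},a_h^{t,i,h})\Big(r_h(x_h^{t,i,h},a_h^{t,i,h})+\sum_{g=h+1}^H\big(r_g(x_g^{t,i,h},a_g^{t,i,h})+F_g^t(x_g^{t,i,h})\big)\Big).$$ For $t\ge2$, $\hat\pi_h^t(x)$ is the linear policy $\arg\max_a\langle\phi_h(x,a),\hat w_h^t\rangle$, where ties are broken by the largest $\langle\theta,\phi_h(x,a)\rangle$ for $\theta$ uniform on the unit sphere, and then uniformly among actions with the same feature vector; $\hat\pi^1$ is an arbitrary policy. Let $\Gamma=\frac{\beta}{\lambda_1}(\Sigma_h^t)^{-1/2}$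 and let $\Sigma'$, $\Lambda'$ be the orthogonal projections onto the spans of the eigenvectors of $\Gamma$ with eigenvalue $\ge\sigma_{\mathsf{tr}}$ and $<\sigma_{\mathsf{tr}}$, respectively. With $\bar\Phi_h(x)$ the convex hull of $\{\phi_h(x,a):a\in\mathcal A\}$ and $F^{\mathsf{tl}}_h(x;u,v)=\max_{\phi\in\bar\Phi_h(x)}\langle u,\phi\rangle+\max_{\phi\in\bar\Phi_h(x)}\langle v,\phi\rangle-\max_{\phi\in\bar\Phi_h(x)}\langle u+v,\phi\rangle$, the bonus is $$F_h^t(x)=\lambda_1\Big(\frac{C_{\mathrm{cor}}}{\varepsilon_{\mathsf{apx}}}\Big)^{2A}\mathbb E_{u'\sim\mathcal N(0,\Sigma')}\mathbb E_{v'\sim\mathcal N(0,\Lambda')}\big[F^{\mathsf{tl}}_h(x;\beta u',v')\big]+2\sqrt{2\pi}\lambda_1\xi\,\mathbb E_{w\sim\mathcal N(0,\Sigma')}\big[\max_a\langle w,\phi_h(x,a)\rangle\big].$$ Finally $Q_h^t(x,a)=r_h(x,a)+\mathbb E^{\hat\pi^t}\big[\sum_{g=h+1}^H(r_g(x_g,a_g)+F_g^t(x_g))\mid(x_h,a_h)=(x,a)\big]$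 and $V_h^t(x)=Q_h^t(x,\hat\pi_h^t(x))$. **Event.** $\mathcal E$ is the event (set of realizations of the sampled trajectories) that for all $h\in[H]$, $t\in[T]$, $\phi\in\mathbb R^d$ one has $|\langle\phi,\hat w_h^t-w_h^t\rangle|\le\beta\,(\phi^\top(\Sigma_h^t)^{-1}\phi)^{1/2}$, where $w_h^t$ is the vector with $Q_h^t(x,a)=\langle w_h^t,\phi_h(x,a)\rangle$ for all $x,a$. Such a vector is unique if it exists; if there is none for some $(h,t)$, nothing is required at this $(h,t)$. **Lemma (Optimism).** If the constants are sufficiently large, namely $C_{\mathrm{psd}}$ and $C_{\mathrm{cor}}$ larger than an absolute constant, $C_{\mathrm{phi}}$ larger than a bound that depends only on $C_{\mathrm{psd}},C_{\mathrm{cor}}$, and $C_{\mathrm{thm}}$ larger than a bound that depends only on the other three, then for every realization of the sampled trajectories in $\mathcal E$, and for all $t\in[T]$, $h\in[H]$, $x\in\mathcal X$, $a\in\mathcal A$, $$Q_h^t(x,a)+\varepsilon_{\mathsf{bkup}}(H-h)\ \ge\ Q_h^\star(x,a),\qquad V_h^t(x)+F_h^t(x)+\varepsilon_{\mathsf{bkup}}(H+1-h)\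 \ge\ V_h^\star(x).$$ -/

import Mathlib

open MeasureTheory ProbabilityTheory
open scoped RealInnerProductSpace MatrixOrder Matrix

noncomputable section

/-! ### Markov decision processes, policies and value functions

Steps are indexed by `h = 1, …, H` (natural numbers); values of the data at other indices play no
role. The feature space is `EuclideanSpace ℝ (Fin d)`. -/

/-- A finite-horizon MDP with horizon `H`, measurable state space `X` and action set `A`. -/
structure MDP (H : ℕ) (X A : Type*) [MeasurableSpace X] where
  /-- `P h a x` is the law of the next state after playing `a` in state `x` at step `h`. -/
  P : ℕ → A → Kernel X X
  markov : ∀ h a, IsMarkovKernel (P h a)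
  /-- `r h x a` is the reward at step `h`. -/
  r : ℕ → X → A → ℝ
  r_measurable : ∀ h ∈ Set.Icc 1 H, ∀ a, Measurable fun x => r h x a
  r_mem : ∀ h ∈ Set.Icc 1 H, ∀ x a, r h x a ∈ Set.Icc (0 : ℝ) 1
  /-- The law of the initial state. -/
  d₁ : Measure X
  d₁_prob : IsProbabilityMeasure d₁

/-- `π h x a` is the probability that `π` plays `a` in state `x` at step `h`; this says that `π` is
a (nonstationary, randomized, measurable) policy. -/
structure IsPolicy {X A : Type*} [MeasurableSpace X] [Fintype A] (π : ℕ → X → A → ℝ) : Prop where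
  nonneg : ∀ h x a, 0 ≤ π h x a
  sum_eq_one : ∀ h x, ∑ a, π h x a = 1
  measurable : ∀ h a, Measurable fun x => π h x a

/-- The law of the state at step `g + 1`, when the state at step `g` has law `μ` and the action at
step `g` is drawn from `π`. -/
def nextLaw {H : ℕ} {X A : Type*} [MeasurableSpace X] [Fintype A] (M : MDP H X A)
    (π : ℕ → X → A → ℝ) (g : ℕ) (μ : Measure X) : Measure X :=
  μ.bind fun x => ∑ a, ENNReal.ofReal (π g x a) • M.P g a x

/-- The law of `x_{h+1+k}` under `π` given `(x_h, a_h) = (x, a)`. -/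
def stateLaw {H : ℕ} {X A : Type*} [MeasurableSpace X] [Fintype A] (M : MDP H X A)
    (π : ℕ → X → A → ℝ) (h : ℕ) (x : X) (a : A) : ℕ → Measure X
  | 0 => M.P h a x
  | k + 1 => nextLaw M π (h + 1 + k) (stateLaw M π h x a k)

/-- `Q_h(x,a) = r_h(x,a) + E^π[∑_{g=h+1}^H (r_g(x_g,a_g) + F_g(x_g)) | (x_h,a_h) = (x,a)]`, the
`Q`-function of `π` with additional rewards `F_g(x_g)` at the later steps. -/
def bonusQ {H : ℕ} {X A : Type*} [MeasurableSpace X] [Fintype A] (M : MDP H X A)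
    (F : ℕ → X → ℝ) (π : ℕ → X → A → ℝ) (h : ℕ) (x : X) (a : A) : ℝ :=
  M.r h x a + ∑ g ∈ Finset.Ioc h H,
    ∫ y, ((∑ b, π g y b * M.r g y b) + F g y) ∂(stateLaw M π h x a (g - (h + 1)))

/-- `V_h(x) = Q_h(x, π_h(x))`. -/
def bonusV {H : ℕ} {X A : Type*} [MeasurableSpace X] [Fintype A] (M : MDP H X A)
    (F : ℕ → X → ℝ) (π : ℕ → X → A → ℝ) (h : ℕ) (x : X) : ℝ :=
  ∑ a, π h x a * bonusQ M F π h x a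

/-- The `Q`-function of the policy `π`. -/
def policyQ {H : ℕ} {X A : Type*} [MeasurableSpace X] [Fintype A] (M : MDP H X A)
    (π : ℕ → X → A → ℝ) (h : ℕ) (x : X) (a : A) : ℝ :=
  bonusQ M (fun _ _ => 0) π h x a

/-- The value function of the policy `π`. -/
def policyV {H : ℕ} {X A : Type*} [MeasurableSpace X] [Fintype A] (M : MDP H X A)
    (π : ℕ → X → A → ℝ) (h : ℕ) (x : X) : ℝ :=
  bonusV M (fun _ _ => 0) π h x

/-- The optimal `Q`-function: the supremum of `Q_h^π(x,a)` over all policies `π`. -/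
def optQ {H : ℕ} {X A : Type*} [MeasurableSpace X] [Fintype A] (M : MDP H X A)
    (h : ℕ) (x : X) (a : A) : ℝ :=
  ⨆ π : {π : ℕ → X → A → ℝ // IsPolicy π}, policyQ M π.1 h x a

/-- The optimal value function: the supremum of `V_h^π(x)` over all policies `π`. -/
def optV {H : ℕ} {X A : Type*} [MeasurableSpace X] [Fintype A] (M : MDP H X A)
    (h : ℕ) (x : X) : ℝ :=
  ⨆ π : {π : ℕ → X → A → ℝ // IsPolicy π}, policyV M π.1 h x

/-! ### Linear Bellman completeness -/

/-- The coefficient vectors that induce linear functions bounded by `1` at step `h`. -/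
def coeffBall {X A : Type*} {d : ℕ} (φ : ℕ → X → A → EuclideanSpace ℝ (Fin d)) (h : ℕ) :
    Set (EuclideanSpace ℝ (Fin d)) :=
  {θ | ∀ x a, |⟪φ h x a, θ⟫| ≤ 1}

/-- Linear Bellman completeness with respect to the features `φ`, where `θr h` is the coefficient
vector of the rewards at step `h`. No backup is needed at the last step. -/
structure IsLinearBellmanComplete {H : ℕ} {X A : Type*} [MeasurableSpace X] {d : ℕ}
    (M : MDP H X A) (φ : ℕ → X → A → EuclideanSpace ℝ (Fin d))
    (θr : ℕ → EuclideanSpace ℝ (Fin d)) : Prop where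
  backup : ∀ h, 1 ≤ h → h < H → ∀ θ ∈ coeffBall φ (h + 1), ∃ θ' ∈ coeffBall φ h, ∀ x a,
    ⟪φ h x a, θ'⟫ = ∫ y, (⨆ b, ⟪φ (h + 1) y b, θ⟫) ∂(M.P h a x)
  reward_mem : ∀ h ∈ Set.Icc 1 H, θr h ∈ coeffBall φ h
  reward_eq : ∀ h ∈ Set.Icc 1 H, ∀ x a, M.r h x a = ⟪φ h x a, θr h⟫

/-- The boundedness assumption, with parameter `B`. -/
structure IsBoundedBy {X A : Type*} {d : ℕ} (H : ℕ)
    (φ : ℕ → X → A → EuclideanSpace ℝ (Fin d)) (θr : ℕ → EuclideanSpace ℝ (Fin d))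
    (B : ℝ) : Prop where
  feature_le : ∀ h ∈ Set.Icc 1 H, ∀ x a, ‖φ h x a‖ ≤ 1
  coeff_le : ∀ h ∈ Set.Icc 1 H, ∀ w ∈ coeffBall φ h, ‖w‖ ≤ B
  reward_le : ∀ h ∈ Set.Icc 1 H, ‖θr h‖ ≤ 1

/-! ### Linear policies -/

/-- The uniform (spherical) probability measure on the unit sphere. -/
def sphereProb (d : ℕ) : Measure (Metric.sphere (0 : EuclideanSpace ℝ (Fin d)) 1) :=
  ((volume : Measure (EuclideanSpace ℝ (Fin d))).toSphere Set.univ)⁻¹ •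
    (volume : Measure (EuclideanSpace ℝ (Fin d))).toSphere

/-- The actions maximizing `⟪w, ψ a⟫`, where `ψ a` is the feature vector of `a`. -/
def argmaxSet {A : Type*} {d : ℕ} (ψ : A → EuclideanSpace ℝ (Fin d))
    (w : EuclideanSpace ℝ (Fin d)) : Set A :=
  {a | ∀ b, ⟪w, ψ b⟫ ≤ ⟪w, ψ a⟫}

/-- The directions in which `a` beats all actions of the argmax set with a different feature
vector. -/
def tieBreakSet {A : Type*} {d : ℕ} (ψ : A → EuclideanSpace ℝ (Fin d))
    (w : EuclideanSpace ℝ (Fin d)) (a : A) :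
    Set (Metric.sphere (0 : EuclideanSpace ℝ (Fin d)) 1) :=
  {θ | ∀ b ∈ argmaxSet ψ w, ψ b ≠ ψ a → ⟪θ.1, ψ b⟫ < ⟪θ.1, ψ a⟫}

open Classical in
/-- The linear policy `a ↦ π_w(a)` at a state with feature vectors `ψ`: play an action maximizing
`⟪w, ψ a⟫`, break ties by the maximum of `⟪θ, ψ a⟫` for a uniformly random direction `θ`, and break
the remaining ties, between actions with one and the same feature vector, uniformly. -/
def linPolicy {A : Type*} {d : ℕ} (ψ : A → EuclideanSpace ℝ (Fin d))
    (w : EuclideanSpace ℝ (Fin d)) (a : A) : ℝ :=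
  if a ∈ argmaxSet ψ w then
    (sphereProb d).real (tieBreakSet ψ w a) / (Set.ncard {b | ψ b = ψ a} : ℝ)
  else 0

/-! ### Parameters -/

/-- The number of actions `A`, the horizon `H`, the dimension `d`, the bound `B`, the confidence
`δ`, the target accuracy `εfinal`, and the four constants: `Cpsd` from the concentration of
empirical covariance matrices, `Ccor` from the lower bound on the truncated linear bonus, `Cphi`
from the regression bound, `Cthm` from the bound on the number of rounds. -/
structure Params where
  A : ℕ
  H : ℕ
  d : ℕ
  B : ℝ
  δ : ℝ
  εfinal : ℝ
  Cpsd : ℝ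
  Ccor : ℝ
  Cphi : ℝ
  Cthm : ℝ

namespace Params

/-- The number of rounds. -/
def T (p : Params) : ℕ :=
  ⌈(p.d : ℝ) * (p.Cthm * p.H ^ 4 * p.B ^ 3 * p.d * √p.A *
    √(Real.log (p.H * p.A * p.B * p.d / (p.εfinal * p.δ))) / p.εfinal) ^ (6 * p.A + 2)⌉₊

/-- The number of samples per round and step. -/
def n (p : Params) : ℕ := 3 * p.T

/-- The regularization parameter `λ`. -/
def lam (p : Params) : ℝ := p.Cpsd * p.d * Real.log (2 * p.T * p.H * p.n / p.δ)

def iota (p : Params) : ℝ := Real.log (p.T * p.H * (p.lam * p.d + p.n) / p.δ)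

def lam1 (p : Params) : ℝ := p.B * p.H

def epsBkup (p : Params) : ℝ := p.εfinal / (2 * p.H)

def sigmaTr (p : Params) : ℝ := p.epsBkup / (4 * p.lam1)

def epsApx (p : Params) : ℝ :=
  p.epsBkup / (128 * √(2 * Real.pi) * p.Cphi * p.lam1 ^ 2 * p.H * p.B * p.d * √p.iota)

def beta (p : Params) : ℝ :=
  4 * p.Cphi * p.H * p.B * √(p.d * p.iota) * (5 * p.lam1 * √p.d) *
    (p.Ccor / p.epsApx) ^ (2 * p.A)

def xi (p : Params) : ℝ :=
  p.beta / (4 * p.Cphi * p.H * p.B * √(p.d * p.iota) * (2 * √(2 * Real.pi) * p.lam1 * √p.d))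

end Params

/-! ### Bonuses -/

/-- `Σ'` of the `σ`-truncated pair of a symmetric matrix `Γ = U D Uᵀ`: the matrix `U D₊ Uᵀ`, where
`D₊` has the entry `1` where `D` has an entry `≥ σ`, and `0` elsewhere. -/
def truncHigh {d : ℕ} (Γ : Matrix (Fin d) (Fin d) ℝ) (σ : ℝ) : Matrix (Fin d) (Fin d) ℝ :=
  cfc (fun s : ℝ => if σ ≤ s then (1 : ℝ) else 0) Γ

/-- `Λ'` of the `σ`-truncated pair of a symmetric matrix `Γ = U D Uᵀ`: the matrix `U D₋ Uᵀ`, where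
`D₋` has the entry `0` where `D` has an entry `≥ σ`, and `1` elsewhere. -/
def truncLow {d : ℕ} (Γ : Matrix (Fin d) (Fin d) ℝ) (σ : ℝ) : Matrix (Fin d) (Fin d) ℝ :=
  cfc (fun s : ℝ => if σ ≤ s then (0 : ℝ) else 1) Γ

/-- `max_{φ ∈ Φ} ⟪u, φ⟫`. -/
def supportFun {d : ℕ} (Φ : Set (EuclideanSpace ℝ (Fin d))) (u : EuclideanSpace ℝ (Fin d)) : ℝ :=
  sSup ((fun v => ⟪u, v⟫) '' Φ)

/-- The truncated linear bonus. -/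
def truncLinBonus {d : ℕ} (Φ : Set (EuclideanSpace ℝ (Fin d)))
    (u v : EuclideanSpace ℝ (Fin d)) : ℝ :=
  supportFun Φ u + supportFun Φ v - supportFun Φ (u + v)

/-- The bonus at a state with feature vectors `ψ a`, when the covariance matrix is `S`. -/
def bonusAt (p : Params) {A : Type*} (ψ : A → EuclideanSpace ℝ (Fin p.d))
    (S : Matrix (Fin p.d) (Fin p.d) ℝ) : ℝ :=
  let Γ := (p.beta / p.lam1) • CFC.sqrt S⁻¹
  let S' := truncHigh Γ p.sigmaTr
  let L' := truncLow Γ p.sigmaTr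
  p.lam1 * (p.Ccor / p.epsApx) ^ (2 * p.A) *
      (∫ u, ∫ v, truncLinBonus (convexHull ℝ (Set.range ψ)) (p.beta • u) v
        ∂(multivariateGaussian 0 L') ∂(multivariateGaussian 0 S')) +
    2 * √(2 * Real.pi) * p.lam1 * p.xi *
      ∫ w, (⨆ a, ⟪w, ψ a⟫) ∂(multivariateGaussian 0 S')

/-! ### The algorithm

Everything that the algorithm computes in round `t` at step `h` is a function of the sampled
trajectories and of the arbitrary policy used in round `1`. -/

/-- A realization of the sampled trajectories: `D t h i k` is the `k`-th state-action pair of the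
`i`-th trajectory that is sampled in round `t` for step `h`. -/
abbrev SampleData (X A : Type*) := ℕ → ℕ → ℕ → ℕ → X × A

/-- The number of trajectories sampled in round `t` for each step. There is no earlier policy to
sample from in round `1`, so that no trajectories are sampled there. -/
def Params.numSamples (p : Params) (t : ℕ) : ℕ := if t = 1 then 0 else p.n

/-- The feature vector at step `h` of the `i`-th trajectory sampled in round `t` for step `h`. -/
def sampleFeature {X A : Type*} {d : ℕ} (φ : ℕ → X → A → EuclideanSpace ℝ (Fin d))
    (D : SampleData X A) (t h i : ℕ) : EuclideanSpace ℝ (Fin d) :=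
  φ h (D t h i h).1 (D t h i h).2

/-- The regularized empirical covariance matrix `Σ_h^t`. -/
def covMatrix (p : Params) {X A : Type*} (φ : ℕ → X → A → EuclideanSpace ℝ (Fin p.d))
    (D : SampleData X A) (t h : ℕ) : Matrix (Fin p.d) (Fin p.d) ℝ :=
  p.lam • (1 : Matrix (Fin p.d) (Fin p.d) ℝ) + ∑ i ∈ Finset.Icc 1 (p.numSamples t),
    Matrix.vecMulVec (sampleFeature φ D t h i).ofLp (sampleFeature φ D t h i).ofLp

/-- The bonus function `F_h^t`. -/
def bonus (p : Params) {X A : Type*} (φ : ℕ → X → A → EuclideanSpace ℝ (Fin p.d))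
    (D : SampleData X A) (t h : ℕ) (x : X) : ℝ :=
  bonusAt p (φ h x) (covMatrix p φ D t h)

/-- The regression label `r_h^{t,i,h} + ∑_{g=h+1}^H (r_g^{t,i,h} + F_g^t(x_g^{t,i,h}))`. -/
def regLabel (p : Params) {X A : Type*} [MeasurableSpace X] (M : MDP p.H X A)
    (φ : ℕ → X → A → EuclideanSpace ℝ (Fin p.d)) (D : SampleData X A) (t h i : ℕ) : ℝ :=
  M.r h (D t h i h).1 (D t h i h).2 + ∑ g ∈ Finset.Ioc h p.H,
    (M.r g (D t h i g).1 (D t h i g).2 + bonus p φ D t g (D t h i g).1)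

/-- The regression estimate `ŵ_h^t`. -/
def wHat (p : Params) {X A : Type*} [MeasurableSpace X] (M : MDP p.H X A)
    (φ : ℕ → X → A → EuclideanSpace ℝ (Fin p.d)) (D : SampleData X A) (t h : ℕ) :
    EuclideanSpace ℝ (Fin p.d) :=
  Matrix.toEuclideanLin (covMatrix p φ D t h)⁻¹
    (∑ i ∈ Finset.Icc 1 (p.numSamples t), regLabel p M φ D t h i • sampleFeature φ D t h i)

/-- The policy `π̂^t`: an arbitrary policy `π₁` for `t = 1`, and else the linear policy with
coefficient vector `ŵ_h^t` at step `h`. -/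
def piHat (p : Params) {X A : Type*} [MeasurableSpace X] (M : MDP p.H X A)
    (φ : ℕ → X → A → EuclideanSpace ℝ (Fin p.d)) (π₁ : ℕ → X → A → ℝ) (D : SampleData X A)
    (t h : ℕ) (x : X) (a : A) : ℝ :=
  if t = 1 then π₁ h x a else linPolicy (φ h x) (wHat p M φ D t h) a

/-- The optimistic `Q`-function `Q_h^t`. -/
def optimisticQ (p : Params) {X A : Type*} [MeasurableSpace X] [Fintype A] (M : MDP p.H X A)
    (φ : ℕ → X → A → EuclideanSpace ℝ (Fin p.d)) (π₁ : ℕ → X → A → ℝ) (D : SampleData X A)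
    (t h : ℕ) (x : X) (a : A) : ℝ :=
  bonusQ M (bonus p φ D t) (piHat p M φ π₁ D t) h x a

/-- The optimistic value function `V_h^t(x) = Q_h^t(x, π̂_h^t(x))`. -/
def optimisticV (p : Params) {X A : Type*} [MeasurableSpace X] [Fintype A] (M : MDP p.H X A)
    (φ : ℕ → X → A → EuclideanSpace ℝ (Fin p.d)) (π₁ : ℕ → X → A → ℝ) (D : SampleData X A)
    (t h : ℕ) (x : X) : ℝ :=
  bonusV M (bonus p φ D t) (piHat p M φ π₁ D t) h x

/-- The regression-accuracy event, as a set of realizations of the sampled trajectories: the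
estimate `ŵ_h^t` is close to the coefficient vector `w_h^t` of `Q_h^t`. Under the boundedness
assumption the features span the space, so that there is at most one such vector. -/
def regressionEvent (p : Params) {X A : Type*} [MeasurableSpace X] [Fintype A] (M : MDP p.H X A)
    (φ : ℕ → X → A → EuclideanSpace ℝ (Fin p.d)) (π₁ : ℕ → X → A → ℝ) :
    Set (SampleData X A) :=
  {D | ∀ h ∈ Set.Icc 1 p.H, ∀ t ∈ Set.Icc 1 p.T, ∀ w : EuclideanSpace ℝ (Fin p.d),
    (∀ x a, optimisticQ p M φ π₁ D t h x a = ⟪φ h x a, w⟫) →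
    ∀ v : EuclideanSpace ℝ (Fin p.d),
      |⟪v, wHat p M φ D t h - w⟫| ≤
        p.beta * √(v.ofLp ⬝ᵥ ((covMatrix p φ D t h)⁻¹ *ᵥ v.ofLp))}

end

noncomputable section

/-! Optimism is proved by backward induction on the step. The invariant, `exists_linear_between`, is
a linear function `⟪φ h x a, w⟫` that lies above the Q-functions of all policies and below `Q_h^t +
ε_bkup (H - h)`. Its coefficient vector is `θr h` plus the backup of `max_a ⟪φ (h+1) y a, w'⟫`,
where `w'` comes from the next step, so it is the solution of the optimal Bellman equation. It is
bounded by `H - h + 1`, hence `‖w‖ ≤ BH = λ₁`. By the Bellman equation `bonusQ_eq`, the induction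
step reduces to one inequality at a single state, `maxInner_le_optimisticV`: `max_a ⟪w, φ a⟫ ≤ V^t +
F^t + ε_bkup (H + 1 - h)`.

Let `t ≥ 2`, let `Q^t = ⟪φ, v⟫`, and let `i` be an action that the policy plays, so that `φ i`
maximizes `ŵ` over the convex hull of the features. For `y` in this hull, `⟪v, y - φ i⟫ ≤ ⟪v - ŵ, y
- φ i⟫`, which on the regression event is at most `β` times the confidence norm of `y - φ i`; and
`⟪w, y⟫ ≤ ⟪v, y⟫ + ε_bkup (H - h)` since the invariant is linear. It therefore suffices to find `y`
close to `φ i` in the confidence norm that maximizes `w` up to the bonus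
(`exists_convex_combination`).

Split `w` along the eigenspaces `Σ'` and `Λ'`. The low part of the confidence norm is small by the
choice of `σ_tr`, so only the high part of `y - φ i` has to be small. The high part of `w` costs at
most the width of the features under `Σ'`, which the Gaussian maximum in the bonus dominates. If no
`y` also almost maximizes the low part of `w`, a separating hyperplane yields a direction in which
the truncated linear bonus is bounded below (`exists_le_familyBonus`). This bound survives small
perturbations, and only differences of features matter, which span at most `A - 1` dimensions. A
Gaussian small ball estimate then costs a factor of order `ε_apx^(2(A-1))`, which
`(C_cor/ε_apx)^(2A)` more than compensates, so that the bonus exceeds the trivial bound `2 λ₁`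
(`le_integral_familyBonus`).

The regression event says something only if `Q^t` is linear in the features
(`exists_optimisticQ_eq`). Bellman completeness makes backups of maxima of linear functions linear,
and linearity passes to averages and pointwise limits. The bonus is an average of such maxima, and
the value of a linear policy is a limit of difference quotients of them
(`isLinearIn_integral_linPolicy`). In round 1 the policy is arbitrary, but the covariance is `λ I`,
all eigenvalues are kept, and the bonus alone dominates every difference of linear functions
(`le_bonusAt_smul_one`). -/

/-- A bounded measurable real-valued function. -/
structure BddMeas {X : Type*} [MeasurableSpace X] (f : X → ℝ) : Prop where
  measurable : Measurable f
  bounded : ∃ C, ∀ x, |f x| ≤ C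

/-! ### Calculus of bounded measurable functions -/

namespace BddMeas

variable {X : Type*} [MeasurableSpace X] {f g : X → ℝ}

lemma integrable (hf : BddMeas f) (μ : Measure X) [IsFiniteMeasure μ] : Integrable f μ := by
  obtain ⟨C, hC⟩ := hf.bounded
  exact Integrable.of_bound hf.measurable.aestronglyMeasurable C (ae_of_all _ hC)

lemma const (c : ℝ) : BddMeas (fun _ : X => c) := ⟨measurable_const, |c|, fun _ => le_rfl⟩

lemma add (hf : BddMeas f) (hg : BddMeas g) : BddMeas (fun x => f x + g x) := by
  obtain ⟨C, hC⟩ := hf.bounded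
  obtain ⟨D, hD⟩ := hg.bounded
  exact ⟨hf.measurable.add hg.measurable, C + D,
    fun x => (abs_add_le _ _).trans (add_le_add (hC x) (hD x))⟩

lemma mul (hf : BddMeas f) (hg : BddMeas g) : BddMeas (fun x => f x * g x) := by
  obtain ⟨C, hC⟩ := hf.bounded
  obtain ⟨D, hD⟩ := hg.bounded
  refine ⟨hf.measurable.mul hg.measurable, C * D, fun x => ?_⟩
  rw [abs_mul]
  exact mul_le_mul (hC x) (hD x) (abs_nonneg _) ((abs_nonneg _).trans (hC x))

lemma const_mul (c : ℝ) (hf : BddMeas f) : BddMeas (fun x => c * f x) := (const c).mul hf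

lemma sum {ι : Type*} (s : Finset ι) {f : ι → X → ℝ} (hf : ∀ i ∈ s, BddMeas (f i)) :
    BddMeas (fun x => ∑ i ∈ s, f i x) := by
  classical
  induction s using Finset.induction_on with
  | empty => simpa using const (X := X) 0
  | insert a s ha ih =>
    simp only [Finset.sum_insert ha]
    exact (hf a (by simp)).add (ih fun i hi => hf i (by simp [hi]))

lemma abs_integral_le {C : ℝ} (hC : ∀ x, |f x| ≤ C) (μ : Measure X) [IsProbabilityMeasure μ] :
    |∫ x, f x ∂μ| ≤ C := by
  simpa using norm_integral_le_of_norm_le_const (μ := μ) (f := f) (ae_of_all _ hC)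

lemma kernel_integral {Y : Type*} [MeasurableSpace Y] (κ : Kernel Y X) [IsMarkovKernel κ]
    (hf : BddMeas f) : BddMeas (fun y => ∫ x, f x ∂(κ y)) := by
  obtain ⟨C, hC⟩ := hf.bounded
  exact ⟨(StronglyMeasurable.integral_kernel (κ := κ) hf.measurable.stronglyMeasurable).measurable,
    C, fun y => abs_integral_le hC _⟩

end BddMeas

/-- A randomized measurable action rule at a single step. -/
structure IsActionRule {X A : Type*} [MeasurableSpace X] [Fintype A] (π : X → A → ℝ) : Prop where
  nonneg : ∀ x a, 0 ≤ π x a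
  sum_eq_one : ∀ x, ∑ a, π x a = 1
  measurable : ∀ a, Measurable fun x => π x a

lemma IsPolicy.isActionRule {X A : Type*} [MeasurableSpace X] [Fintype A] {π : ℕ → X → A → ℝ}
    (hπ : IsPolicy π) (h : ℕ) : IsActionRule (π h) :=
  ⟨hπ.nonneg h, hπ.sum_eq_one h, hπ.measurable h⟩

/-! ### Conditional state laws and the Bellman equation -/

section Recursion

variable {H : ℕ} {X A : Type*} [MeasurableSpace X] [Fintype A]

lemma IsActionRule.bddMeas {π : X → A → ℝ} (hπ : IsActionRule π) (a : A) :
    BddMeas (fun x => π x a) := by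
  refine ⟨hπ.measurable a, 1, fun x => ?_⟩
  rw [abs_of_nonneg (hπ.nonneg x a), ← hπ.sum_eq_one x]
  exact Finset.single_le_sum (f := fun a => π x a) (fun b _ => hπ.nonneg x b) (Finset.mem_univ a)

lemma IsActionRule.average {π : X → A → ℝ} (hπ : IsActionRule π) {f : X → A → ℝ}
    (hf : ∀ a, BddMeas fun x => f x a) : BddMeas (fun x => ∑ a, π x a * f x a) :=
  BddMeas.sum _ fun a _ => (hπ.bddMeas a).mul (hf a)

/-- The one-step transition kernel of an action rule. -/
def stepKernel (M : MDP H X A) (π : ℕ → X → A → ℝ) (g : ℕ) (hπ : IsActionRule (π g)) :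
    Kernel X X where
  toFun := fun x => ∑ a, ENNReal.ofReal (π g x a) • M.P g a x
  measurable' := by
    refine Measure.measurable_of_measurable_coe _ fun s hs => ?_
    simp only [Measure.coe_finsetSum, Measure.coe_smul, Finset.sum_apply, Pi.smul_apply, smul_eq_mul]
    exact Finset.measurable_sum _ fun a _ =>
      ((hπ.measurable a).ennreal_ofReal).mul (Kernel.measurable_coe _ hs)

lemma stepKernel_apply (M : MDP H X A) (π : ℕ → X → A → ℝ) (g : ℕ) (hπ : IsActionRule (π g))
    (x : X) : stepKernel M π g hπ x = ∑ a, ENNReal.ofReal (π g x a) • M.P g a x := rfl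

instance (M : MDP H X A) (h : ℕ) (a : A) : IsMarkovKernel (M.P h a) := M.markov h a

instance stepKernel_markov (M : MDP H X A) (π : ℕ → X → A → ℝ) (g : ℕ)
    (hπ : IsActionRule (π g)) : IsMarkovKernel (stepKernel M π g hπ) := by
  refine ⟨fun x => ⟨?_⟩⟩
  rw [stepKernel_apply]
  simp only [Measure.coe_finsetSum, Measure.coe_smul, Finset.sum_apply, Pi.smul_apply, smul_eq_mul,
    measure_univ, mul_one]
  rw [← ENNReal.ofReal_sum_of_nonneg fun a _ => hπ.nonneg x a, hπ.sum_eq_one, ENNReal.ofReal_one]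

lemma integral_stepKernel (M : MDP H X A) (π : ℕ → X → A → ℝ) (g : ℕ) (hπ : IsActionRule (π g))
    {f : X → ℝ} (hf : BddMeas f) (x : X) :
    ∫ y, f y ∂(stepKernel M π g hπ x) = ∑ a, π g x a * ∫ y, f y ∂(M.P g a x) := by
  rw [stepKernel_apply, integral_finsetSum_measure]
  · refine Finset.sum_congr rfl fun a _ => ?_
    rw [integral_smul_measure, ENNReal.toReal_ofReal (hπ.nonneg x a), smul_eq_mul]
  · exact fun a _ => (hf.integrable _).smul_measure ENNReal.ofReal_ne_top

lemma nextLaw_eq (M : MDP H X A) (π : ℕ → X → A → ℝ) (g : ℕ) (hπ : IsActionRule (π g))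
    (μ : Measure X) : nextLaw M π g μ = μ.bind (stepKernel M π g hπ) := rfl

lemma integral_nextLaw (M : MDP H X A) (π : ℕ → X → A → ℝ) (g : ℕ) (hπ : IsActionRule (π g))
    (μ : Measure X) [IsProbabilityMeasure μ] {f : X → ℝ} (hf : BddMeas f) :
    ∫ y, f y ∂(nextLaw M π g μ) = ∫ x, ∑ a, π g x a * ∫ y, f y ∂(M.P g a x) ∂μ := by
  have h1 : nextLaw M π g μ = (stepKernel M π g hπ ∘ₖ Kernel.const Unit μ) () := by
    rw [Kernel.comp_apply, Kernel.const_apply, nextLaw_eq M π g hπ]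
  rw [h1, Kernel.integral_comp (hf.integrable _), Kernel.const_apply]
  exact integral_congr_ae (ae_of_all _ fun x => integral_stepKernel M π g hπ hf x)

/-- The average of `f` at the next state, when the action is drawn from `π`. -/
def stepAverage (M : MDP H X A) (π : ℕ → X → A → ℝ) (g : ℕ) (f : X → ℝ) (x : X) : ℝ :=
  ∑ a, π g x a * ∫ y, f y ∂(M.P g a x)

lemma stepAverage_bddMeas (M : MDP H X A) {π : ℕ → X → A → ℝ} {g : ℕ} (hπ : IsActionRule (π g))
    {f : X → ℝ} (hf : BddMeas f) : BddMeas (stepAverage M π g f) :=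
  hπ.average fun _ => hf.kernel_integral _

lemma stateLaw_isProbabilityMeasure (M : MDP H X A) {π : ℕ → X → A → ℝ} {h : ℕ} (x : X) (a : A)
    (k : ℕ) (hπ : ∀ g, h < g → g ≤ h + k → IsActionRule (π g)) :
    IsProbabilityMeasure (stateLaw M π h x a k) := by
  induction k with
  | zero => exact inferInstanceAs (IsProbabilityMeasure (M.P h a x))
  | succ k ih =>
    have := ih fun g h1 h2 => hπ g h1 (by omega)
    have hg := hπ (h + 1 + k) (by omega) (by omega)
    rw [stateLaw, nextLaw_eq M π _ hg]
    infer_instance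

lemma integral_stateLaw_succ (M : MDP H X A) {π : ℕ → X → A → ℝ} {h : ℕ} (x : X) (a : A)
    (k : ℕ) (hπ : ∀ g, h < g → g ≤ h + (k + 1) → IsActionRule (π g)) {f : X → ℝ}
    (hf : BddMeas f) :
    ∫ y, f y ∂(stateLaw M π h x a (k + 1)) =
      ∫ y, stepAverage M π (h + 1 + k) f y ∂(stateLaw M π h x a k) := by
  have := stateLaw_isProbabilityMeasure M x a k fun g h1 h2 => hπ g h1 (by omega)
  rw [stateLaw, integral_nextLaw M π _ (hπ _ (by omega) (by omega)) _ hf]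
  rfl

lemma integral_stateLaw_bddMeas (M : MDP H X A) {π : ℕ → X → A → ℝ} {h : ℕ} (a : A)
    (k : ℕ) (hπ : ∀ g, h < g → g ≤ h + k → IsActionRule (π g)) {f : X → ℝ}
    (hf : BddMeas f) : BddMeas (fun x => ∫ y, f y ∂(stateLaw M π h x a k)) := by
  induction k generalizing f with
  | zero => exact hf.kernel_integral (M.P h a)
  | succ k ih =>
    simp only [integral_stateLaw_succ M _ a k hπ hf]
    exact ih (fun g h1 h2 => hπ g h1 (by omega))
      (stepAverage_bddMeas M (hπ _ (by omega) (by omega)) hf)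

/-- Chapman–Kolmogorov: `stateLaw` appends transitions at the end, whereas the Bellman equation
splits off the first one. Induction on the number of steps, moving the last transition into the
integrand. -/
lemma integral_stateLaw_succ_eq_first_step (M : MDP H X A) {π : ℕ → X → A → ℝ} {h : ℕ} (x : X)
    (a : A) (k : ℕ) (hπ : ∀ g, h < g → g ≤ h + (k + 1) → IsActionRule (π g)) {f : X → ℝ}
    (hf : BddMeas f) :
    ∫ y, f y ∂(stateLaw M π h x a (k + 1)) =
      ∫ y, ∑ b, π (h + 1) y b * ∫ z, f z ∂(stateLaw M π (h + 1) y b k) ∂(M.P h a x) := by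
  induction k generalizing f with
  | zero => exact integral_stateLaw_succ M x a 0 hπ hf
  | succ k ih =>
    rw [integral_stateLaw_succ M x a (k + 1) hπ hf,
      ih (fun g h1 h2 => hπ g h1 (by omega))
        (stepAverage_bddMeas M (hπ _ (by omega) (by omega)) hf)]
    refine integral_congr_ae (ae_of_all _ fun y => Finset.sum_congr rfl fun b _ => ?_)
    rw [integral_stateLaw_succ M y b k (fun g h1 h2 => hπ g (by omega) (by omega)) hf,
      show h + 1 + (k + 1) = h + 1 + 1 + k by omega]

omit [Fintype A] in
lemma reward_bddMeas (M : MDP H X A) {h : ℕ} (hh : h ∈ Set.Icc 1 H) (a : A) :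
    BddMeas (fun x => M.r h x a) :=
  ⟨M.r_measurable h hh a, 1, fun x => abs_le.2
    ⟨by linarith [(M.r_mem h hh x a).1], (M.r_mem h hh x a).2⟩⟩

variable {M : MDP H X A} {F : ℕ → X → ℝ} {π : ℕ → X → A → ℝ}

lemma bonusQ_bddMeas (hπ : ∀ g ∈ Set.Icc 1 H, IsActionRule (π g))
    (hF : ∀ g ∈ Set.Icc 1 H, BddMeas (F g)) {h : ℕ} (hh : h ∈ Set.Icc 1 H) (a : A) :
    BddMeas (fun x => bonusQ M F π h x a) := by
  obtain ⟨h1, h2⟩ := hh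
  refine (reward_bddMeas M ⟨h1, h2⟩ a).add (BddMeas.sum _ fun g hg => ?_)
  rw [Finset.mem_Ioc] at hg
  have hg' : g ∈ Set.Icc 1 H := ⟨by omega, hg.2⟩
  refine integral_stateLaw_bddMeas M a _ (fun i hi1 hi2 => hπ i ⟨by omega, by omega⟩) ?_
  exact ((hπ g hg').average fun b => reward_bddMeas M hg' b).add (hF g hg')

lemma bonusV_bddMeas (hπ : ∀ g ∈ Set.Icc 1 H, IsActionRule (π g))
    (hF : ∀ g ∈ Set.Icc 1 H, BddMeas (F g)) {h : ℕ} (hh : h ∈ Set.Icc 1 H) :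
    BddMeas (bonusV M F π h) :=
  (hπ h hh).average fun a => bonusQ_bddMeas hπ hF hh a

lemma bonusQ_last (x : X) (a : A) : bonusQ M F π H x a = M.r H x a := by
  simp [bonusQ]

/-- The Bellman equation. -/
lemma bonusQ_eq (hπ : ∀ g ∈ Set.Icc 1 H, IsActionRule (π g))
    (hF : ∀ g ∈ Set.Icc 1 H, BddMeas (F g)) {h : ℕ} (h1 : 1 ≤ h) (h2 : h < H) (x : X) (a : A) :
    bonusQ M F π h x a =
      M.r h x a + ∫ y, (bonusV M F π (h + 1) y + F (h + 1) y) ∂(M.P h a x) := by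
  have hh : h + 1 ∈ Set.Icc 1 H := ⟨by omega, h2⟩
  have hstep : ∀ g ∈ Set.Icc 1 H, BddMeas (fun y => (∑ b, π g y b * M.r g y b) + F g y) :=
    fun g hg => ((hπ g hg).average fun b => reward_bddMeas M hg b).add (hF g hg)
  have hlaw : ∀ g ∈ Finset.Ioc (h + 1) H, ∀ b, BddMeas (fun y =>
      ∫ z, ((∑ b, π g z b * M.r g z b) + F g z) ∂(stateLaw M π (h + 1) y b (g - (h + 1 + 1)))) := by
    intro g hg b
    rw [Finset.mem_Ioc] at hg
    exact integral_stateLaw_bddMeas M b _ (fun i hi1 hi2 => hπ i ⟨by omega, by omega⟩)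
      (hstep g ⟨by omega, hg.2⟩)
  have key : ∀ y, bonusV M F π (h + 1) y + F (h + 1) y =
      ((∑ b, π (h + 1) y b * M.r (h + 1) y b) + F (h + 1) y) +
      ∑ g ∈ Finset.Ioc (h + 1) H, ∑ b, π (h + 1) y b *
        ∫ z, ((∑ b, π g z b * M.r g z b) + F g z)
          ∂(stateLaw M π (h + 1) y b (g - (h + 1 + 1))) := by
    intro y
    rw [Finset.sum_comm]
    simp only [bonusV, bonusQ, mul_add, Finset.sum_add_distrib, Finset.mul_sum]
    ring
  have hsplit : Finset.Ioc h H = insert (h + 1) (Finset.Ioc (h + 1) H) := by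
    ext i
    simp only [Finset.mem_insert, Finset.mem_Ioc]
    omega
  simp only [key]
  rw [integral_add ((hstep _ hh).integrable _)
      ((BddMeas.sum _ fun g hg => (hπ _ hh).average fun b => hlaw g hg b).integrable _),
    integral_finsetSum _ fun g hg =>
      ((hπ _ hh).average fun b => hlaw g hg b).integrable _,
    bonusQ, hsplit, Finset.sum_insert (by simp)]
  congr 2
  · simp [stateLaw]
  · refine Finset.sum_congr rfl fun g hg => ?_
    rw [Finset.mem_Ioc] at hg
    rw [show g - (h + 1) = g - (h + 1 + 1) + 1 by omega]
    exact integral_stateLaw_succ_eq_first_step M x a _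
      (fun i hi1 hi2 => hπ i ⟨by omega, by omega⟩) (hstep g ⟨by omega, hg.2⟩)

end Recursion

/-! ### Maxima of linear functions -/

section MaxInner

variable {A : Type*} {d : ℕ}

/-- `max_a ⟪u, ψ a⟫`. -/
def maxInner (ψ : A → EuclideanSpace ℝ (Fin d)) (u : EuclideanSpace ℝ (Fin d)) : ℝ :=
  ⨆ a, ⟪u, ψ a⟫

/-- The truncated linear bonus of a finite family of feature vectors. -/
def familyBonus (ψ : A → EuclideanSpace ℝ (Fin d)) (u v : EuclideanSpace ℝ (Fin d)) : ℝ :=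
  maxInner ψ u + maxInner ψ v - maxInner ψ (u + v)

variable [Finite A] {ψ : A → EuclideanSpace ℝ (Fin d)}

lemma le_maxInner (ψ : A → EuclideanSpace ℝ (Fin d)) (u : EuclideanSpace ℝ (Fin d)) (a : A) :
    ⟪u, ψ a⟫ ≤ maxInner ψ u :=
  le_ciSup (f := fun a => ⟪u, ψ a⟫) (Set.finite_range _).bddAbove a

lemma inner_le_maxInner_of_mem_convexHull {φ : EuclideanSpace ℝ (Fin d)}
    (hφ : φ ∈ convexHull ℝ (Set.range ψ)) (u : EuclideanSpace ℝ (Fin d)) :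
    ⟪u, φ⟫ ≤ maxInner ψ u := by
  have hc : Convex ℝ {y : EuclideanSpace ℝ (Fin d) | ⟪u, y⟫ ≤ maxInner ψ u} :=
    convex_halfSpace_le ((innerSL ℝ u).toLinearMap.isLinear) _
  refine convexHull_min ?_ hc hφ
  rintro _ ⟨a, rfl⟩
  exact le_maxInner ψ u a

variable [Nonempty A]

lemma exists_maxInner_eq (ψ : A → EuclideanSpace ℝ (Fin d)) (u : EuclideanSpace ℝ (Fin d)) :
    ∃ a, maxInner ψ u = ⟪u, ψ a⟫ := by
  obtain ⟨a, ha⟩ := exists_eq_ciSup_of_finite (f := fun a => ⟪u, ψ a⟫)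
  exact ⟨a, ha.symm⟩

omit [Finite A] in
lemma maxInner_le {u : EuclideanSpace ℝ (Fin d)} {c : ℝ} (h : ∀ a, ⟪u, ψ a⟫ ≤ c) :
    maxInner ψ u ≤ c := ciSup_le h

lemma supportFun_convexHull_range (u : EuclideanSpace ℝ (Fin d)) :
    supportFun (convexHull ℝ (Set.range ψ)) u = maxInner ψ u := by
  obtain ⟨a, ha⟩ := exists_maxInner_eq ψ u
  refine IsLUB.csSup_eq ⟨?_, ?_⟩ ⟨_, ψ a, subset_convexHull ℝ _ ⟨a, rfl⟩, rfl⟩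
  · rintro _ ⟨φ, hφ, rfl⟩
    exact inner_le_maxInner_of_mem_convexHull hφ u
  · intro b hb
    rw [ha]
    exact hb ⟨ψ a, subset_convexHull ℝ _ ⟨a, rfl⟩, rfl⟩

lemma truncLinBonus_convexHull_range (u v : EuclideanSpace ℝ (Fin d)) :
    truncLinBonus (convexHull ℝ (Set.range ψ)) u v = familyBonus ψ u v := by
  simp only [truncLinBonus, supportFun_convexHull_range, familyBonus]

lemma maxInner_add_le (u v : EuclideanSpace ℝ (Fin d)) :
    maxInner ψ (u + v) ≤ maxInner ψ u + maxInner ψ v :=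
  maxInner_le fun a => by
    rw [inner_add_left]
    exact add_le_add (le_maxInner ψ u a) (le_maxInner ψ v a)

omit [Finite A] [Nonempty A] in
lemma maxInner_smul {c : ℝ} (hc : 0 ≤ c) (u : EuclideanSpace ℝ (Fin d)) :
    maxInner ψ (c • u) = c * maxInner ψ u := by
  simp only [maxInner, real_inner_smul_left]
  exact (Real.mul_iSup_of_nonneg hc _).symm

omit [Finite A] in
lemma maxInner_le_norm (hψ : ∀ a, ‖ψ a‖ ≤ 1) (u : EuclideanSpace ℝ (Fin d)) :
    maxInner ψ u ≤ ‖u‖ :=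
  maxInner_le fun a => (real_inner_le_norm _ _).trans
    (mul_le_of_le_one_right (norm_nonneg _) (hψ a))

lemma maxInner_sub_le (hψ : ∀ a, ‖ψ a‖ ≤ 1) (u v : EuclideanSpace ℝ (Fin d)) :
    maxInner ψ u - maxInner ψ v ≤ ‖u - v‖ := by
  have h1 := maxInner_add_le (ψ := ψ) (u - v) v
  rw [sub_add_cancel] at h1
  linarith [maxInner_le_norm hψ (u - v)]

lemma abs_maxInner_sub_le (hψ : ∀ a, ‖ψ a‖ ≤ 1) (u v : EuclideanSpace ℝ (Fin d)) :
    |maxInner ψ u - maxInner ψ v| ≤ ‖u - v‖ :=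
  abs_sub_le_iff.2 ⟨maxInner_sub_le hψ u v, norm_sub_rev u v ▸ maxInner_sub_le hψ v u⟩

lemma abs_maxInner_le (hψ : ∀ a, ‖ψ a‖ ≤ 1) (u : EuclideanSpace ℝ (Fin d)) :
    |maxInner ψ u| ≤ ‖u‖ := by
  have h0 : maxInner ψ 0 = 0 := by simp [maxInner]
  simpa [h0] using abs_maxInner_sub_le hψ u 0

lemma familyBonus_nonneg (u v : EuclideanSpace ℝ (Fin d)) : 0 ≤ familyBonus ψ u v :=
  sub_nonneg.2 (maxInner_add_le u v)

lemma familyBonus_le (hψ : ∀ a, ‖ψ a‖ ≤ 1) (u v : EuclideanSpace ℝ (Fin d)) :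
    familyBonus ψ u v ≤ 2 * ‖v‖ := by
  have h1 := maxInner_sub_le hψ u (u + v)
  have h2 := maxInner_le_norm hψ v
  rw [show u - (u + v) = -v by abel, norm_neg] at h1
  unfold familyBonus
  linarith

lemma abs_familyBonus_le (hψ : ∀ a, ‖ψ a‖ ≤ 1) (u v : EuclideanSpace ℝ (Fin d)) :
    |familyBonus ψ u v| ≤ 2 * ‖v‖ := by
  rw [abs_of_nonneg (familyBonus_nonneg u v)]
  exact familyBonus_le hψ u v

omit [Finite A] [Nonempty A] in
lemma familyBonus_smul {c : ℝ} (hc : 0 ≤ c) (u v : EuclideanSpace ℝ (Fin d)) :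
    familyBonus ψ (c • u) (c • v) = c * familyBonus ψ u v := by
  simp only [familyBonus, ← smul_add, maxInner_smul hc]
  ring

/-- The maximizer `i` of `u + v` is the only unknown in the bonus; `a` and `b` are competitors in
the other two maxima. A bound uniform in `i` thus bounds the bonus through feature differences only.
-/
lemma le_familyBonus {u v : EuclideanSpace ℝ (Fin d)} {c : ℝ} {a b : A}
    (h : ∀ i, c ≤ ⟪u, ψ a - ψ i⟫ + ⟪v, ψ b - ψ i⟫) : c ≤ familyBonus ψ u v := by
  obtain ⟨i, hi⟩ := exists_maxInner_eq ψ (u + v)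
  have := h i
  rw [inner_sub_right, inner_sub_right] at this
  rw [familyBonus, hi, inner_add_left]
  linarith [le_maxInner ψ u a, le_maxInner ψ v b]

/-- The truncated bonus depends on its arguments through their inner products with differences of
feature vectors, in a Lipschitz way. -/
lemma familyBonus_perturb {u v u' v' : EuclideanSpace ℝ (Fin d)} {r s : ℝ}
    (hu : ∀ a b, |⟪u' - u, ψ a - ψ b⟫| ≤ r) (hv : ∀ a b, |⟪v' - v, ψ a - ψ b⟫| ≤ s) :
    familyBonus ψ u v - r - s ≤ familyBonus ψ u' v' := by
  obtain ⟨a, ha⟩ := exists_maxInner_eq ψ u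
  obtain ⟨b, hb⟩ := exists_maxInner_eq ψ v
  refine le_familyBonus (a := a) (b := b) fun i => ?_
  have h1 := (abs_le.1 (hu a i)).1
  have h2 := (abs_le.1 (hv b i)).1
  have h3 := le_maxInner ψ (u + v) i
  rw [familyBonus, ha, hb]
  simp only [inner_sub_left, inner_sub_right, inner_add_left] at h1 h2 h3 ⊢
  linarith

omit [Nonempty A] in
lemma measurable_maxInner {Z : Type*} [MeasurableSpace Z] {ψ : Z → A → EuclideanSpace ℝ (Fin d)}
    {u : Z → EuclideanSpace ℝ (Fin d)} (hψ : ∀ a, Measurable fun z => ψ z a) (hu : Measurable u) :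
    Measurable fun z => maxInner (ψ z) (u z) :=
  Measurable.iSup fun a => hu.inner (hψ a)

omit [Nonempty A] in
lemma measurable_familyBonus {Z : Type*} [MeasurableSpace Z]
    {ψ : Z → A → EuclideanSpace ℝ (Fin d)} {u v : Z → EuclideanSpace ℝ (Fin d)}
    (hψ : ∀ a, Measurable fun z => ψ z a) (hu : Measurable u) (hv : Measurable v) :
    Measurable fun z => familyBonus (ψ z) (u z) (v z) :=
  ((measurable_maxInner hψ hu).add (measurable_maxInner hψ hv)).sub
    (measurable_maxInner hψ (hu.add hv))

end MaxInner

/-! ### Functions that are linear in the features -/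

/-- `f` is induced by a linear functional of the feature vectors `Φ`. -/
def IsLinearIn {ι : Type*} {d : ℕ} (Φ : ι → EuclideanSpace ℝ (Fin d)) (f : ι → ℝ) : Prop :=
  ∃ w, ∀ i, f i = ⟪Φ i, w⟫

namespace IsLinearIn

variable {ι : Type*} {d : ℕ} {Φ : ι → EuclideanSpace ℝ (Fin d)}

/-- The range of a dual map is the annihilator of the kernel. The criterion does not mention the
coefficient vector, so limits and integrals preserve linearity without any control of the
coefficients. -/
lemma iff_respects_relations {f : ι → ℝ} : IsLinearIn Φ f ↔
    ∀ c : ι →₀ ℝ, (c.sum fun i r => r • Φ i) = 0 → (c.sum fun i r => r * f i) = 0 := by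
  constructor
  · rintro ⟨w, hw⟩ c hc
    have : (c.sum fun i r => r * f i) = ⟪c.sum fun i r => r • Φ i, w⟫ := by
      simp only [Finsupp.sum, sum_inner, real_inner_smul_left, hw]
    rw [this, hc, inner_zero_left]
  · intro h
    have hmem : Finsupp.linearCombination ℝ f ∈
        (LinearMap.ker (Finsupp.linearCombination ℝ Φ)).dualAnnihilator := by
      rw [Submodule.mem_dualAnnihilator]
      intro c hc
      rw [LinearMap.mem_ker, Finsupp.linearCombination_apply] at hc
      rw [Finsupp.linearCombination_apply]
      simpa using h c hc
    rw [← LinearMap.range_dualMap_eq_dualAnnihilator_ker] at hmem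
    obtain ⟨ℓ, hℓ⟩ := hmem
    refine ⟨(InnerProductSpace.toDual ℝ _).symm ℓ.toContinuousLinearMap, fun i => ?_⟩
    rw [real_inner_comm, InnerProductSpace.toDual_symm_apply]
    have := LinearMap.congr_fun hℓ (Finsupp.single i 1)
    simpa using this.symm

lemma add {f g : ι → ℝ} (hf : IsLinearIn Φ f) (hg : IsLinearIn Φ g) :
    IsLinearIn Φ (fun i => f i + g i) := by
  obtain ⟨v, hv⟩ := hf
  obtain ⟨w, hw⟩ := hg
  exact ⟨v + w, fun i => by simp only [inner_add_right, hv, hw]⟩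

lemma const_mul {f : ι → ℝ} (c : ℝ) (hf : IsLinearIn Φ f) : IsLinearIn Φ (fun i => c * f i) := by
  obtain ⟨v, hv⟩ := hf
  exact ⟨c • v, fun i => by simp only [real_inner_smul_right, hv]⟩

lemma sub {f g : ι → ℝ} (hf : IsLinearIn Φ f) (hg : IsLinearIn Φ g) :
    IsLinearIn Φ (fun i => f i - g i) := by
  obtain ⟨v, hv⟩ := hf
  obtain ⟨w, hw⟩ := hg
  exact ⟨v - w, fun i => by simp only [inner_sub_right, hv, hw]⟩

lemma of_tendsto {f : ℕ → ι → ℝ} {g : ι → ℝ} (hf : ∀ n, IsLinearIn Φ (f n))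
    (h : ∀ i, Filter.Tendsto (fun n => f n i) Filter.atTop (nhds (g i))) : IsLinearIn Φ g := by
  rw [iff_respects_relations]
  intro c hc
  have h1 : Filter.Tendsto (fun n => c.sum fun i r => r * f n i) Filter.atTop
      (nhds (c.sum fun i r => r * g i)) :=
    tendsto_finsetSum _ fun i _ => (h i).const_mul _
  simp only [fun n => iff_respects_relations.1 (hf n) c hc] at h1
  exact tendsto_nhds_unique h1 tendsto_const_nhds

lemma integral {Θ : Type*} [MeasurableSpace Θ] {μ : Measure Θ} {f : Θ → ι → ℝ}
    (hf : ∀ θ, IsLinearIn Φ (f θ)) (hint : ∀ i, Integrable (fun θ => f θ i) μ) :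
    IsLinearIn Φ (fun i => ∫ θ, f θ i ∂μ) := by
  rw [iff_respects_relations]
  intro c hc
  have h1 : (c.sum fun i r => r * ∫ θ, f θ i ∂μ) = ∫ θ, (c.sum fun i r => r * f θ i) ∂μ := by
    simp only [Finsupp.sum]
    rw [integral_finsetSum _ fun i _ => (hint i).const_mul _]
    simp only [integral_const_mul]
  rw [h1]
  simp only [fun θ => iff_respects_relations.1 (hf θ) c hc, integral_zero]

/-- Averaging over a parameter preserves linearity of the expectations. -/
lemma integral_integral {Θ X : Type*} [MeasurableSpace Θ] [MeasurableSpace X] {μ : Measure Θ}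
    [SFinite μ] {κ : ι → Measure X} [∀ i, IsProbabilityMeasure (κ i)] {f : X → Θ → ℝ}
    {C : Θ → ℝ} (hmeas : Measurable (Function.uncurry f)) (hC : Integrable C μ)
    (hb : ∀ x θ, |f x θ| ≤ C θ) (hf : ∀ θ, IsLinearIn Φ (fun i => ∫ x, f x θ ∂(κ i))) :
    IsLinearIn Φ (fun i => ∫ x, ∫ θ, f x θ ∂μ ∂(κ i)) := by
  have hint : ∀ i, Integrable (Function.uncurry f) ((κ i).prod μ) := fun i =>
    (hC.comp_snd (κ i)).mono' hmeas.aestronglyMeasurable (ae_of_all _ fun p => hb p.1 p.2)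
  have := integral (Φ := Φ) hf fun i => (hint i).integral_prod_right
  obtain ⟨w, hw⟩ := this
  exact ⟨w, fun i => (integral_integral_swap (hint i)).trans (hw i)⟩

end IsLinearIn

/-! ### The truncated pair of projections -/

section Truncation

variable {d : ℕ}

lemma continuousOn_spectrum_matrix (f : ℝ → ℝ) (Γ : Matrix (Fin d) (Fin d) ℝ) :
    ContinuousOn f (spectrum ℝ Γ) :=
  (Matrix.finite_real_spectrum (A := Γ)).continuousOn f

variable {Γ : Matrix (Fin d) (Fin d) ℝ} {σ : ℝ}

lemma truncHigh_isSelfAdjoint : IsSelfAdjoint (truncHigh Γ σ) := cfc_predicate _ _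

lemma truncHigh_mul_self : truncHigh Γ σ * truncHigh Γ σ = truncHigh Γ σ := by
  rw [truncHigh, ← cfc_mul _ _ _ (continuousOn_spectrum_matrix _ _)
    (continuousOn_spectrum_matrix _ _)]
  congr 1
  ext s
  split_ifs <;> simp

lemma truncHigh_nonneg : 0 ≤ truncHigh Γ σ :=
  cfc_nonneg fun s _ => by split_ifs <;> simp

lemma truncLow_nonneg : 0 ≤ truncLow Γ σ :=
  cfc_nonneg fun s _ => by split_ifs <;> simp

lemma truncHigh_add_truncLow (hΓ : IsSelfAdjoint Γ) : truncHigh Γ σ + truncLow Γ σ = 1 := by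
  rw [truncHigh, truncLow, ← cfc_add Γ _ _ (continuousOn_spectrum_matrix _ _)
    (continuousOn_spectrum_matrix _ _), ← cfc_one ℝ Γ]
  congr 1
  ext s
  split_ifs <;> simp

lemma truncLow_mul_self : truncLow Γ σ * truncLow Γ σ = truncLow Γ σ := by
  rw [truncLow, ← cfc_mul _ _ _ (continuousOn_spectrum_matrix _ _)
    (continuousOn_spectrum_matrix _ _)]
  congr 1
  ext s
  split_ifs <;> simp

lemma sqrt_truncHigh : CFC.sqrt (truncHigh Γ σ) = truncHigh Γ σ :=
  CFC.sqrt_unique truncHigh_mul_self truncHigh_nonneg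

lemma sqrt_truncLow : CFC.sqrt (truncLow Γ σ) = truncLow Γ σ :=
  CFC.sqrt_unique truncLow_mul_self truncLow_nonneg

/-- The quadratic form of `Γ²` is controlled by the two projections. -/
lemma sq_le_truncated {M : ℝ} (hΓ : 0 ≤ Γ) (hM : Γ * Γ ≤ M ^ 2 • 1) :
    Γ * Γ ≤ M ^ 2 • truncHigh Γ σ + σ ^ 2 • truncLow Γ σ := by
  have hsa : IsSelfAdjoint Γ := hΓ.isSelfAdjoint
  have hsq : Γ * Γ = cfc (fun s : ℝ => s * s) Γ := by
    rw [cfc_mul _ _ _ (continuousOn_spectrum_matrix _ _) (continuousOn_spectrum_matrix _ _),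
      cfc_id' ℝ Γ]
  have hle : ∀ s ∈ spectrum ℝ Γ, s * s ≤ M ^ 2 := by
    rw [← cfc_le_algebraMap_iff (fun s : ℝ => s * s) (M ^ 2) Γ
      (continuousOn_spectrum_matrix _ _) hsa, ← hsq, Algebra.algebraMap_eq_smul_one]
    exact hM
  have h0 : ∀ s ∈ spectrum ℝ Γ, 0 ≤ s := fun s hs => spectrum_nonneg_of_nonneg hΓ hs
  rw [hsq, truncHigh, truncLow, ← cfc_smul _ _ _ (continuousOn_spectrum_matrix _ _),
    ← cfc_smul _ _ _ (continuousOn_spectrum_matrix _ _),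
    ← cfc_add Γ _ _ (continuousOn_spectrum_matrix _ _) (continuousOn_spectrum_matrix _ _)]
  refine cfc_mono (fun s hs => ?_) (continuousOn_spectrum_matrix _ _)
    (continuousOn_spectrum_matrix _ _)
  split_ifs with h
  · simpa using hle s hs
  · simp only [smul_eq_mul, mul_zero, mul_one, zero_add]
    nlinarith [h0 s hs]

/-- All of a scalar matrix above the threshold is kept. -/
lemma truncHigh_smul_one {c : ℝ} (h : σ ≤ c) :
    truncHigh (c • (1 : Matrix (Fin d) (Fin d) ℝ)) σ = 1 := by
  rw [truncHigh, ← Algebra.algebraMap_eq_smul_one, cfc_algebraMap, if_pos h, map_one]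

end Truncation

/-! ### The confidence norm in terms of the two projections -/

section Inverse

variable {d : ℕ} {S : Matrix (Fin d) (Fin d) ℝ} {l : ℝ}

lemma posDef_of_smul_one_le (hl : 0 < l) (hS : l • (1 : Matrix (Fin d) (Fin d) ℝ) ≤ S) :
    S.PosDef := by
  have h1 : (l • (1 : Matrix (Fin d) (Fin d) ℝ)).PosDef := Matrix.PosDef.one.smul hl
  simpa using h1.add_posSemidef (Matrix.le_iff.1 hS)

/-- With `v = S u` the claim is `l ⟪u, S u⟫ ≤ ‖S u‖²`, which is the sum of `‖S u - l u‖² ≥ 0` and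
`l` times the hypothesis at `u`. -/
lemma inv_le_smul_one (hl : 0 < l) (hS : l • (1 : Matrix (Fin d) (Fin d) ℝ) ≤ S) :
    S⁻¹ ≤ l⁻¹ • 1 := by
  have hpd := posDef_of_smul_one_le hl hS
  have hdet : IsUnit S.det := hpd.det_pos.ne'.isUnit
  rw [Matrix.le_iff]
  refine Matrix.PosSemidef.of_dotProduct_mulVec_nonneg ?_ fun v => ?_
  · exact ((Matrix.isHermitian_one).smul (k := l⁻¹) (by simp [IsSelfAdjoint])).sub hpd.inv.1
  · obtain ⟨u, rfl⟩ : ∃ u, v = S *ᵥ u := ⟨S⁻¹ *ᵥ v, by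
      rw [Matrix.mulVec_mulVec, Matrix.mul_nonsing_inv _ hdet, Matrix.one_mulVec]⟩
    have h1 := (Matrix.le_iff.1 hS).dotProduct_mulVec_nonneg u
    rw [Matrix.sub_mulVec, Matrix.smul_mulVec, Matrix.one_mulVec, dotProduct_sub,
      dotProduct_smul] at h1
    rw [Matrix.sub_mulVec, Matrix.mulVec_mulVec u S⁻¹ S, Matrix.nonsing_inv_mul _ hdet,
      Matrix.smul_mulVec, Matrix.one_mulVec, Matrix.one_mulVec, dotProduct_sub, dotProduct_smul]
    simp only [star_trivial, smul_eq_mul] at h1 ⊢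
    have h2 : 0 ≤ (S *ᵥ u - l • u) ⬝ᵥ (S *ᵥ u - l • u) := Finset.sum_nonneg fun i _ => mul_self_nonneg _
    rw [sub_dotProduct, dotProduct_sub, dotProduct_sub, dotProduct_smul, smul_dotProduct,
      smul_dotProduct, dotProduct_smul] at h2
    simp only [smul_eq_mul] at h2
    rw [dotProduct_comm (S *ᵥ u) u] at *
    have h3 : 0 ≤ l⁻¹ * (S *ᵥ u ⬝ᵥ S *ᵥ u - l * (u ⬝ᵥ S *ᵥ u)) := by
      apply mul_nonneg (inv_nonneg.2 hl.le)
      nlinarith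
    rw [mul_sub, inv_mul_cancel_left₀ hl.ne'] at h3
    exact h3

/-- The weighted norm of a vector, in terms of the truncated pair. -/
lemma sqrt_dotProduct_inv_le {b σ : ℝ} (hl : 0 < l) (hb : 0 ≤ b) (hσ : 0 ≤ σ)
    (hS : l • (1 : Matrix (Fin d) (Fin d) ℝ) ≤ S) (v : EuclideanSpace ℝ (Fin d)) :
    b * √(v.ofLp ⬝ᵥ (S⁻¹ *ᵥ v.ofLp)) ≤
      b / √l * ‖Matrix.toEuclideanCLM (𝕜 := ℝ) (truncHigh (b • CFC.sqrt S⁻¹) σ) v‖ +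
      σ * ‖Matrix.toEuclideanCLM (𝕜 := ℝ) (truncLow (b • CFC.sqrt S⁻¹) σ) v‖ := by
  have hpd := posDef_of_smul_one_le hl hS
  have hS0 : (0 : Matrix (Fin d) (Fin d) ℝ) ≤ S⁻¹ := hpd.inv.posSemidef.nonneg
  set Γ := b • CFC.sqrt S⁻¹ with hΓdef
  have hΓ : 0 ≤ Γ := smul_nonneg hb (CFC.sqrt_nonneg _)
  have hΓΓ : Γ * Γ = b ^ 2 • S⁻¹ := by
    rw [hΓdef, smul_mul_smul_comm, CFC.sqrt_mul_sqrt_self _ hS0, sq]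
  have hM : Γ * Γ ≤ (b / √l) ^ 2 • 1 := by
    rw [hΓΓ, div_pow, Real.sq_sqrt hl.le, div_eq_mul_inv, mul_smul]
    exact smul_le_smul_of_nonneg_left (inv_le_smul_one hl hS) (sq_nonneg b)
  have key := (Matrix.le_iff.1 (sq_le_truncated (σ := σ) hΓ hM)).dotProduct_mulVec_nonneg v.ofLp
  have hproj : ∀ Q : Matrix (Fin d) (Fin d) ℝ, IsSelfAdjoint Q → Q * Q = Q →
      v.ofLp ⬝ᵥ (Q *ᵥ v.ofLp) = ‖Matrix.toEuclideanCLM (𝕜 := ℝ) Q v‖ ^ 2 := by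
    intro Q hQ hQQ
    rw [← real_inner_self_eq_norm_sq, ← Matrix.inner_toEuclideanCLM,
      ← ContinuousLinearMap.adjoint_inner_right, ← ContinuousLinearMap.star_eq_adjoint,
      ← map_star, hQ.star_eq, ← mul_apply_eq_comp, ← map_mul, hQQ]
  rw [hΓΓ, Matrix.sub_mulVec, Matrix.add_mulVec, Matrix.smul_mulVec, Matrix.smul_mulVec,
    Matrix.smul_mulVec, dotProduct_sub, dotProduct_add, dotProduct_smul, dotProduct_smul,
    dotProduct_smul, star_trivial, hproj _ truncHigh_isSelfAdjoint truncHigh_mul_self,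
    hproj _ truncLow_nonneg.isSelfAdjoint truncLow_mul_self] at key
  simp only [smul_eq_mul] at key
  have h0 : 0 ≤ v.ofLp ⬝ᵥ (S⁻¹ *ᵥ v.ofLp) := by
    simpa using hpd.inv.posSemidef.dotProduct_mulVec_nonneg v.ofLp
  set x := ‖Matrix.toEuclideanCLM (𝕜 := ℝ) (truncHigh Γ σ) v‖
  set y := ‖Matrix.toEuclideanCLM (𝕜 := ℝ) (truncLow Γ σ) v‖
  have hx : 0 ≤ b / √l * x := by positivity
  have hy : 0 ≤ σ * y := by positivity
  -- The squared norm is at most the sum of the squares of the two nonnegative terms, hence at most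
  -- the square of their sum.
  refine abs_le_of_sq_le_sq' ?_ (by positivity) |>.2
  rw [mul_pow, Real.sq_sqrt h0]
  nlinarith [mul_nonneg hx hy]

end Inverse

/-! ### Estimates for Gaussian measures -/

lemma integral_abs_gaussianReal_zero_one : ∫ x, |x| ∂(gaussianReal 0 1) = 2 / √(2 * Real.pi) := by
  rw [integral_gaussianReal_eq_integral_smul one_ne_zero]
  have h1 : ∀ x : ℝ, gaussianPDFReal 0 1 x • |x| =
      (fun y : ℝ => (√(2 * Real.pi))⁻¹ * (y ^ (1 : ℝ) * Real.exp (-(1 / 2) * y ^ (2 : ℝ)))) |x| := by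
    intro x
    simp only [gaussianPDFReal_def, NNReal.coe_one, mul_one, sub_zero, smul_eq_mul, Real.rpow_one,
      Real.rpow_two, sq_abs]
    rw [show -x ^ 2 / 2 = -(1 / 2) * x ^ 2 by ring]
    ring
  simp only [h1]
  rw [integral_comp_abs (f := fun y : ℝ =>
      (√(2 * Real.pi))⁻¹ * (y ^ (1 : ℝ) * Real.exp (-(1 / 2) * y ^ (2 : ℝ)))),
    integral_const_mul, integral_rpow_mul_exp_neg_mul_rpow (by norm_num) (by norm_num)
      (by norm_num)]
  norm_num [Real.rpow_neg_one]
  ring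

/-! ### One-dimensional marginals and small balls of the standard Gaussian -/

section Std

variable {E : Type*} [NormedAddCommGroup E] [InnerProductSpace ℝ E] [FiniteDimensional ℝ E]
  [MeasurableSpace E] [BorelSpace E]

lemma map_inner_stdGaussian (z : E) :
    (stdGaussian E).map (fun g => ⟪z, g⟫) = (gaussianReal 0 1).map (fun x => ‖z‖ * x) := by
  have h1 := IsGaussian.map_eq_gaussianReal (μ := stdGaussian E) (innerSL ℝ z)
  rw [integral_strongDual_stdGaussian, variance_dual_stdGaussian, innerSL_apply_norm] at h1
  rw [gaussianReal_map_const_mul, mul_zero, mul_one]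
  have h2 : NNReal.mk (‖z‖ ^ 2) (sq_nonneg _) = (‖z‖ ^ 2).toNNReal := by
    ext; simp
  rw [h2, ← h1]
  rfl

lemma integral_abs_inner_stdGaussian (z : E) :
    ∫ g, |⟪z, g⟫| ∂(stdGaussian E) = ‖z‖ * (2 / √(2 * Real.pi)) := by
  have h1 : ∫ g, |⟪z, g⟫| ∂(stdGaussian E) =
      ∫ x, |x| ∂((stdGaussian E).map (fun g => ⟪z, g⟫)) := by
    rw [integral_map (by fun_prop) (by fun_prop)]
  rw [h1, map_inner_stdGaussian, integral_map (by fun_prop) (by fun_prop)]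
  simp only [abs_mul, abs_norm, integral_const_mul, integral_abs_gaussianReal_zero_one]

/-- On the interval `x² ≤ 2 z² + 2 ρ²`, so the density is at least `exp (-(z² + ρ²)) / 4`; the
interval has length `2 ρ`. -/
lemma gaussianReal_Icc_ge (z : ℝ) {ρ : ℝ} (hρ : 0 < ρ) :
    ρ / 2 * Real.exp (-(z ^ 2 + ρ ^ 2)) ≤ (gaussianReal 0 1).real (Set.Icc (z - ρ) (z + ρ)) := by
  rw [measureReal_def, gaussianReal_apply_eq_integral _ one_ne_zero, ENNReal.toReal_ofReal
    (setIntegral_nonneg measurableSet_Icc fun x _ => gaussianPDFReal_nonneg _ _ _)]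
  have hpi : √(2 * Real.pi) ≤ 4 := by
    rw [Real.sqrt_le_left (by norm_num)]
    linarith [Real.pi_lt_four]
  have hpos : 0 < √(2 * Real.pi) := by positivity
  have h1 : ∀ x ∈ Set.Icc (z - ρ) (z + ρ),
      4⁻¹ * Real.exp (-(z ^ 2 + ρ ^ 2)) ≤ gaussianPDFReal 0 1 x := by
    intro x hx
    simp only [gaussianPDFReal_def, NNReal.coe_one, mul_one, sub_zero]
    refine mul_le_mul (inv_anti₀ hpos hpi) (Real.exp_le_exp.2 ?_) (Real.exp_pos _).le
      (by positivity)
    have h2 : (x - z) ^ 2 ≤ ρ ^ 2 := sq_le_sq' (by linarith [hx.1]) (by linarith [hx.2])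
    nlinarith [sq_nonneg (x - 2 * z)]
  have h2 := setIntegral_ge_of_const_le_real (μ := volume) measurableSet_Icc
    (by simp) h1 (integrable_gaussianPDFReal 0 1).integrableOn
  rw [measureReal_def, Real.volume_Icc, ENNReal.toReal_ofReal (by linarith)] at h2
  calc ρ / 2 * Real.exp (-(z ^ 2 + ρ ^ 2))
      = 4⁻¹ * Real.exp (-(z ^ 2 + ρ ^ 2)) * (z + ρ - (z - ρ)) := by ring
    _ ≤ _ := h2

omit [FiniteDimensional ℝ E] in
lemma measurableSet_small_ball (U : Submodule ℝ E) (z : E) (c : ℝ) :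
    MeasurableSet {g : E | ∀ y ∈ U, |⟪g - z, y⟫| ≤ c * ‖y‖} := by
  have : {g : E | ∀ y ∈ U, |⟪g - z, y⟫| ≤ c * ‖y‖} = ⋂ y ∈ U, {g : E | |⟪g - z, y⟫| ≤ c * ‖y‖} := by
    ext g; simp
  rw [this]
  exact (isClosed_biInter fun y _ => isClosed_le (by fun_prop) (by fun_prop)).measurableSet

/-- A small ball estimate for the standard Gaussian measure in few directions. -/
lemma stdGaussian_small_ball {U : Submodule ℝ E} {m : ℕ} (hU : Module.finrank ℝ U ≤ m)
    {z : E} (hz : ‖z‖ ≤ 1) {ρ : ℝ} (hρ : 0 < ρ) (hρ1 : Module.finrank ℝ E * ρ ^ 2 ≤ 1)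
    (hρ2 : ρ ≤ 2) :
    Real.exp (-2) * (ρ / 2) ^ m ≤ (stdGaussian E).real
      {g | ∀ y ∈ U, |⟪g - z, y⟫| ≤ ρ * √(Module.finrank ℝ E) * ‖y‖} := by
  classical
  -- In an orthonormal basis of the whole space that extends one of `U`, the Gaussian coordinates
  -- are independent and only those in `U` are constrained.
  let bU := stdOrthonormalBasis ℝ U
  have hon : Orthonormal ℝ (fun i => (bU i : E)) :=
    bU.orthonormal.comp_linearIsometry U.subtypeₗᵢ
  obtain ⟨s, b, hs, hb⟩ := hon.toSubtypeRange.exists_orthonormalBasis_extension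
  set v : Set E := Set.range fun i => (bU i : E) with hv
  have hUspan : U = Submodule.span ℝ v := by
    have h1 := congrArg (Submodule.map U.subtype) bU.toBasis.span_eq
    rw [Submodule.map_top, Submodule.range_subtype, Submodule.map_span, ← Set.range_comp] at h1
    rw [← h1, hv]
    congr 1
  have hortho : ∀ i : s, (i : E) ∉ v → ∀ y ∈ U, ⟪b i, y⟫ = 0 := by
    intro i hi y hy
    rw [hUspan] at hy
    induction hy using Submodule.span_induction with
    | mem x hx =>
      have hx' : x ∈ s := hs hx
      have : b ⟨x, hx'⟩ = x := by rw [hb]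
      rw [← this]
      exact b.orthonormal.2 fun h => hi (by rw [h]; exact hx)
    | zero => simp
    | add x y _ _ hx hy => rw [inner_add_right, hx, hy, add_zero]
    | smul c x _ hx => rw [inner_smul_right, hx, mul_zero]
  have hcard : Fintype.card s = Module.finrank ℝ E := (Module.finrank_eq_card_basis b.toBasis).symm
  let S : s → Set ℝ := fun i =>
    if (i : E) ∈ v then Set.Icc (⟪b i, z⟫ - ρ) (⟪b i, z⟫ + ρ) else Set.univ
  have hsub : Set.univ.pi S ⊆ (fun x : s → ℝ => ∑ i, x i • b i) ⁻¹'
      {g | ∀ y ∈ U, |⟪g - z, y⟫| ≤ ρ * √(Module.finrank ℝ E) * ‖y‖} := by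
    intro x hx y hy
    have h1 : ⟪(∑ i, x i • b i) - z, y⟫ = ∑ i, (x i - ⟪b i, z⟫) * ⟪b i, y⟫ := by
      conv_lhs => rw [← b.sum_repr' z, ← Finset.sum_sub_distrib]
      simp only [← sub_smul, sum_inner, real_inner_smul_left]
    have h2 : ∀ i : s, |(x i - ⟪b i, z⟫) * ⟪b i, y⟫| ≤ ρ * |⟪b i, y⟫| := by
      intro i
      by_cases hi : (i : E) ∈ v
      · have := hx i (Set.mem_univ i)
        simp only [S, if_pos hi] at this
        rw [abs_mul]
        exact mul_le_mul_of_nonneg_right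
          (abs_le.2 ⟨by linarith [this.1], by linarith [this.2]⟩) (abs_nonneg _)
      · simp [hortho i hi y hy]
    -- Cauchy–Schwarz over all coordinates; this is the source of the factor `√dim E`.
    have h3 : ∑ i, |⟪b i, y⟫| ≤ √(Module.finrank ℝ E) * ‖y‖ := by
      have h4 := sq_sum_le_card_mul_sum_sq (s := Finset.univ) (f := fun i : s => |⟪b i, y⟫|)
      simp only [sq_abs, b.sum_sq_inner_right, Finset.card_univ, hcard] at h4
      refine abs_le_of_sq_le_sq' ?_ (by positivity) |>.2
      rw [mul_pow, Real.sq_sqrt (by positivity)]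
      exact h4
    calc |⟪(∑ i, x i • b i) - z, y⟫| ≤ ∑ i, |(x i - ⟪b i, z⟫) * ⟪b i, y⟫| := by
          rw [h1]
          exact Finset.abs_sum_le_sum_abs _ _
      _ ≤ ∑ i, ρ * |⟪b i, y⟫| := Finset.sum_le_sum fun i _ => h2 i
      _ ≤ ρ * √(Module.finrank ℝ E) * ‖y‖ := by
          rw [← Finset.mul_sum, mul_assoc]
          exact mul_le_mul_of_nonneg_left h3 hρ.le
  rw [stdGaussian_eq_map_pi_orthonormalBasis b, map_measureReal_apply (by fun_prop)
    (measurableSet_small_ball U z _)]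
  refine le_trans ?_ (measureReal_mono hsub)
  rw [measureReal_def, Measure.pi_pi, ENNReal.toReal_prod]
  -- Free coordinates have probability 1 but are charged the exponential too, so that the exponents
  -- add up to `‖z‖² + dim E · ρ² ≤ 2`.
  have hprod : ∏ i : s, ((if (i : E) ∈ v then ρ / 2 else 1) *
      Real.exp (-(⟪b i, z⟫ ^ 2 + ρ ^ 2))) ≤ ∏ i : s, (gaussianReal 0 1 (S i)).toReal := by
    refine Finset.prod_le_prod (fun i _ => ?_) fun i _ => ?_
    · split_ifs <;> positivity
    · by_cases hi : (i : E) ∈ v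
      · simp only [S, if_pos hi]
        exact gaussianReal_Icc_ge _ hρ
      · simp only [S, if_neg hi, measure_univ, ENNReal.toReal_one, one_mul]
        exact Real.exp_le_one_iff.2 (by nlinarith [sq_nonneg ⟪b i, z⟫, sq_nonneg ρ])
  refine le_trans ?_ hprod
  rw [Finset.prod_mul_distrib, ← Real.exp_sum, mul_comm]
  refine mul_le_mul ?_ (Real.exp_le_exp.2 ?_) (Real.exp_pos _).le
    (Finset.prod_nonneg fun i _ => by split_ifs <;> positivity)
  · rw [Finset.prod_ite, Finset.prod_const, Finset.prod_const_one, mul_one]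
    refine pow_le_pow_of_le_one (by positivity) (by linarith) (le_trans ?_ hU)
    have : Set.ncard v ≤ Module.finrank ℝ U := by
      rw [hv, ← Set.image_univ]
      refine (Set.ncard_image_le Set.finite_univ).trans ?_
      simp [Set.ncard_univ]
    refine le_trans ?_ this
    rw [← Set.ncard_coe_finset]
    refine Set.ncard_le_ncard_of_injOn (fun i : s => (i : E)) (fun i hi => ?_)
      Subtype.val_injective.injOn (Set.finite_range _)
    simpa using hi
  · rw [Finset.sum_neg_distrib, Finset.sum_add_distrib, b.sum_sq_inner_right, Finset.sum_const,
      Finset.card_univ, hcard, nsmul_eq_mul]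
    have : ‖z‖ ^ 2 ≤ 1 := by nlinarith [norm_nonneg z]
    linarith

end Std

/-! ### Lower bounds for the bonus -/

/-- A pair of complementary orthogonal projections. -/
structure IsComplementaryPair {d : ℕ}
    (p q : EuclideanSpace ℝ (Fin d) →L[ℝ] EuclideanSpace ℝ (Fin d)) : Prop where
  inner_left : ∀ x y, ⟪p x, y⟫ = ⟪x, p y⟫
  inner_right : ∀ x y, ⟪q x, y⟫ = ⟪x, q y⟫
  idem_left : ∀ x, p (p x) = p x
  idem_right : ∀ x, q (q x) = q x
  add_eq : ∀ x, p x + q x = x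

namespace IsComplementaryPair

variable {d : ℕ} {p q : EuclideanSpace ℝ (Fin d) →L[ℝ] EuclideanSpace ℝ (Fin d)}

lemma norm_left_le (h : IsComplementaryPair p q) (x : EuclideanSpace ℝ (Fin d)) :
    ‖p x‖ ≤ ‖x‖ := by
  have h1 : ‖p x‖ ^ 2 ≤ ‖p x‖ * ‖x‖ := by
    rw [← real_inner_self_eq_norm_sq, h.inner_left, h.idem_left, real_inner_comm]
    exact real_inner_le_norm _ _
  by_contra hlt
  push Not at hlt
  nlinarith [norm_nonneg x]

lemma symm (h : IsComplementaryPair p q) : IsComplementaryPair q p :=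
  ⟨h.inner_right, h.inner_left, h.idem_right, h.idem_left, fun x => by
    rw [add_comm, h.add_eq]⟩

lemma norm_right_le (h : IsComplementaryPair p q) (x : EuclideanSpace ℝ (Fin d)) :
    ‖q x‖ ≤ ‖x‖ := h.symm.norm_left_le x

end IsComplementaryPair

section LowerBounds

variable {A : Type*} [Fintype A] [Nonempty A] {d : ℕ} {ψ : A → EuclideanSpace ℝ (Fin d)}
  {p q : EuclideanSpace ℝ (Fin d) →L[ℝ] EuclideanSpace ℝ (Fin d)}

lemma integrable_maxInner (hψ : ∀ a, ‖ψ a‖ ≤ 1)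
    (p : EuclideanSpace ℝ (Fin d) →L[ℝ] EuclideanSpace ℝ (Fin d)) :
    Integrable (fun g => maxInner ψ (p g)) (stdGaussian (EuclideanSpace ℝ (Fin d))) := by
  have h1 : Integrable (fun g => ‖p g‖) (stdGaussian (EuclideanSpace ℝ (Fin d))) :=
    (p.integrable_comp (IsGaussian.integrable_id
      (μ := stdGaussian (EuclideanSpace ℝ (Fin d))))).norm
  have h2 : Measurable fun g => maxInner ψ (p g) :=
    measurable_maxInner (ψ := fun _ => ψ) (fun a => measurable_const) p.continuous.measurable
  exact h1.mono' h2.aestronglyMeasurable (ae_of_all _ fun g => abs_maxInner_le hψ _)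

/-- The expected maximum of a Gaussian is at least the width of the feature vectors. -/
lemma norm_sub_le_integral_maxInner (h : IsComplementaryPair p q) (hψ : ∀ a, ‖ψ a‖ ≤ 1)
    (a b : A) : ‖p (ψ a - ψ b)‖ / √(2 * Real.pi) ≤
      ∫ g, maxInner ψ (p g) ∂(stdGaussian (EuclideanSpace ℝ (Fin d))) := by
  have hlin : ∀ z : EuclideanSpace ℝ (Fin d),
      Integrable (fun g => ⟪z, g⟫) (stdGaussian (EuclideanSpace ℝ (Fin d))) := fun z =>
    (innerSL ℝ z).integrable_comp IsGaussian.integrable_id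
  have h0 : ∫ g, ⟪p (ψ a + ψ b), g⟫ ∂(stdGaussian (EuclideanSpace ℝ (Fin d))) = 0 :=
    integral_strongDual_stdGaussian (innerSL ℝ (p (ψ a + ψ b)))
  -- The maximum of two numbers is half their sum plus half the absolute value of their difference;
  -- the sum has mean zero.
  have hle : ∀ g, 2⁻¹ * (⟪p (ψ a + ψ b), g⟫ + |⟪p (ψ a - ψ b), g⟫|) ≤ maxInner ψ (p g) := by
    intro g
    have h1 := le_maxInner ψ (p g) a
    have h2 := le_maxInner ψ (p g) b
    rw [h.inner_left, h.inner_left, inner_add_left, inner_sub_left, real_inner_comm (p g) (ψ a),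
      real_inner_comm (p g) (ψ b)]
    rcases abs_cases (⟪p g, ψ a⟫ - ⟪p g, ψ b⟫) with h3 | h3 <;> linarith
  have h4 := integral_mono (((hlin _).add (hlin (p (ψ a - ψ b))).abs).const_mul 2⁻¹)
    (integrable_maxInner hψ p) hle
  simp only [Pi.add_apply] at h4
  rw [integral_const_mul, integral_add (hlin _) (hlin _).abs, h0,
    integral_abs_inner_stdGaussian] at h4
  refine le_trans (le_of_eq ?_) h4
  ring

/-- If no convex combination of the feature vectors that is close to `ψ i` in the first component
almost maximizes `v`, then the truncated bonus is large in some direction. -/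
lemma exists_le_familyBonus {i : A} {v : EuclideanSpace ℝ (Fin d)} {τ c : ℝ} (hτ : 0 ≤ τ)
    (h : IsComplementaryPair p q)
    (hsep : ∀ φ ∈ convexHull ℝ (Set.range ψ), ‖p (φ - ψ i)‖ ≤ τ → ⟪v, φ⟫ < maxInner ψ v - c) :
    ∃ u, τ * ‖u‖ + c ≤ familyBonus ψ (p u) v := by
  set m := maxInner ψ v
  -- The hypothesis says that the image of the convex hull under `φ ↦ (p φ, ⟪v, φ⟫)` misses the
  -- product of the ball of radius `τ` around `p (ψ i)` with `[m - c, ∞)`. A functional `(u₀, α)`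
  -- separates the two sets, and `u₀ / α` is the required direction.
  let L : EuclideanSpace ℝ (Fin d) →L[ℝ] EuclideanSpace ℝ (Fin d) × ℝ := p.prod (innerSL ℝ v)
  have hL : ∀ x, L x = (p x, ⟪v, x⟫) := fun x => rfl
  have hcomp : IsCompact (L '' convexHull ℝ (Set.range ψ)) :=
    ((Set.finite_range ψ).isCompact_convexHull (𝕜 := ℝ)).image L.continuous
  have hconv : Convex ℝ (L '' convexHull ℝ (Set.range ψ)) :=
    (convex_convexHull ℝ _).linear_image L.toLinearMap
  have hdisj : Disjoint (L '' convexHull ℝ (Set.range ψ))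
      (Metric.closedBall (p (ψ i)) τ ×ˢ Set.Ici (m - c)) := by
    rw [Set.disjoint_left]
    rintro _ ⟨φ, hφ, rfl⟩ ⟨h1, h2⟩
    rw [hL] at h1 h2
    rw [Metric.mem_closedBall, dist_eq_norm, ← map_sub] at h1
    exact (hsep φ hφ h1).not_ge h2
  obtain ⟨f, a, b, hfa, hab, hfb⟩ := geometric_hahn_banach_compact_closed hconv hcomp
    ((convex_closedBall _ _).prod (convex_Ici _)) (Metric.isClosed_closedBall.prod isClosed_Ici)
    hdisj
  set α := f (0, 1)
  set u₀ := (InnerProductSpace.toDual ℝ _).symm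
    (f.comp (ContinuousLinearMap.inl ℝ (EuclideanSpace ℝ (Fin d)) ℝ)) with hu₀
  have hf : ∀ s y, f (s, y) = ⟪u₀, s⟫ + α * y := by
    intro s y
    rw [hu₀, InnerProductSpace.toDual_symm_apply]
    have : (s, y) = (s, (0 : ℝ)) + y • ((0 : EuclideanSpace ℝ (Fin d)), (1 : ℝ)) := by simp
    rw [this, map_add, map_smul, smul_eq_mul, mul_comm]
    rfl
  have key : ∀ j s y, ‖s - p (ψ i)‖ ≤ τ → m - c ≤ y →
      ⟪u₀, p (ψ j)⟫ + α * ⟪v, ψ j⟫ < ⟪u₀, s⟫ + α * y := by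
    intro j s y hs hy
    rw [← hf, ← hf, ← hL]
    have h1 := hfa (L (ψ j)) ⟨ψ j, subset_convexHull ℝ _ ⟨j, rfl⟩, rfl⟩
    have h2 := hfb (s, y) ⟨by rwa [Metric.mem_closedBall, dist_eq_norm], hy⟩
    linarith
  -- Compare `ψ i` with a point over the same `p (ψ i)` whose second coordinate is strictly larger.
  have hα : 0 < α := by
    have h1 := key i (p (ψ i)) (max (m - c) (⟪v, ψ i⟫ + 1)) (by simpa using hτ) (le_max_left _ _)
    have h2 : ⟪v, ψ i⟫ + 1 ≤ max (m - c) (⟪v, ψ i⟫ + 1) := le_max_right _ _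
    by_contra hneg
    push Not at hneg
    nlinarith
  -- This point minimizes `u₀` on the ball and gains `τ ‖u₀‖`. For `u₀ = 0` the quotient is `0` and
  -- the point is the centre.
  have hs : ‖(p (ψ i) - (τ / ‖u₀‖) • u₀) - p (ψ i)‖ ≤ τ := by
    rw [sub_sub_cancel_left, norm_neg, norm_smul, Real.norm_of_nonneg (by positivity)]
    rcases eq_or_ne ‖u₀‖ 0 with h0 | h0
    · simpa [h0] using hτ
    · rw [div_mul_cancel₀ _ h0]
  have hin : ⟪u₀, p (ψ i) - (τ / ‖u₀‖) • u₀⟫ = ⟪u₀, p (ψ i)⟫ - τ * ‖u₀‖ := by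
    rw [inner_sub_right, inner_smul_right, real_inner_self_eq_norm_sq]
    rcases eq_or_ne ‖u₀‖ 0 with h0 | h0
    · simp [h0]
    · field_simp
  obtain ⟨b', hb'⟩ := exists_maxInner_eq ψ v
  refine ⟨α⁻¹ • u₀, le_familyBonus (a := i) (b := b') fun j => ?_⟩
  have h1 := key j _ (m - c) hs le_rfl
  rw [hin] at h1
  rw [map_smul, inner_smul_left, norm_smul, h.inner_left, map_sub, inner_sub_right, inner_sub_right,
    ← hb', Real.norm_of_nonneg (inv_nonneg.2 hα.le)]
  simp only [conj_trivial]
  have h2 : α * (τ * (α⁻¹ * ‖u₀‖) + c) ≤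
      α * (α⁻¹ * (⟪u₀, p (ψ i)⟫ - ⟪u₀, p (ψ j)⟫) + (m - ⟪v, ψ j⟫)) := by
    have e1 : α * (τ * (α⁻¹ * ‖u₀‖) + c) = τ * ‖u₀‖ + α * c := by field_simp
    have e2 : α * (α⁻¹ * (⟪u₀, p (ψ i)⟫ - ⟪u₀, p (ψ j)⟫) + (m - ⟪v, ψ j⟫)) =
      ⟪u₀, p (ψ i)⟫ - ⟪u₀, p (ψ j)⟫ + α * (m - ⟪v, ψ j⟫) := by field_simp
    rw [e1, e2]
    nlinarith
  exact le_of_mul_le_mul_left h2 hα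

/-- A normalized form of the previous lemma. -/
lemma exists_le_familyBonus_of_norm_le_one {i : A} {v : EuclideanSpace ℝ (Fin d)} {τ c β m₀ : ℝ}
    (hτ : 0 ≤ τ) (hc : 0 ≤ c) (hβ : 0 < β) (hm₁ : m₀ ≤ c) (hm₂ : m₀ ≤ β * τ)
    (h : IsComplementaryPair p q)
    (hsep : ∀ φ ∈ convexHull ℝ (Set.range ψ), ‖p (φ - ψ i)‖ ≤ τ → ⟪v, φ⟫ < maxInner ψ v - c) :
    ∃ (u : EuclideanSpace ℝ (Fin d)) (t : ℝ), p u = u ∧ ‖u‖ ≤ 1 ∧ 0 ≤ t ∧ t ≤ 1 ∧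
      m₀ ≤ familyBonus ψ (β • u) (t • v) := by
  obtain ⟨u, hu⟩ := exists_le_familyBonus hτ h hsep
  have hnorm := h.norm_left_le u
  -- The bonus is positively homogeneous. A short direction is absorbed into `β • u` with `t = 1`,
  -- keeping the gain `c`; a long one is scaled down jointly with `v`, keeping the gain `β τ`.
  by_cases hcase : ‖p u‖ ≤ β
  · refine ⟨β⁻¹ • p u, 1, by rw [map_smul, h.idem_left], ?_, zero_le_one, le_rfl, ?_⟩
    · rw [norm_smul, Real.norm_of_nonneg (inv_nonneg.2 hβ.le), inv_mul_le_iff₀ hβ, mul_one]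
      exact hcase
    · rw [smul_inv_smul₀ hβ.ne', one_smul]
      have : 0 ≤ τ * ‖u‖ := by positivity
      linarith
  · push Not at hcase
    have hpos : 0 < ‖p u‖ := hβ.trans hcase
    refine ⟨‖p u‖⁻¹ • p u, β * ‖p u‖⁻¹, by rw [map_smul, h.idem_left], ?_, by positivity, ?_, ?_⟩
    · rw [norm_smul, Real.norm_of_nonneg (inv_nonneg.2 hpos.le), inv_mul_cancel₀ hpos.ne']
    · rw [← div_eq_mul_inv, div_le_one hpos]
      exact hcase.le
    · rw [smul_smul, familyBonus_smul (by positivity)]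
      have h1 : τ * ‖p u‖ ≤ familyBonus ψ (p u) v := by nlinarith
      calc m₀ ≤ β * ‖p u‖⁻¹ * (τ * ‖p u‖) := by
            rw [show β * ‖p u‖⁻¹ * (τ * ‖p u‖) = β * τ by field_simp]
            exact hm₂
        _ ≤ _ := mul_le_mul_of_nonneg_left h1 (by positivity)

/-- All differences are generated by those to one reference action. This is what keeps the small
ball exponent at `A - 1` instead of `d`. -/
lemma exists_span_differences (p : EuclideanSpace ℝ (Fin d) →L[ℝ] EuclideanSpace ℝ (Fin d))
    (ψ : A → EuclideanSpace ℝ (Fin d)) :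
    ∃ U : Submodule ℝ (EuclideanSpace ℝ (Fin d)),
      Module.finrank ℝ U ≤ Fintype.card A - 1 ∧ ∀ a b, p (ψ a - ψ b) ∈ U := by
  classical
  obtain ⟨a₀⟩ := ‹Nonempty A›
  let f : {a // a ≠ a₀} → EuclideanSpace ℝ (Fin d) := fun a => p (ψ a - ψ a₀)
  have hmem : ∀ a, p (ψ a - ψ a₀) ∈ Submodule.span ℝ (Set.range f) := by
    intro a
    by_cases ha : a = a₀
    · simp [ha]
    · exact Submodule.subset_span ⟨⟨a, ha⟩, rfl⟩
  refine ⟨Submodule.span ℝ (Set.range f), ?_, fun a b => ?_⟩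
  · refine (finrank_range_le_card f).trans ?_
    rw [Fintype.card_subtype_compl, Fintype.card_subtype_eq]
  · have := Submodule.sub_mem _ (hmem a) (hmem b)
    rwa [← map_sub, sub_sub_sub_cancel_right] at this

/-- The expected truncated bonus is large, unless some convex combination of the feature vectors
close to `ψ i` in the first component almost maximizes `v`. -/
lemma le_integral_familyBonus {i : A} {v : EuclideanSpace ℝ (Fin d)} {τ c β m₀ e : ℝ}
    (hd : 1 ≤ d) (hψ : ∀ a, ‖ψ a‖ ≤ 1) (hv : ‖v‖ ≤ 1) (hqv : q v = v)
    (hτ : 0 ≤ τ) (hc : 0 ≤ c) (hβ : 0 < β) (hm₁ : m₀ ≤ c) (hm₂ : m₀ ≤ β * τ)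
    (he : 0 < e) (hde : d * e ≤ 1) (hm₃ : ∀ a b, β * (e * ‖p (ψ a - ψ b)‖) ≤ m₀ / 4)
    (hm₄ : 2 * (d * e) ≤ m₀ / 4) (h : IsComplementaryPair p q)
    (hsep : ∀ φ ∈ convexHull ℝ (Set.range ψ), ‖p (φ - ψ i)‖ ≤ τ → ⟪v, φ⟫ < maxInner ψ v - c) :
    Real.exp (-4) * (e ^ 2 / 4) ^ (Fintype.card A - 1) * (m₀ / 2) ≤
      ∫ g, ∫ g', familyBonus ψ (β • p g) (q g') ∂(stdGaussian (EuclideanSpace ℝ (Fin d)))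
        ∂(stdGaussian (EuclideanSpace ℝ (Fin d))) := by
  obtain ⟨u, t, hpu, hu, ht0, ht1, hut⟩ :=
    exists_le_familyBonus_of_norm_le_one hτ hc hβ hm₁ hm₂ h hsep
  obtain ⟨U, hU, hUmem⟩ := exists_span_differences p ψ
  obtain ⟨W, hW, hWmem⟩ := exists_span_differences q ψ
  set γ := stdGaussian (EuclideanSpace ℝ (Fin d))
  have hd' : (1 : ℝ) ≤ d := by exact_mod_cast hd
  have hsd : 1 ≤ √(d : ℝ) := Real.one_le_sqrt.2 hd'
  have hsd0 : 0 < √(d : ℝ) := by linarith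
  have hsqd : √(d : ℝ) * √d = d := Real.mul_self_sqrt (by positivity)
  have hfr : ((Module.finrank ℝ (EuclideanSpace ℝ (Fin d)) : ℕ) : ℝ) = d := by simp
  have he1 : e ≤ 1 := by nlinarith
  have hm0 : 0 < m₀ := by
    have : 0 < d * e := by positivity
    linarith
  -- The first argument is multiplied by `β` and needs the finer accuracy `e`, the second tolerates
  -- `d * e`. The radii `e / √d` and `√d * e` are chosen so that the dimension cancels in the
  -- product of the two probabilities.
  have b1 := stdGaussian_small_ball hU hu (ρ := e / √d) (by positivity) (by
    rw [hfr, div_pow, Real.sq_sqrt (by positivity), mul_div_cancel₀ _ (by positivity)]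
    nlinarith) (by rw [div_le_iff₀ hsd0]; nlinarith)
  have htv : ‖t • v‖ ≤ 1 := by
    rw [norm_smul, Real.norm_of_nonneg ht0]
    exact mul_le_one₀ ht1 (norm_nonneg _) hv
  have b2 := stdGaussian_small_ball hW htv (ρ := √d * e) (by positivity) (by
    rw [hfr, mul_pow, Real.sq_sqrt (by positivity)]
    nlinarith [mul_pos (show (0 : ℝ) < d by linarith) he]) (by nlinarith)
  rw [hfr] at b1 b2
  rw [div_mul_cancel₀ _ hsd0.ne'] at b1
  rw [show √(d : ℝ) * e * √d = √d * √d * e by ring, hsqd] at b2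
  set Bu := {g : EuclideanSpace ℝ (Fin d) | ∀ y ∈ U, |⟪g - u, y⟫| ≤ e * ‖y‖} with hBu
  set Bv := {g : EuclideanSpace ℝ (Fin d) | ∀ y ∈ W, |⟪g - t • v, y⟫| ≤ d * e * ‖y‖} with hBv
  have hBum : MeasurableSet Bu := measurableSet_small_ball U u _
  have hBvm : MeasurableSet Bv := measurableSet_small_ball W (t • v) _
  -- Each of the two perturbations costs at most `m₀ / 4`, so half of the lower bound `m₀` remains.
  have hpt : ∀ g ∈ Bu, ∀ g' ∈ Bv, m₀ / 2 ≤ familyBonus ψ (β • p g) (q g') := by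
    intro g hg g' hg'
    have h1 := familyBonus_perturb (ψ := ψ) (u := β • u) (v := t • v) (u' := β • p g)
      (v' := q g') (r := m₀ / 4) (s := m₀ / 4) (fun a b => ?_) fun a b => ?_
    · linarith
    · rw [← smul_sub, inner_smul_left, conj_trivial, abs_mul, abs_of_pos hβ]
      refine le_trans (mul_le_mul_of_nonneg_left ?_ hβ.le) (hm₃ a b)
      have h2 := hg _ (hUmem a b)
      rwa [← h.inner_left, map_sub, hpu] at h2
    · refine le_trans ?_ hm₄
      have h2 := hg' _ (hWmem a b)
      rw [← h.inner_right, map_sub, map_smul, hqv] at h2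
      refine h2.trans ?_
      have h3 : ‖q (ψ a - ψ b)‖ ≤ 2 := (h.norm_right_le _).trans
        ((norm_sub_le _ _).trans (by linarith [hψ a, hψ b]))
      have : 0 ≤ d * e := by positivity
      nlinarith
  have hqint : Integrable (fun g' => 2 * ‖q g'‖) γ :=
    (q.integrable_comp (IsGaussian.integrable_id (μ := γ))).norm.const_mul 2
  have hmeas : Measurable fun z : EuclideanSpace ℝ (Fin d) × EuclideanSpace ℝ (Fin d) =>
      familyBonus ψ (β • p z.1) (q z.2) :=
    measurable_familyBonus (fun a => measurable_const) (by fun_prop) (by fun_prop)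
  have hint : ∀ g, Integrable (fun g' => familyBonus ψ (β • p g) (q g')) γ := fun g =>
    hqint.mono' (hmeas.comp measurable_prodMk_left).aestronglyMeasurable
      (ae_of_all _ fun g' => abs_familyBonus_le hψ _ _)
  have hint2 : Integrable (fun g => ∫ g', familyBonus ψ (β • p g) (q g') ∂γ) γ := by
    refine (integrable_const (∫ g', 2 * ‖q g'‖ ∂γ)).mono'
      (hmeas.stronglyMeasurable.integral_prod_right').aestronglyMeasurable (ae_of_all _ fun g => ?_)
    rw [Real.norm_of_nonneg (integral_nonneg fun g' => familyBonus_nonneg _ _)]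
    exact integral_mono (hint g) hqint fun g' => familyBonus_le hψ _ _
  -- The bonus is nonnegative, so everything outside the two small balls may be dropped.
  have hinner : ∀ g, Bu.indicator (fun _ => γ.real Bv * (m₀ / 2)) g ≤
      ∫ g', familyBonus ψ (β • p g) (q g') ∂γ := by
    intro g
    by_cases hg : g ∈ Bu
    · rw [Set.indicator_of_mem hg]
      have h1 : ∫ g', Bv.indicator (fun _ => m₀ / 2) g' ∂γ = γ.real Bv * (m₀ / 2) := by
        rw [integral_indicator_const _ hBvm, smul_eq_mul]
      rw [← h1]
      refine integral_mono ((integrable_const _).indicator hBvm) (hint g) fun g' => ?_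
      by_cases hg' : g' ∈ Bv
      · rw [Set.indicator_of_mem hg']
        exact hpt g hg g' hg'
      · rw [Set.indicator_of_notMem hg']
        exact familyBonus_nonneg _ _
    · rw [Set.indicator_of_notMem hg]
      exact integral_nonneg fun g' => familyBonus_nonneg _ _
  have houter := integral_mono ((integrable_const _).indicator hBum) hint2 hinner
  rw [integral_indicator_const _ hBum, smul_eq_mul] at houter
  refine le_trans ?_ houter
  have e1 : Real.exp (-4) * (e ^ 2 / 4) ^ (Fintype.card A - 1) =
      (Real.exp (-2) * (e / √d / 2) ^ (Fintype.card A - 1)) *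
      (Real.exp (-2) * (√d * e / 2) ^ (Fintype.card A - 1)) := by
    rw [show (-4 : ℝ) = -2 + -2 by norm_num, Real.exp_add, mul_mul_mul_comm, ← mul_pow]
    congr 2
    field_simp
    ring
  rw [e1, ← mul_assoc (γ.real Bu)]
  refine mul_le_mul_of_nonneg_right ?_ (half_pos hm0).le
  exact mul_le_mul b1 b2 (by positivity) measureReal_nonneg

end LowerBounds

/-! ### The bonus at a state -/

section Projections

variable {d : ℕ}

lemma isComplementaryPair_of_matrix {P Q : Matrix (Fin d) (Fin d) ℝ} (hP : IsSelfAdjoint P)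
    (hQ : IsSelfAdjoint Q) (hPP : P * P = P) (hQQ : Q * Q = Q) (hPQ : P + Q = 1) :
    IsComplementaryPair (Matrix.toEuclideanCLM (𝕜 := ℝ) P)
      (Matrix.toEuclideanCLM (𝕜 := ℝ) Q) := by
  have hself : ∀ T : Matrix (Fin d) (Fin d) ℝ, IsSelfAdjoint T →
      ∀ x y, ⟪Matrix.toEuclideanCLM (𝕜 := ℝ) T x, y⟫ = ⟪x, Matrix.toEuclideanCLM (𝕜 := ℝ) T y⟫ := by
    intro T hT x y
    rw [← ContinuousLinearMap.adjoint_inner_right, ← ContinuousLinearMap.star_eq_adjoint,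
      ← map_star, hT.star_eq]
  refine ⟨hself P hP, hself Q hQ, fun x => ?_, fun x => ?_, fun x => ?_⟩
  · rw [← mul_apply_eq_comp, ← map_mul, hPP]
  · rw [← mul_apply_eq_comp, ← map_mul, hQQ]
  · rw [← add_apply, ← map_add, hPQ, map_one]
    rfl

/-- Orthogonal projections satisfy the hypothesis. The two Gaussians of the bonus thus become
projections of standard Gaussian vectors. -/
lemma multivariateGaussian_zero_of_sqrt {T : Matrix (Fin d) (Fin d) ℝ} (hT : CFC.sqrt T = T) :
    multivariateGaussian 0 T =
      (stdGaussian (EuclideanSpace ℝ (Fin d))).map (Matrix.toEuclideanCLM (𝕜 := ℝ) T) := by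
  rw [multivariateGaussian, hT]
  simp only [zero_add]

end Projections

section BonusAt

variable {p : Params} {A : Type*} [Fintype A] [Nonempty A]

/-- The coefficient `(C_cor / ε_apx)^{2A}`. -/
def Params.kap (p : Params) : ℝ := (p.Ccor / p.epsApx) ^ (2 * p.A)

/-- The matrix `Γ` that determines the truncated pair. -/
def gammaMatrix (p : Params) (S : Matrix (Fin p.d) (Fin p.d) ℝ) : Matrix (Fin p.d) (Fin p.d) ℝ :=
  (p.beta / p.lam1) • CFC.sqrt S⁻¹

/-- The projection `Σ'` as a linear map. -/
def highProj (p : Params) (S : Matrix (Fin p.d) (Fin p.d) ℝ) :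
    EuclideanSpace ℝ (Fin p.d) →L[ℝ] EuclideanSpace ℝ (Fin p.d) :=
  Matrix.toEuclideanCLM (𝕜 := ℝ) (truncHigh (gammaMatrix p S) p.sigmaTr)

/-- The projection `Λ'` as a linear map. -/
def lowProj (p : Params) (S : Matrix (Fin p.d) (Fin p.d) ℝ) :
    EuclideanSpace ℝ (Fin p.d) →L[ℝ] EuclideanSpace ℝ (Fin p.d) :=
  Matrix.toEuclideanCLM (𝕜 := ℝ) (truncLow (gammaMatrix p S) p.sigmaTr)

lemma gammaMatrix_isSelfAdjoint (S : Matrix (Fin p.d) (Fin p.d) ℝ) :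
    IsSelfAdjoint (gammaMatrix p S) :=
  (IsSelfAdjoint.all (p.beta / p.lam1)).smul (CFC.sqrt_nonneg S⁻¹).isSelfAdjoint

lemma isComplementaryPair_highProj_lowProj (S : Matrix (Fin p.d) (Fin p.d) ℝ) :
    IsComplementaryPair (highProj p S) (lowProj p S) :=
  isComplementaryPair_of_matrix truncHigh_isSelfAdjoint truncLow_nonneg.isSelfAdjoint
    truncHigh_mul_self truncLow_mul_self (truncHigh_add_truncLow (gammaMatrix_isSelfAdjoint S))

/-- The bonus in terms of standard Gaussian vectors. -/
lemma bonusAt_eq (ψ : A → EuclideanSpace ℝ (Fin p.d)) (S : Matrix (Fin p.d) (Fin p.d) ℝ) :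
    bonusAt p ψ S = p.lam1 * p.kap *
      (∫ g, ∫ g', familyBonus ψ (p.beta • highProj p S g) (lowProj p S g')
        ∂(stdGaussian (EuclideanSpace ℝ (Fin p.d))) ∂(stdGaussian (EuclideanSpace ℝ (Fin p.d)))) +
      2 * √(2 * Real.pi) * p.lam1 * p.xi *
        ∫ g, maxInner ψ (highProj p S g) ∂(stdGaussian (EuclideanSpace ℝ (Fin p.d))) := by
  have hm : Measurable fun z : EuclideanSpace ℝ (Fin p.d) × EuclideanSpace ℝ (Fin p.d) =>
      familyBonus ψ (p.beta • z.1) z.2 :=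
    measurable_familyBonus (ψ := fun _ => ψ) (fun a => measurable_const) (by fun_prop)
      (by fun_prop)
  have hm1 : Measurable fun u : EuclideanSpace ℝ (Fin p.d) => maxInner ψ u :=
    measurable_maxInner (ψ := fun _ => ψ) (fun a => measurable_const) measurable_id
  simp only [bonusAt, truncLinBonus_convexHull_range]
  change p.lam1 * (p.Ccor / p.epsApx) ^ (2 * p.A) *
      (∫ u, ∫ v, familyBonus ψ (p.beta • u) v
        ∂(multivariateGaussian 0 (truncLow (gammaMatrix p S) p.sigmaTr))
        ∂(multivariateGaussian 0 (truncHigh (gammaMatrix p S) p.sigmaTr))) +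
    2 * √(2 * Real.pi) * p.lam1 * p.xi *
      ∫ w, maxInner ψ w ∂(multivariateGaussian 0 (truncHigh (gammaMatrix p S) p.sigmaTr)) = _
  rw [multivariateGaussian_zero_of_sqrt sqrt_truncHigh,
    multivariateGaussian_zero_of_sqrt sqrt_truncLow]
  rw [integral_map (by fun_prop) hm1.aestronglyMeasurable,
    integral_map (by fun_prop)
      (hm.stronglyMeasurable.integral_prod_right').aestronglyMeasurable]
  congr 2
  refine integral_congr_ae (ae_of_all _ fun g => ?_)
  exact integral_map (by fun_prop) (hm.comp measurable_prodMk_left).aestronglyMeasurable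

end BonusAt

/-! ### The parameters -/

/-- The hypotheses on the parameters that are used below. -/
structure Params.Admissible (p : Params) : Prop where
  A_pos : 1 ≤ p.A
  H_pos : 1 ≤ p.H
  d_pos : 1 ≤ p.d
  T_pos : 1 ≤ p.T
  one_le_B : 1 ≤ p.B
  δ_pos : 0 < p.δ
  δ_lt : p.δ < 1
  ε_pos : 0 < p.εfinal
  ε_lt : p.εfinal < 1
  Cpsd_ge : 2 ≤ p.Cpsd
  Ccor_ge : 2 ≤ p.Ccor
  Cphi_ge : p.Cpsd ≤ p.Cphi

namespace Params.Admissible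

variable {p : Params}

lemma cast_H (hp : p.Admissible) : (1 : ℝ) ≤ p.H := by exact_mod_cast hp.H_pos

lemma cast_d (hp : p.Admissible) : (1 : ℝ) ≤ p.d := by exact_mod_cast hp.d_pos

lemma cast_T (hp : p.Admissible) : (1 : ℝ) ≤ p.T := by exact_mod_cast hp.T_pos

lemma three_le_n (hp : p.Admissible) : (3 : ℝ) ≤ p.n := by
  have := hp.T_pos
  exact_mod_cast (by simp only [Params.n]; omega : 3 ≤ p.n)

lemma one_le_log {x : ℝ} (hx : 3 ≤ x) : 1 ≤ Real.log x := by
  rw [Real.le_log_iff_exp_le (by linarith)]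
  linarith [Real.exp_one_lt_d9]

lemma one_le_TH (hp : p.Admissible) : (1 : ℝ) ≤ p.T * p.H :=
  one_le_mul_of_one_le_of_one_le hp.cast_T hp.cast_H

lemma one_le_lam (hp : p.Admissible) : 1 ≤ p.lam := by
  have h1 : 1 ≤ Real.log (2 * p.T * p.H * p.n / p.δ) := by
    apply one_le_log
    rw [le_div_iff₀ hp.δ_pos]
    nlinarith [hp.one_le_TH, hp.three_le_n, hp.δ_lt]
  have h2 : 1 ≤ p.Cpsd * p.d :=
    one_le_mul_of_one_le_of_one_le (by linarith [hp.Cpsd_ge]) hp.cast_d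
  exact one_le_mul_of_one_le_of_one_le h2 h1

lemma lam_d_nonneg (hp : p.Admissible) : 0 ≤ p.lam * p.d :=
  mul_nonneg (by linarith [hp.one_le_lam]) (by positivity)

lemma one_le_iota (hp : p.Admissible) : 1 ≤ p.iota := by
  apply one_le_log
  rw [le_div_iff₀ hp.δ_pos]
  nlinarith [hp.one_le_TH, hp.three_le_n, hp.δ_lt, hp.lam_d_nonneg]

/-- The logarithm in `λ` exceeds `ι` by at most `log 2 < 1 ≤ ι`. -/
lemma lam_le (hp : p.Admissible) : p.lam ≤ 2 * p.Cpsd * p.d * p.iota := by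
  have h1 : Real.log (2 * p.T * p.H * p.n / p.δ) ≤ 2 * p.iota := by
    have h2 : 0 < p.T * p.H * (p.lam * p.d + p.n) / p.δ := by
      have := hp.one_le_TH
      have := hp.three_le_n
      have := hp.lam_d_nonneg
      have := hp.δ_pos
      positivity
    have h3 : 2 * p.T * p.H * p.n / p.δ ≤ 2 * (p.T * p.H * (p.lam * p.d + p.n) / p.δ) := by
      rw [← mul_div_assoc]
      refine div_le_div_of_nonneg_right ?_ hp.δ_pos.le
      nlinarith [hp.one_le_TH, hp.lam_d_nonneg]
    have h4 : 0 < 2 * p.T * p.H * p.n / p.δ := by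
      have := hp.cast_T
      have := hp.cast_H
      have := hp.three_le_n
      have := hp.δ_pos
      positivity
    have h5 := Real.log_le_log h4 h3
    rw [Real.log_mul two_ne_zero h2.ne'] at h5
    have h6 := hp.one_le_iota
    have h7 := Real.log_two_lt_d9
    simp only [Params.iota] at h6 ⊢
    linarith
  have h2 : 0 ≤ p.Cpsd * p.d := mul_nonneg (by linarith [hp.Cpsd_ge]) (by positivity)
  calc p.lam ≤ p.Cpsd * p.d * (2 * p.iota) := mul_le_mul_of_nonneg_left h1 h2
    _ = _ := by ring

lemma one_le_lam1 (hp : p.Admissible) : 1 ≤ p.lam1 :=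
  one_le_mul_of_one_le_of_one_le hp.one_le_B hp.cast_H

lemma epsBkup_pos (hp : p.Admissible) : 0 < p.epsBkup :=
  div_pos hp.ε_pos (by linarith [hp.cast_H])

lemma epsBkup_le (hp : p.Admissible) : p.epsBkup ≤ 1 := by
  rw [Params.epsBkup, div_le_one (by linarith [hp.cast_H])]
  linarith [hp.cast_H, hp.ε_lt]

lemma one_le_sqrt_two_pi : 1 ≤ √(2 * Real.pi) :=
  Real.one_le_sqrt.2 (by linarith [Real.pi_gt_three])

/-- The ratio `β / ξ`. -/
def _root_.Params.ratio (p : Params) : ℝ :=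
  8 * √(2 * Real.pi) * p.Cphi * p.H * p.B * p.lam1 * p.d * √p.iota

lemma ratio_ge (hp : p.Admissible) : 8 * p.lam1 * p.d ≤ p.ratio := by
  have h1 := one_le_sqrt_two_pi
  have h2 : 1 ≤ p.Cphi := by linarith [hp.Cphi_ge, hp.Cpsd_ge]
  have h3 := hp.cast_H
  have h4 := hp.one_le_B
  have h5 : 1 ≤ √p.iota := Real.one_le_sqrt.2 hp.one_le_iota
  have h6 : 1 ≤ √(2 * Real.pi) * p.Cphi * p.H * p.B * √p.iota :=
    one_le_mul_of_one_le_of_one_le (one_le_mul_of_one_le_of_one_le (one_le_mul_of_one_le_of_one_le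
      (one_le_mul_of_one_le_of_one_le h1 h2) h3) h4) h5
  have h7 : 0 ≤ 8 * p.lam1 * p.d := by
    have := hp.one_le_lam1
    positivity
  calc 8 * p.lam1 * p.d ≤ 8 * p.lam1 * p.d * (√(2 * Real.pi) * p.Cphi * p.H * p.B * √p.iota) :=
        le_mul_of_one_le_right h7 h6
    _ = p.ratio := by rw [Params.ratio]; ring

lemma ratio_pos (hp : p.Admissible) : 0 < p.ratio := by
  have := hp.ratio_ge
  have := hp.one_le_lam1
  have := hp.cast_d
  have : 0 < 8 * p.lam1 * p.d := by positivity
  linarith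

/-- The identity behind the choice of `ε_apx`: where the features have width at most `1 / ξ` under
`Σ'`, an error `ε_apx` in the Gaussian direction, amplified by `β = ξ · ratio`, costs at most
`ε_bkup / (16 λ₁)`. -/
lemma epsApx_mul_ratio (hp : p.Admissible) : p.epsApx * p.ratio = p.epsBkup / (16 * p.lam1) := by
  have h1 := hp.one_le_lam1
  have h2 : 128 * √(2 * Real.pi) * p.Cphi * p.lam1 ^ 2 * p.H * p.B * p.d * √p.iota =
      16 * p.lam1 * p.ratio := by rw [Params.ratio]; ring
  rw [Params.epsApx, h2]
  have := hp.ratio_pos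
  field_simp

lemma epsApx_pos (hp : p.Admissible) : 0 < p.epsApx := by
  have h1 := hp.epsApx_mul_ratio
  have h2 := hp.one_le_lam1
  have h3 : 0 < p.epsBkup / (16 * p.lam1) := div_pos hp.epsBkup_pos (by linarith)
  rw [← h1] at h3
  exact pos_of_mul_pos_left h3 hp.ratio_pos.le

lemma d_mul_epsApx_le (hp : p.Admissible) : p.d * p.epsApx ≤ p.epsBkup / (128 * p.lam1) := by
  have h1 := hp.epsApx_mul_ratio
  have h2 := hp.one_le_lam1
  have h3 := hp.ratio_ge
  have h4 := hp.epsApx_pos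
  have h5 : p.epsApx * (8 * p.d) ≤ p.epsApx * p.ratio := by
    refine mul_le_mul_of_nonneg_left (le_trans ?_ h3) h4.le
    nlinarith [hp.cast_d]
  rw [h1, le_div_iff₀ (by linarith)] at h5
  rw [le_div_iff₀ (by linarith)]
  linarith

lemma epsApx_le (hp : p.Admissible) : p.epsApx ≤ p.epsBkup / (128 * p.lam1) := by
  refine le_trans ?_ hp.d_mul_epsApx_le
  nlinarith [hp.cast_d, hp.epsApx_pos]

lemma epsApx_le' (hp : p.Admissible) : p.epsApx ≤ 1 / 128 := by
  refine hp.epsApx_le.trans ?_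
  have h2 := hp.one_le_lam1
  rw [div_le_div_iff₀ (by linarith) (by norm_num)]
  linarith [hp.epsBkup_le]

lemma d_mul_epsApx_le_one (hp : p.Admissible) : p.d * p.epsApx ≤ 1 := by
  refine hp.d_mul_epsApx_le.trans ?_
  have h2 := hp.one_le_lam1
  rw [div_le_one (by linarith)]
  linarith [hp.epsBkup_le]

/-- `A - 1` of the `A` factors `(C_cor/ε_apx)²` cancel the small ball probability, since `C_cor² / 4
≥ 1`. The remaining factor gives `1 / ε_apx²`, to be played off against the accuracy `ε_bkup / λ₁`.
-/
lemma four_div_sq_le (hp : p.Admissible) :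
    4 / p.epsApx ^ 2 ≤ p.kap * (p.epsApx ^ 2 / 4) ^ (p.A - 1) := by
  obtain ⟨k, hk⟩ : ∃ k, p.A = k + 1 := ⟨p.A - 1, by have := hp.A_pos; omega⟩
  have he := hp.epsApx_pos
  have h1 : p.kap * (p.epsApx ^ 2 / 4) ^ (p.A - 1) =
      (p.Ccor ^ 2 / 4) ^ k * (p.Ccor ^ 2 / p.epsApx ^ 2) := by
    rw [Params.kap, hk, Nat.add_sub_cancel, pow_mul, pow_succ, div_pow, mul_right_comm, ← mul_pow]
    congr 2
    field_simp
  have h2 : 4 ≤ p.Ccor ^ 2 := by nlinarith [hp.Ccor_ge]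
  have h3 : 1 ≤ (p.Ccor ^ 2 / 4) ^ k := one_le_pow₀ (by linarith)
  rw [h1]
  have h4 : 4 / p.epsApx ^ 2 ≤ p.Ccor ^ 2 / p.epsApx ^ 2 :=
    div_le_div_of_nonneg_right h2 (by positivity)
  refine h4.trans (le_mul_of_one_le_left (by positivity) h3)

lemma one_le_kap (hp : p.Admissible) : 4 ≤ p.kap := by
  have h1 : 2 ≤ p.Ccor / p.epsApx := by
    rw [le_div_iff₀ hp.epsApx_pos]
    linarith [hp.epsApx_le', hp.Ccor_ge]
  have h2 : 2 ≤ 2 * p.A := by have := hp.A_pos; omega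
  calc (4 : ℝ) = 2 ^ 2 := by norm_num
    _ ≤ (p.Ccor / p.epsApx) ^ 2 := pow_le_pow_left₀ (by norm_num) h1 2
    _ ≤ _ := pow_le_pow_right₀ (by linarith) h2

lemma _root_.Params.beta_eq (p : Params) :
    p.beta = 20 * p.Cphi * p.H * p.B * p.lam1 * p.d * √p.iota * p.kap := by
  rw [Params.beta, Real.sqrt_mul (Nat.cast_nonneg _), Params.kap]
  have : √(p.d : ℝ) * √p.d = p.d := Real.mul_self_sqrt (Nat.cast_nonneg _)
  calc _ = 20 * p.Cphi * p.H * p.B * p.lam1 * (√(p.d : ℝ) * √p.d) * √p.iota *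
      (p.Ccor / p.epsApx) ^ (2 * p.A) := by ring
    _ = _ := by rw [this]

lemma xi_mul_ratio (hp : p.Admissible) : p.xi * p.ratio = p.beta := by
  have h1 : 4 * p.Cphi * p.H * p.B * √(p.d * p.iota) *
      (2 * √(2 * Real.pi) * p.lam1 * √p.d) = p.ratio := by
    rw [Real.sqrt_mul (Nat.cast_nonneg _), Params.ratio]
    have : √(p.d : ℝ) * √p.d = p.d := Real.mul_self_sqrt (Nat.cast_nonneg _)
    calc _ = 8 * √(2 * Real.pi) * p.Cphi * p.H * p.B * p.lam1 * (√(p.d : ℝ) * √p.d) * √p.iota := by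
          ring
      _ = _ := by rw [this]
  rw [Params.xi, h1, div_mul_cancel₀ _ hp.ratio_pos.ne']

/-- `β` and the denominator of `ξ` agree except for `5 (C_cor/ε_apx)^(2A)` against `2 √(2π)`. Hence
`ξ` is of the order of `kap`, in particular at least 1. -/
lemma xi_eq (hp : p.Admissible) : p.xi * √(2 * Real.pi) * 2 = 5 * p.kap := by
  have h1 := hp.xi_mul_ratio
  have h2 : p.beta * (√(2 * Real.pi) * 2) = 5 * p.kap * p.ratio := by
    rw [p.beta_eq, Params.ratio]
    ring
  have h3 : (p.xi * √(2 * Real.pi) * 2) * p.ratio = (5 * p.kap) * p.ratio := by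
    rw [← h2, ← h1]
    ring
  exact mul_right_cancel₀ hp.ratio_pos.ne' h3

lemma one_le_xi (hp : p.Admissible) : 1 ≤ p.xi := by
  have h1 := hp.xi_eq
  have h2 := hp.one_le_kap
  have hpi : √(2 * Real.pi) ≤ 4 := by
    rw [Real.sqrt_le_left (by norm_num)]
    linarith [Real.pi_lt_four]
  have h3 := one_le_sqrt_two_pi
  by_contra hneg
  push Not at hneg
  nlinarith

lemma beta_pos (hp : p.Admissible) : 0 < p.beta := by
  rw [← hp.xi_mul_ratio]
  exact mul_pos (by linarith [hp.one_le_xi]) hp.ratio_pos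

/-- Ensures that in round 1 the only eigenvalue `β / (λ₁ √λ)` of `Γ` reaches the threshold `σ_tr`.
Here `C_phi ≥ C_psd` enters, as `λ` is proportional to `C_psd` up to the logarithm. -/
lemma sqrt_lam_le_beta (hp : p.Admissible) : √p.lam ≤ p.beta := by
  have h2 : 2 ≤ p.Cphi := by linarith [hp.Cphi_ge, hp.Cpsd_ge]
  have h5 : 1 ≤ √p.iota := Real.one_le_sqrt.2 hp.one_le_iota
  have h6 : 1 ≤ 20 * p.H * p.B * p.lam1 * p.kap := by
    have := one_le_mul_of_one_le_of_one_le (one_le_mul_of_one_le_of_one_le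
      (one_le_mul_of_one_le_of_one_le hp.cast_H hp.one_le_B) hp.one_le_lam1)
      (by linarith [hp.one_le_kap] : 1 ≤ p.kap)
    linarith
  have h7 : √p.lam ≤ 2 * (p.Cphi * p.d * √p.iota) := by
    rw [Real.sqrt_le_left (by have := hp.cast_d; positivity)]
    refine hp.lam_le.trans ?_
    rw [mul_pow, mul_pow, Real.sq_sqrt (by linarith [hp.one_le_iota])]
    have h8 : p.Cpsd * p.d ≤ (p.Cphi * p.d) ^ 2 := by
      have h9 : p.Cpsd * p.d ≤ p.Cphi * p.d :=
        mul_le_mul_of_nonneg_right hp.Cphi_ge (Nat.cast_nonneg _)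
      have h10 : 1 ≤ p.Cphi * p.d :=
        one_le_mul_of_one_le_of_one_le (by linarith) hp.cast_d
      nlinarith
    nlinarith [hp.one_le_iota, mul_le_mul_of_nonneg_right h8 (by linarith [hp.one_le_iota] : 0 ≤ p.iota),
      sq_nonneg (p.Cphi * p.d)]
  have h8 : 0 ≤ p.Cphi * p.d * √p.iota := by have := hp.cast_d; positivity
  have h9 : 2 ≤ 20 * p.H * p.B * p.lam1 * p.kap := by
    have := one_le_mul_of_one_le_of_one_le (one_le_mul_of_one_le_of_one_le
      (one_le_mul_of_one_le_of_one_le hp.cast_H hp.one_le_B) hp.one_le_lam1)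
      (by linarith [hp.one_le_kap] : 1 ≤ p.kap)
    linarith
  calc √p.lam ≤ 2 * (p.Cphi * p.d * √p.iota) := h7
    _ ≤ (20 * p.H * p.B * p.lam1 * p.kap) * (p.Cphi * p.d * √p.iota) :=
      mul_le_mul_of_nonneg_right h9 h8
    _ = p.beta := by rw [p.beta_eq]; ring

end Params.Admissible

/-! ### Comparison of the bonus with linear functions at one state -/

section StateComparison

variable {p : Params} {A : Type*} [Fintype A] [Nonempty A] {ψ : A → EuclideanSpace ℝ (Fin p.d)}
  {S : Matrix (Fin p.d) (Fin p.d) ℝ}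

lemma firstBonus_nonneg (hp : p.Admissible) : 0 ≤ p.lam1 * p.kap *
    ∫ g, ∫ g', familyBonus ψ (p.beta • highProj p S g) (lowProj p S g')
      ∂(stdGaussian (EuclideanSpace ℝ (Fin p.d))) ∂(stdGaussian (EuclideanSpace ℝ (Fin p.d))) :=
  mul_nonneg (mul_nonneg (by linarith [hp.one_le_lam1]) (by linarith [hp.one_le_kap]))
    (integral_nonneg fun _ => integral_nonneg fun _ => familyBonus_nonneg _ _)

/-- The factor `√(2π)` of the bonus undoes the loss in `norm_sub_le_integral_maxInner`. -/
lemma secondBonus_ge (hp : p.Admissible) (hψ : ∀ a, ‖ψ a‖ ≤ 1) (a b : A) :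
    2 * p.lam1 * (p.xi * ‖highProj p S (ψ a - ψ b)‖) ≤ 2 * √(2 * Real.pi) * p.lam1 * p.xi *
      ∫ g, maxInner ψ (highProj p S g) ∂(stdGaussian (EuclideanSpace ℝ (Fin p.d))) := by
  have h1 := norm_sub_le_integral_maxInner (isComplementaryPair_highProj_lowProj S) hψ a b
  have h2 := Params.Admissible.one_le_sqrt_two_pi
  have h3 := hp.one_le_lam1
  have h4 := hp.one_le_xi
  have h5 : 0 ≤ 2 * √(2 * Real.pi) * p.lam1 * p.xi := by positivity
  refine le_trans (le_of_eq ?_) (mul_le_mul_of_nonneg_left h1 h5)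
  field_simp

lemma bonusAt_ge_width (hp : p.Admissible) (hψ : ∀ a, ‖ψ a‖ ≤ 1) (a b : A) :
    2 * p.lam1 * (p.xi * ‖highProj p S (ψ a - ψ b)‖) ≤ bonusAt p ψ S := by
  rw [bonusAt_eq]
  linarith [secondBonus_ge (S := S) hp hψ a b, firstBonus_nonneg (ψ := ψ) (S := S) hp]

/-- Without samples, the bonus dominates all differences of linear functions. -/
lemma le_bonusAt_smul_one (hp : p.Admissible) (hψ : ∀ a, ‖ψ a‖ ≤ 1) (a b : A) :
    p.lam1 * ‖ψ a - ψ b‖ ≤ bonusAt p ψ (p.lam • 1) := by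
  have hl : 0 < p.lam := by linarith [hp.one_le_lam]
  have hsl : 0 < √p.lam := Real.sqrt_pos.2 hl
  have h1l := hp.one_le_lam1
  have hsqrt : CFC.sqrt (p.lam • (1 : Matrix (Fin p.d) (Fin p.d) ℝ))⁻¹ = (√p.lam)⁻¹ • 1 := by
    refine CFC.sqrt_unique ?_ ?_
    · rw [smul_mul_smul_comm, mul_one, ← mul_inv, Real.mul_self_sqrt hl.le]
      symm
      refine Matrix.inv_eq_left_inv ?_
      rw [smul_mul_smul_comm, mul_one, inv_mul_cancel₀ hl.ne', one_smul]
    · exact smul_nonneg (inv_nonneg.2 hsl.le) zero_le_one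
  have hσ : p.sigmaTr ≤ p.beta / p.lam1 * (√p.lam)⁻¹ := by
    rw [Params.sigmaTr, ← div_eq_mul_inv, div_div, div_le_div_iff₀ (by linarith) (by positivity)]
    have h2 := hp.sqrt_lam_le_beta
    have h3 := hp.epsBkup_le
    have h4 : p.epsBkup * √p.lam ≤ 1 * p.beta :=
      mul_le_mul h3 h2 hsl.le zero_le_one
    nlinarith
  have hproj : highProj p (p.lam • 1) = 1 := by
    rw [highProj, gammaMatrix, hsqrt, smul_smul, truncHigh_smul_one hσ, map_one]
  refine le_trans ?_ (bonusAt_ge_width (S := p.lam • 1) hp hψ a b)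
  rw [hproj, one_apply_eq_self]
  have h2 := hp.one_le_xi
  have h3 : p.lam1 * ‖ψ a - ψ b‖ * 1 ≤ p.lam1 * ‖ψ a - ψ b‖ * (2 * p.xi) :=
    mul_le_mul_of_nonneg_left (by linarith) (by positivity)
  linarith

/-- If the bonus is not already large, every action can be replaced by a convex combination of
actions that is close to it in the confidence norm and almost maximizes a given linear function. -/
lemma exists_convex_combination (hp : p.Admissible) (hA : p.A = Fintype.card A)
    (hψ : ∀ a, ‖ψ a‖ ≤ 1) (hS : p.lam • (1 : Matrix (Fin p.d) (Fin p.d) ℝ) ≤ S)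
    {w : EuclideanSpace ℝ (Fin p.d)} (hw : ‖w‖ ≤ p.lam1) (i : A) :
    ∃ φ ∈ convexHull ℝ (Set.range ψ),
      p.beta * √((φ - ψ i).ofLp ⬝ᵥ (S⁻¹ *ᵥ (φ - ψ i).ofLp)) ≤ p.epsBkup * (3 / 4) ∧
      maxInner ψ w - ⟪w, φ⟫ ≤ bonusAt p ψ S + p.epsBkup / 4 := by
  have hl : 1 ≤ p.lam := hp.one_le_lam
  have hsl : 1 ≤ √p.lam := Real.one_le_sqrt.2 hl
  have h1l := hp.one_le_lam1
  have hε := hp.epsBkup_pos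
  have hβ := hp.beta_pos
  have hξ := hp.one_le_xi
  have he := hp.epsApx_pos
  have hpair := isComplementaryPair_highProj_lowProj (p := p) S
  have hw0 := norm_nonneg w
  -- Linear functions with `‖w‖ ≤ λ₁` vary by at most `2 λ₁` over the features, so a bonus of this
  -- size allows `φ = ψ i` itself.
  have htrivial : 2 * p.lam1 ≤ bonusAt p ψ S → ∃ φ ∈ convexHull ℝ (Set.range ψ),
      p.beta * √((φ - ψ i).ofLp ⬝ᵥ (S⁻¹ *ᵥ (φ - ψ i).ofLp)) ≤ p.epsBkup * (3 / 4) ∧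
      maxInner ψ w - ⟪w, φ⟫ ≤ bonusAt p ψ S + p.epsBkup / 4 := by
    intro hbig
    refine ⟨ψ i, subset_convexHull ℝ _ ⟨i, rfl⟩, ?_, ?_⟩
    · simp only [sub_self, WithLp.ofLp_zero, zero_dotProduct, Real.sqrt_zero, mul_zero]
      positivity
    · have h1 := maxInner_le_norm hψ w
      have h2 := (abs_le.1 ((abs_real_inner_le_norm w (ψ i)).trans
        (mul_le_of_le_one_right hw0 (hψ i)))).1
      linarith
  by_cases hwidth : ∃ a b, 1 ≤ p.xi * ‖highProj p S (ψ a - ψ b)‖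
  · obtain ⟨a, b, hab⟩ := hwidth
    refine htrivial ((le_mul_of_one_le_right (by linarith) hab).trans ?_)
    exact bonusAt_ge_width hp hψ a b
  push Not at hwidth
  -- The error budget: a high part of norm `τ` costs `(β/√λ) τ = ε_bkup / 4`, the low part costs at
  -- most `2 λ₁ σ_tr = ε_bkup / 2`, and missing the maximum of `v` by `c` costs `λ₁ c = ε_bkup / 4`.
  set τ := p.epsBkup * √p.lam / (4 * p.beta) with hτdef
  set c := p.epsBkup / (4 * p.lam1) with hcdef
  have hτ : 0 ≤ τ := by positivity
  have hc : 0 < c := by positivity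
  set v := p.lam1⁻¹ • lowProj p S w with hvdef
  by_cases hex : ∃ φ ∈ convexHull ℝ (Set.range ψ), ‖highProj p S (φ - ψ i)‖ ≤ τ ∧
      maxInner ψ v - c ≤ ⟪v, φ⟫
  · obtain ⟨φ, hφ, hφτ, hφv⟩ := hex
    have hball : ∀ y ∈ convexHull ℝ (Set.range ψ), ‖y‖ ≤ 1 := by
      intro y hy
      have := convexHull_min (s := Set.range ψ) (t := Metric.closedBall 0 1)
        (by rintro _ ⟨a, rfl⟩; simpa using hψ a) (convex_closedBall _ _) hy
      simpa using this
    refine ⟨φ, hφ, ?_, ?_⟩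
    · have h1 := sqrt_dotProduct_inv_le (l := p.lam) (b := p.beta / p.lam1) (σ := p.sigmaTr)
        (by linarith) (by positivity) (by unfold Params.sigmaTr; positivity) hS (φ - ψ i)
      change _ ≤ p.beta / p.lam1 / √p.lam * ‖highProj p S (φ - ψ i)‖ +
        p.sigmaTr * ‖lowProj p S (φ - ψ i)‖ at h1
      have h2 : ‖lowProj p S (φ - ψ i)‖ ≤ 2 := (hpair.norm_right_le _).trans
        ((norm_sub_le _ _).trans (by linarith [hball φ hφ, hψ i]))
      have h3 := mul_le_mul_of_nonneg_left h1 (show 0 ≤ p.lam1 by linarith)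
      have h4 : p.lam1 * (p.beta / p.lam1 / √p.lam * ‖highProj p S (φ - ψ i)‖) ≤
          p.epsBkup / 4 := by
        calc _ ≤ p.lam1 * (p.beta / p.lam1 / √p.lam * τ) := by gcongr
          _ = _ := by rw [hτdef]; field_simp
      have h5 : p.lam1 * (p.sigmaTr * ‖lowProj p S (φ - ψ i)‖) ≤ p.epsBkup / 2 := by
        calc _ ≤ p.lam1 * (p.sigmaTr * 2) := by unfold Params.sigmaTr; gcongr
          _ = _ := by rw [Params.sigmaTr]; field_simp; norm_num
      have h6 : p.lam1 * (p.beta / p.lam1 * √((φ - ψ i).ofLp ⬝ᵥ (S⁻¹ *ᵥ (φ - ψ i).ofLp))) =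
          p.beta * √((φ - ψ i).ofLp ⬝ᵥ (S⁻¹ *ᵥ (φ - ψ i).ofLp)) := by field_simp
      linarith
    · obtain ⟨a, ha⟩ := exists_maxInner_eq ψ w
      -- The high part of `w` may be as small at `φ` as at its minimizer `b`; the resulting loss is
      -- bounded by the width of the features.
      obtain ⟨b, hb⟩ := exists_maxInner_eq ψ (-highProj p S w)
      have h1 := inner_le_maxInner_of_mem_convexHull hφ (-highProj p S w)
      have h2 := le_maxInner ψ v a
      have h3 : ∀ y, ⟪w, y⟫ = ⟪highProj p S w, y⟫ + p.lam1 * ⟪v, y⟫ := by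
        intro y
        rw [hvdef, real_inner_smul_left, mul_inv_cancel_left₀ (by linarith), ← inner_add_left,
          hpair.add_eq]
      have h4 : ⟪highProj p S w, ψ a - ψ b⟫ ≤ bonusAt p ψ S := by
        refine le_trans ?_ (bonusAt_ge_width hp hψ a b)
        rw [hpair.inner_left]
        refine (real_inner_le_norm _ _).trans ?_
        have h5 : ‖w‖ * ‖highProj p S (ψ a - ψ b)‖ ≤ p.lam1 * ‖highProj p S (ψ a - ψ b)‖ := by
          gcongr
        have h6 : p.lam1 * ‖highProj p S (ψ a - ψ b)‖ * 1 ≤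
            p.lam1 * ‖highProj p S (ψ a - ψ b)‖ * (2 * p.xi) :=
          mul_le_mul_of_nonneg_left (by linarith) (by positivity)
        linarith
      have h7 : p.lam1 * (⟪v, ψ a⟫ - ⟪v, φ⟫) ≤ p.epsBkup / 4 := by
        calc _ ≤ p.lam1 * c := mul_le_mul_of_nonneg_left (by linarith) (by linarith)
          _ = _ := by rw [hcdef]; field_simp
      rw [hb] at h1
      rw [ha, h3, h3]
      simp only [inner_neg_left, inner_sub_right] at h1 h4
      linarith
  · push Not at hex
    apply htrivial
    have hv1 : ‖v‖ ≤ 1 := by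
      rw [hvdef, norm_smul, Real.norm_of_nonneg (by positivity), inv_mul_le_iff₀ (by linarith),
        mul_one]
      exact (hpair.norm_right_le w).trans hw
    have hqv : lowProj p S v = v := by rw [hvdef, map_smul, hpair.idem_right]
    have hc16 : c / 4 = p.epsBkup / (16 * p.lam1) := by rw [hcdef]; field_simp; norm_num
    -- No suitable `φ` exists. The separation argument applies with `m₀ = c`, which is at most `β τ
    -- = ε_bkup √λ / 4`, and makes the first bonus term at least `2 λ₁`.
    have h1 := le_integral_familyBonus (p := highProj p S) (q := lowProj p S) (i := i) (m₀ := c)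
      (e := p.epsApx) hp.d_pos hψ hv1 hqv hτ hc.le hβ le_rfl (by
        have : p.beta * τ = p.epsBkup * √p.lam / 4 := by rw [hτdef]; field_simp
        rw [this, hcdef, div_le_div_iff₀ (by linarith) (by norm_num)]
        have : 1 ≤ √p.lam * p.lam1 := one_le_mul_of_one_le_of_one_le hsl h1l
        nlinarith) he hp.d_mul_epsApx_le_one (by
        intro a b
        rw [hc16, ← hp.epsApx_mul_ratio, ← hp.xi_mul_ratio]
        have h2 := mul_le_mul_of_nonneg_left (hwidth a b).le
          (mul_pos he hp.ratio_pos).le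
        linarith) (by
        rw [hc16]
        have h2 := hp.d_mul_epsApx_le
        have h3 : p.epsBkup / (128 * p.lam1) * 8 = p.epsBkup / (16 * p.lam1) := by
          field_simp; norm_num
        have h4 : 0 ≤ p.epsBkup / (128 * p.lam1) := by positivity
        linarith) hpair hex
    rw [← hA] at h1
    have hk : 0 < p.kap := by linarith [hp.one_le_kap]
    have h2 := mul_le_mul_of_nonneg_left h1 hk.le
    have h3 : 2 ≤ p.kap * (Real.exp (-4) * (p.epsApx ^ 2 / 4) ^ (p.A - 1) * (c / 2)) := by
      have h4 := hp.four_div_sq_le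
      have h5 : (1 : ℝ) / 64 ≤ Real.exp (-4) := by
        rw [Real.exp_neg, ← one_div]
        refine one_div_le_one_div_of_le (Real.exp_pos _) ?_
        have : Real.exp 4 = Real.exp 1 ^ 4 := by rw [← Real.exp_nat_mul]; norm_num
        rw [this]
        calc Real.exp 1 ^ 4 ≤ 2.8 ^ 4 := by
              gcongr
              linarith [Real.exp_one_lt_d9]
          _ ≤ 64 := by norm_num
      have h6 : p.epsApx ^ 2 ≤ c / 64 := by
        have h7 := hp.epsApx_le
        have h8 := hp.epsApx_le'
        have h9 : p.epsBkup / (128 * p.lam1) = c / 32 := by rw [hcdef]; field_simp; norm_num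
        rw [h9] at h7
        nlinarith
      calc (2 : ℝ) ≤ 1 / 64 * (4 / p.epsApx ^ 2) * (c / 2) := by
            have h7 : (64 : ℝ) ≤ c / p.epsApx ^ 2 := by
              rw [le_div_iff₀ (by positivity)]
              linarith
            calc (2 : ℝ) ≤ 1 / 32 * (c / p.epsApx ^ 2) := by linarith
              _ = _ := by ring
        _ ≤ Real.exp (-4) * (p.kap * (p.epsApx ^ 2 / 4) ^ (p.A - 1)) * (c / 2) := by
            gcongr
        _ = _ := by ring
    have h4 := secondBonus_ge (ψ := ψ) (S := S) hp hψ i i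
    simp only [sub_self, map_zero, norm_zero, mul_zero] at h4
    rw [bonusAt_eq]
    have h5 := mul_le_mul_of_nonneg_left (h3.trans h2) (show 0 ≤ p.lam1 by linarith)
    linarith

end StateComparison

/-! ### The uniform distribution on the sphere -/

section Sphere

variable {d : ℕ}

lemma sphereProb_isProbabilityMeasure (hd : 1 ≤ d) : IsProbabilityMeasure (sphereProb d) := by
  have : Nonempty (Fin d) := ⟨⟨0, hd⟩⟩
  refine ⟨?_⟩
  rw [sphereProb, Measure.smul_apply, smul_eq_mul]
  refine ENNReal.inv_mul_cancel ?_ (measure_ne_top _ _)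
  rw [Ne, Measure.measure_univ_eq_zero]
  exact Measure.toSphere_ne_zero _

open scoped Pointwise in
-- Spherical measure is, up to a scalar, the Lebesgue measure of the truncated cone over the set;
-- the cone over a great subsphere lies in a proper subspace.
lemma sphereProb_hyperplane {y : EuclideanSpace ℝ (Fin d)} (hy : y ≠ 0) :
    sphereProb d {θ | ⟪θ.1, y⟫ = 0} = 0 := by
  have hm : MeasurableSet {θ : Metric.sphere (0 : EuclideanSpace ℝ (Fin d)) 1 | ⟪θ.1, y⟫ = 0} :=
    (isClosed_eq (by fun_prop) continuous_const).measurableSet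
  have hnull : (volume : Measure (EuclideanSpace ℝ (Fin d)))
      (LinearMap.ker (innerSL ℝ y).toLinearMap : Set (EuclideanSpace ℝ (Fin d))) = 0 := by
    refine Measure.addHaar_submodule _ _ fun htop => hy ?_
    have : y ∈ LinearMap.ker (innerSL ℝ y).toLinearMap := by rw [htop]; trivial
    simpa using this
  rw [sphereProb, Measure.smul_apply, Measure.toSphere_apply' _ hm]
  have hsub : Set.Ioo (0 : ℝ) 1 • (Subtype.val '' {θ : Metric.sphere (0 : EuclideanSpace ℝ (Fin d)) 1 |
      ⟪θ.1, y⟫ = 0}) ⊆ (LinearMap.ker (innerSL ℝ y).toLinearMap : Set (EuclideanSpace ℝ (Fin d))) := by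
    rintro _ ⟨c, _, _, ⟨θ, hθ, rfl⟩, rfl⟩
    have hθ' : ⟪y, θ.1⟫ = 0 := by rw [real_inner_comm]; exact hθ
    simp [hθ']
  rw [measure_mono_null hsub hnull]
  simp

/-- Almost every direction separates finitely many vectors. -/
lemma ae_sphereProb_separates {A : Type*} [Finite A] (ψ : A → EuclideanSpace ℝ (Fin d)) :
    ∀ᵐ θ ∂(sphereProb d), ∀ a b, ψ a ≠ ψ b → ⟪θ.1, ψ a⟫ ≠ ⟪θ.1, ψ b⟫ := by
  rw [ae_all_iff]
  intro a
  rw [ae_all_iff]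
  intro b
  by_cases hab : ψ a = ψ b
  · exact ae_of_all _ fun θ h => absurd hab h
  · have h1 : ∀ᵐ θ ∂(sphereProb d), ¬ ⟪θ.1, ψ a - ψ b⟫ = 0 := by
      rw [ae_iff]
      simp only [not_not]
      exact sphereProb_hyperplane (sub_ne_zero.2 hab)
    filter_upwards [h1] with θ hθ _ h
    exact hθ (by rw [inner_sub_right, h, sub_self])

end Sphere

/-! ### Linear policies -/

section LinPolicy

variable {A : Type*} [Fintype A] [Nonempty A] {d : ℕ}

/-- A maximizer of `⟪w, ψ a⟫` that wins all ties in direction `θ` against other feature vectors. -/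
def IsLexMax (ψ : A → EuclideanSpace ℝ (Fin d)) (w θ : EuclideanSpace ℝ (Fin d)) (a : A) : Prop :=
  ∀ b, ψ b = ψ a ∨ ⟪w, ψ b⟫ < ⟪w, ψ a⟫ ∨ (⟪w, ψ b⟫ = ⟪w, ψ a⟫ ∧ ⟪θ, ψ b⟫ < ⟪θ, ψ a⟫)

lemma exists_isLexMax {ψ : A → EuclideanSpace ℝ (Fin d)} {w θ : EuclideanSpace ℝ (Fin d)}
    (hθ : ∀ a b, ψ a ≠ ψ b → ⟪θ, ψ a⟫ ≠ ⟪θ, ψ b⟫) : ∃ a, IsLexMax ψ w θ a := by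
  obtain ⟨a₀, ha₀⟩ := exists_maxInner_eq ψ w
  have hne : (argmaxSet ψ w).Nonempty := ⟨a₀, fun b => ha₀ ▸ le_maxInner ψ w b⟩
  obtain ⟨a, ha, hmax⟩ := (Set.toFinite (argmaxSet ψ w)).exists_maximalFor (fun a => ⟪θ, ψ a⟫) _ hne
  refine ⟨a, fun b => ?_⟩
  by_cases hba : ψ b = ψ a
  · exact Or.inl hba
  rcases (ha b).lt_or_eq with hlt | heq
  · exact Or.inr (Or.inl hlt)
  · refine Or.inr (Or.inr ⟨heq, lt_of_le_of_ne ?_ (hθ b a hba)⟩)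
    have hb : b ∈ argmaxSet ψ w := fun c => heq ▸ ha c
    by_contra hcon
    push Not at hcon
    exact absurd (hmax hb hcon.le) (not_le.2 hcon)

omit [Fintype A] [Nonempty A] in
-- For a separating direction the random tie-breaking determines the feature vector. Only the choice
-- among actions sharing it remains, which explains the division by their number.
lemma IsLexMax.mem_iff {ψ : A → EuclideanSpace ℝ (Fin d)} {w : EuclideanSpace ℝ (Fin d)}
    {θ : Metric.sphere (0 : EuclideanSpace ℝ (Fin d)) 1} {a : A} (ha : IsLexMax ψ w θ.1 a) (b : A) :
    (b ∈ argmaxSet ψ w ∧ θ ∈ tieBreakSet ψ w b) ↔ ψ b = ψ a := by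
  have hle : ∀ c, ⟪w, ψ c⟫ ≤ ⟪w, ψ a⟫ := by
    intro c
    rcases ha c with h | h | h
    · rw [h]
    · exact h.le
    · exact h.1.le
  constructor
  · rintro ⟨hb, hθ⟩
    by_contra hne
    have hab : ⟪w, ψ a⟫ = ⟪w, ψ b⟫ := le_antisymm (hb a) (hle b)
    have ha' : a ∈ argmaxSet ψ w := hle
    have h1 := hθ a ha' (Ne.symm hne)
    rcases ha b with h | h | h
    · exact hne h
    · exact absurd hab h.ne'
    · exact absurd h1 (not_lt.2 h.2.le)
  · intro hba
    refine ⟨fun c => by rw [hba]; exact hle c, fun c hc hcb => ?_⟩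
    rw [hba] at hcb ⊢
    rcases ha c with h | h | h
    · exact absurd h hcb
    · exact absurd (hc a) (not_le.2 h)
    · exact h.2

open Classical in
/-- The action probabilities of the linear policy for a fixed tie-breaking direction. -/
def tieBroken (ψ : A → EuclideanSpace ℝ (Fin d)) (w : EuclideanSpace ℝ (Fin d)) (f : A → ℝ)
    (θ : Metric.sphere (0 : EuclideanSpace ℝ (Fin d)) 1) : ℝ :=
  ∑ a, (tieBreakSet ψ w a).indicator
    (fun _ => if a ∈ argmaxSet ψ w then f a / (Set.ncard {b | ψ b = ψ a} : ℝ) else 0) θ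

omit [Nonempty A] in
lemma tieBroken_eq {ψ : A → EuclideanSpace ℝ (Fin d)} {w : EuclideanSpace ℝ (Fin d)} {f : A → ℝ}
    (hf : ∀ a b, ψ a = ψ b → f a = f b)
    {θ : Metric.sphere (0 : EuclideanSpace ℝ (Fin d)) 1} {a : A} (ha : IsLexMax ψ w θ.1 a) :
    tieBroken ψ w f θ = f a := by
  classical
  have h1 : ∀ b, (tieBreakSet ψ w b).indicator
      (fun _ => if b ∈ argmaxSet ψ w then f b / (Set.ncard {c | ψ c = ψ b} : ℝ) else 0) θ =
      if ψ b = ψ a then f a / (Set.ncard {c | ψ c = ψ a} : ℝ) else 0 := by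
    intro b
    by_cases hb : ψ b = ψ a
    · obtain ⟨h2, h3⟩ := (ha.mem_iff b).2 hb
      rw [Set.indicator_of_mem h3, if_pos h2, if_pos hb, hb, hf b a hb]
    · rw [if_neg hb]
      by_cases h3 : θ ∈ tieBreakSet ψ w b
      · rw [Set.indicator_of_mem h3, if_neg fun h2 => hb ((ha.mem_iff b).1 ⟨h2, h3⟩)]
      · rw [Set.indicator_of_notMem h3]
  have hcard : (Set.ncard {c | ψ c = ψ a} : ℝ) ≠ 0 := by
    have : 0 < Set.ncard {c | ψ c = ψ a} := (Set.ncard_pos).2 ⟨a, rfl⟩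
    exact_mod_cast this.ne'
  have hc2 : Set.ncard {c | ψ c = ψ a} = (Finset.univ.filter fun c => ψ c = ψ a).card := by
    rw [← Set.ncard_coe_finset]
    simp
  simp only [tieBroken, h1]
  rw [← Finset.sum_filter, Finset.sum_const, nsmul_eq_mul, ← hc2]
  field_simp

omit [Nonempty A] in
lemma measurableSet_tieBreakSet (ψ : A → EuclideanSpace ℝ (Fin d)) (w : EuclideanSpace ℝ (Fin d))
    (a : A) : MeasurableSet (tieBreakSet ψ w a) := by
  have : tieBreakSet ψ w a = ⋂ b, {θ | b ∈ argmaxSet ψ w → ψ b ≠ ψ a → ⟪θ.1, ψ b⟫ < ⟪θ.1, ψ a⟫} := by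
    ext θ
    simp [tieBreakSet]
  rw [this]
  refine MeasurableSet.iInter fun b => ?_
  by_cases h1 : b ∈ argmaxSet ψ w
  · by_cases h2 : ψ b = ψ a
    · simp [h2]
    · simp only [h1, ne_eq, h2, not_false_eq_true, forall_const]
      exact (isOpen_lt (by fun_prop) (by fun_prop)).measurableSet
  · simp [h1]

omit [Nonempty A] in
-- Exchanges the average over tie-breaking directions with the sum over actions, so that the policy
-- can be studied for one fixed direction.
lemma sum_linPolicy_mul (hd : 1 ≤ d) (ψ : A → EuclideanSpace ℝ (Fin d))
    (w : EuclideanSpace ℝ (Fin d)) (f : A → ℝ) :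
    ∑ a, linPolicy ψ w a * f a = ∫ θ, tieBroken ψ w f θ ∂(sphereProb d) := by
  have := sphereProb_isProbabilityMeasure hd
  simp only [tieBroken]
  rw [integral_finsetSum _ fun a _ =>
    (integrable_const _).indicator (measurableSet_tieBreakSet ψ w a)]
  refine Finset.sum_congr rfl fun a _ => ?_
  rw [integral_indicator_const _ (measurableSet_tieBreakSet ψ w a), linPolicy, smul_eq_mul]
  split_ifs
  · ring
  · ring

omit [Fintype A] [Nonempty A] in
lemma linPolicy_nonneg (ψ : A → EuclideanSpace ℝ (Fin d)) (w : EuclideanSpace ℝ (Fin d)) (a : A) :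
    0 ≤ linPolicy ψ w a := by
  unfold linPolicy
  split_ifs
  · exact div_nonneg measureReal_nonneg (Nat.cast_nonneg _)
  · exact le_rfl

lemma sum_linPolicy (hd : 1 ≤ d) (ψ : A → EuclideanSpace ℝ (Fin d))
    (w : EuclideanSpace ℝ (Fin d)) : ∑ a, linPolicy ψ w a = 1 := by
  have := sphereProb_isProbabilityMeasure hd
  have h1 := sum_linPolicy_mul hd ψ w fun _ => 1
  simp only [mul_one] at h1
  rw [h1]
  have h2 : ∀ᵐ θ ∂(sphereProb d), tieBroken ψ w (fun _ => 1) θ = 1 := by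
    filter_upwards [ae_sphereProb_separates ψ] with θ hθ
    obtain ⟨a, ha⟩ := exists_isLexMax (w := w) hθ
    exact tieBroken_eq (fun _ _ _ => rfl) ha
  rw [integral_congr_ae h2]
  simp

omit [Fintype A] [Nonempty A] in
lemma linPolicy_of_not_mem {ψ : A → EuclideanSpace ℝ (Fin d)} {w : EuclideanSpace ℝ (Fin d)} {a : A}
    (ha : a ∉ argmaxSet ψ w) : linPolicy ψ w a = 0 := if_neg ha

omit [Nonempty A] in
lemma measurable_linPolicy {X : Type*} [MeasurableSpace X] {ψ : X → A → EuclideanSpace ℝ (Fin d)}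
    (hd : 1 ≤ d) (hψ : ∀ a, Measurable fun x => ψ x a) (w : EuclideanSpace ℝ (Fin d)) (a : A) :
    Measurable fun x => linPolicy (ψ x) w a := by
  classical
  have := sphereProb_isProbabilityMeasure hd
  have harg : ∀ a, MeasurableSet {x | a ∈ argmaxSet (ψ x) w} := by
    intro a
    have : {x | a ∈ argmaxSet (ψ x) w} = ⋂ b, {x | ⟪w, ψ x b⟫ ≤ ⟪w, ψ x a⟫} := by
      ext x; simp [argmaxSet]
    rw [this]
    exact MeasurableSet.iInter fun b =>
      measurableSet_le (measurable_const.inner (hψ b)) (measurable_const.inner (hψ a))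
  have heq : ∀ b, MeasurableSet {x | ψ x b = ψ x a} := fun b =>
    measurableSet_eq_fun (hψ b) (hψ a)
  have hset : MeasurableSet {z : X × Metric.sphere (0 : EuclideanSpace ℝ (Fin d)) 1 |
      z.2 ∈ tieBreakSet (ψ z.1) w a} := by
    have : {z : X × Metric.sphere (0 : EuclideanSpace ℝ (Fin d)) 1 |
        z.2 ∈ tieBreakSet (ψ z.1) w a} =
        ⋂ b, ((Prod.fst ⁻¹' {x | b ∈ argmaxSet (ψ x) w})ᶜ ∪ Prod.fst ⁻¹' {x | ψ x b = ψ x a} ∪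
          {z | ⟪z.2.1, ψ z.1 b⟫ < ⟪z.2.1, ψ z.1 a⟫}) := by
      ext z
      simp only [tieBreakSet, Set.mem_ofPred_eq, Set.mem_iInter, Set.mem_union, Set.mem_compl_iff,
        Set.mem_preimage]
      refine forall_congr' fun b => ?_
      tauto
    rw [this]
    refine MeasurableSet.iInter fun b => ((measurable_fst (harg b)).compl.union
      (measurable_fst (heq b))).union ?_
    have hval : Measurable fun z : X × Metric.sphere (0 : EuclideanSpace ℝ (Fin d)) 1 => z.2.1 :=
      measurable_subtype_coe.comp measurable_snd
    exact measurableSet_lt (hval.inner ((hψ b).comp measurable_fst))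
      (hval.inner ((hψ a).comp measurable_fst))
  have hnum : Measurable fun x => (sphereProb d).real (tieBreakSet (ψ x) w a) :=
    (measurable_measure_prodMk_left hset).ennreal_toReal
  have hden : Measurable fun x => (Set.ncard {b | ψ x b = ψ x a} : ℝ) := by
    have : (fun x => (Set.ncard {b | ψ x b = ψ x a} : ℝ)) =
        fun x => ∑ b, if ψ x b = ψ x a then (1 : ℝ) else 0 := by
      ext x
      rw [Finset.sum_boole, ← Set.ncard_coe_finset]
      simp
    rw [this]
    exact Finset.measurable_sum _ fun b _ => Measurable.ite (heq b) measurable_const measurable_const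
  exact Measurable.ite (harg a) (hnum.div hden) measurable_const

lemma linPolicy_isActionRule {X : Type*} [MeasurableSpace X] {ψ : X → A → EuclideanSpace ℝ (Fin d)}
    (hd : 1 ≤ d) (hψ : ∀ a, Measurable fun x => ψ x a) (w : EuclideanSpace ℝ (Fin d)) :
    IsActionRule fun x => linPolicy (ψ x) w :=
  ⟨fun _ _ => linPolicy_nonneg _ _ _, fun _ => sum_linPolicy hd _ _, measurable_linPolicy hd hψ w⟩

/-- A difference quotient of the maximum, whose limit is the value of the linear policy. -/
def maxQuotient (ψ : A → EuclideanSpace ℝ (Fin d)) (w₀ w θ : EuclideanSpace ℝ (Fin d)) (η : ℝ) : ℝ :=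
  (maxInner ψ (w₀ + η • θ + η ^ 2 • w) - maxInner ψ (w₀ + η • θ)) / η ^ 2

/-- A maximum over features of norm at most 1 is 1-Lipschitz. The bound is uniform in `η` and serves
as the dominating function in both limit exchanges, over directions and over states. -/
lemma abs_maxQuotient_le {ψ : A → EuclideanSpace ℝ (Fin d)} (hψ : ∀ a, ‖ψ a‖ ≤ 1)
    (w₀ w θ : EuclideanSpace ℝ (Fin d)) (η : ℝ) : |maxQuotient ψ w₀ w θ η| ≤ ‖w‖ := by
  rw [maxQuotient, abs_div, abs_of_nonneg (sq_nonneg η)]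
  refine div_le_of_le_mul₀ (sq_nonneg η) (norm_nonneg w) ?_
  refine (abs_maxInner_sub_le hψ _ _).trans (le_of_eq ?_)
  rw [add_sub_cancel_left, norm_smul, Real.norm_of_nonneg (sq_nonneg η), mul_comm]

/-- The scales `1`, `η`, `η²` act lexicographically: a gap in `w₀` beats everything, a tie in `w₀`
is decided by `θ` at order `η`, and `w` at order `η²` is too small to change the maximizer. -/
lemma IsLexMax.eventually_maxInner_eq {ψ : A → EuclideanSpace ℝ (Fin d)}
    {w₀ θ : EuclideanSpace ℝ (Fin d)} {a : A} (ha : IsLexMax ψ w₀ θ a)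
    (w : EuclideanSpace ℝ (Fin d)) :
    ∀ᶠ n : ℕ in Filter.atTop, maxInner ψ (w₀ + ((1 : ℝ) / (n + 1)) • θ + ((1 : ℝ) / (n + 1)) ^ 2 • w) =
      ⟪w₀ + ((1 : ℝ) / (n + 1)) • θ + ((1 : ℝ) / (n + 1)) ^ 2 • w, ψ a⟫ := by
  have hlim : Filter.Tendsto (fun n : ℕ => (1 : ℝ) / (n + 1)) Filter.atTop (nhds 0) :=
    tendsto_one_div_add_atTop_nhds_zero_nat
  have hb : ∀ b, ∀ᶠ n : ℕ in Filter.atTop,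
      ⟪w₀ + ((1 : ℝ) / (n + 1)) • θ + ((1 : ℝ) / (n + 1)) ^ 2 • w, ψ b⟫ ≤
      ⟪w₀ + ((1 : ℝ) / (n + 1)) • θ + ((1 : ℝ) / (n + 1)) ^ 2 • w, ψ a⟫ := by
    intro b
    simp only [inner_add_left, real_inner_smul_left]
    rcases ha b with h | h | ⟨h1, h2⟩
    · rw [h]
      exact Filter.Eventually.of_forall fun _ => le_rfl
    · have h3 : ∀ c : A, Filter.Tendsto (fun n : ℕ => ⟪w₀, ψ c⟫ + (1 : ℝ) / (n + 1) * ⟪θ, ψ c⟫ +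
          ((1 : ℝ) / (n + 1)) ^ 2 * ⟪w, ψ c⟫) Filter.atTop (nhds ⟪w₀, ψ c⟫) := by
        intro c
        simpa using ((hlim.mul_const ⟪θ, ψ c⟫).const_add ⟪w₀, ψ c⟫).add
          ((hlim.pow 2).mul_const ⟪w, ψ c⟫)
      exact ((h3 b).eventually_lt (h3 a) h).mono fun _ hn => hn.le
    · have h3 : ∀ c : A, Filter.Tendsto (fun n : ℕ => ⟪θ, ψ c⟫ +
          (1 : ℝ) / (n + 1) * ⟪w, ψ c⟫) Filter.atTop (nhds ⟪θ, ψ c⟫) := by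
        intro c
        simpa using (hlim.mul_const ⟪w, ψ c⟫).const_add ⟪θ, ψ c⟫
      refine ((h3 b).eventually_lt (h3 a) h2).mono fun n hn => ?_
      have h4 : (0 : ℝ) ≤ 1 / (n + 1) := by positivity
      have := mul_le_mul_of_nonneg_left hn.le h4
      rw [h1]
      linarith
  refine (Filter.eventually_all.2 hb).mono fun n hn => ?_
  exact le_antisymm (maxInner_le hn) (le_maxInner _ _ _)

lemma IsLexMax.tendsto_maxQuotient {ψ : A → EuclideanSpace ℝ (Fin d)}
    {w₀ θ : EuclideanSpace ℝ (Fin d)} {a : A} (ha : IsLexMax ψ w₀ θ a)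
    (w : EuclideanSpace ℝ (Fin d)) :
    Filter.Tendsto (fun n : ℕ => maxQuotient ψ w₀ w θ (1 / (n + 1))) Filter.atTop
      (nhds ⟪w, ψ a⟫) := by
  refine tendsto_const_nhds.congr' ?_
  filter_upwards [ha.eventually_maxInner_eq w, ha.eventually_maxInner_eq 0] with n h1 h2
  simp only [smul_zero, add_zero] at h2
  have h3 : ((1 : ℝ) / (n + 1)) ^ 2 ≠ 0 := by positivity
  rw [maxQuotient, h1, h2, ← inner_sub_left, add_sub_cancel_left, real_inner_smul_left,
    mul_div_cancel_left₀ _ h3]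

lemma tendsto_integral_maxQuotient (hd : 1 ≤ d) {ψ : A → EuclideanSpace ℝ (Fin d)}
    (hψ : ∀ a, ‖ψ a‖ ≤ 1) (w₀ w : EuclideanSpace ℝ (Fin d)) :
    Filter.Tendsto (fun n : ℕ => ∫ θ, maxQuotient ψ w₀ w θ.1 (1 / (n + 1)) ∂(sphereProb d))
      Filter.atTop (nhds (∑ a, linPolicy ψ w₀ a * ⟪w, ψ a⟫)) := by
  have := sphereProb_isProbabilityMeasure hd
  rw [sum_linPolicy_mul hd]
  refine tendsto_integral_of_dominated_convergence (fun _ => ‖w‖) (fun n => ?_) (integrable_const _)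
    (fun n => ae_of_all _ fun θ => abs_maxQuotient_le hψ _ _ _ _) ?_
  · refine Measurable.aestronglyMeasurable ?_
    exact ((measurable_maxInner (ψ := fun _ => ψ) (fun _ => measurable_const) (by fun_prop)).sub
      (measurable_maxInner (ψ := fun _ => ψ) (fun _ => measurable_const) (by fun_prop))).div_const _
  · filter_upwards [ae_sphereProb_separates ψ] with θ hθ
    obtain ⟨a, ha⟩ := exists_isLexMax (w := w₀) hθ
    rw [tieBroken_eq (fun a b h => by rw [h]) ha]
    exact ha.tendsto_maxQuotient w

end LinPolicy

/-! ### Bonuses and linear policies have linear backups -/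

namespace IsLinearIn

variable {X ι : Type*} [MeasurableSpace X] {d : ℕ} {Φ : ι → EuclideanSpace ℝ (Fin d)}
  {κ : ι → Measure X} {f g : X → ℝ}

lemma expect_const_mul (c : ℝ) (hf : IsLinearIn Φ fun i => ∫ x, f x ∂(κ i)) :
    IsLinearIn Φ fun i => ∫ x, c * f x ∂(κ i) := by
  simpa only [integral_const_mul] using hf.const_mul c

variable [∀ i, IsProbabilityMeasure (κ i)]

lemma expect_add (hf : BddMeas f) (hg : BddMeas g) (hf' : IsLinearIn Φ fun i => ∫ x, f x ∂(κ i))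
    (hg' : IsLinearIn Φ fun i => ∫ x, g x ∂(κ i)) :
    IsLinearIn Φ fun i => ∫ x, (f x + g x) ∂(κ i) := by
  simpa only [integral_add (hf.integrable _) (hg.integrable _)] using hf'.add hg'

lemma expect_sub (hf : BddMeas f) (hg : BddMeas g) (hf' : IsLinearIn Φ fun i => ∫ x, f x ∂(κ i))
    (hg' : IsLinearIn Φ fun i => ∫ x, g x ∂(κ i)) :
    IsLinearIn Φ fun i => ∫ x, (f x - g x) ∂(κ i) := by
  simpa only [integral_sub (hf.integrable _) (hg.integrable _)] using hf'.sub hg'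

end IsLinearIn

section LinearBackups

variable {X A ι : Type*} [MeasurableSpace X] [Fintype A] [Nonempty A] {d : ℕ}
  {ψ : X → A → EuclideanSpace ℝ (Fin d)}

lemma maxInner_bddMeas (hm : ∀ a, Measurable fun x => ψ x a) (hψ : ∀ x a, ‖ψ x a‖ ≤ 1)
    (u : EuclideanSpace ℝ (Fin d)) : BddMeas fun x => maxInner (ψ x) u :=
  ⟨measurable_maxInner hm measurable_const, ‖u‖, fun x => abs_maxInner_le (hψ x) u⟩

section IntegralBounds

variable {p q : EuclideanSpace ℝ (Fin d) →L[ℝ] EuclideanSpace ℝ (Fin d)} {β : ℝ}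

lemma integrable_norm_clm (q : EuclideanSpace ℝ (Fin d) →L[ℝ] EuclideanSpace ℝ (Fin d)) :
    Integrable (fun g => ‖q g‖) (stdGaussian (EuclideanSpace ℝ (Fin d))) :=
  (q.integrable_comp (IsGaussian.integrable_id
    (μ := stdGaussian (EuclideanSpace ℝ (Fin d))))).norm

omit [Nonempty A] in
lemma measurable_familyBonus_prod (hm : ∀ a, Measurable fun x => ψ x a) :
    Measurable fun z : X × (EuclideanSpace ℝ (Fin d) × EuclideanSpace ℝ (Fin d)) =>
      familyBonus (ψ z.1) (β • p z.2.1) (q z.2.2) :=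
  measurable_familyBonus (fun a => (hm a).comp measurable_fst) (by fun_prop) (by fun_prop)

lemma integrable_two_norm_snd (q : EuclideanSpace ℝ (Fin d) →L[ℝ] EuclideanSpace ℝ (Fin d)) :
    Integrable (fun z : EuclideanSpace ℝ (Fin d) × EuclideanSpace ℝ (Fin d) => 2 * ‖q z.2‖)
      ((stdGaussian (EuclideanSpace ℝ (Fin d))).prod (stdGaussian (EuclideanSpace ℝ (Fin d)))) :=
  ((integrable_norm_clm q).const_mul 2).comp_snd _

lemma integral_integral_familyBonus_eq (hm : ∀ a, Measurable fun x => ψ x a)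
    (hψ : ∀ x a, ‖ψ x a‖ ≤ 1) (x : X) :
    ∫ g, ∫ g', familyBonus (ψ x) (β • p g) (q g') ∂(stdGaussian (EuclideanSpace ℝ (Fin d)))
      ∂(stdGaussian (EuclideanSpace ℝ (Fin d))) =
    ∫ z, familyBonus (ψ x) (β • p z.1) (q z.2) ∂((stdGaussian (EuclideanSpace ℝ (Fin d))).prod
      (stdGaussian (EuclideanSpace ℝ (Fin d)))) := by
  symm
  refine integral_prod (fun z : EuclideanSpace ℝ (Fin d) × EuclideanSpace ℝ (Fin d) =>
    familyBonus (ψ x) (β • p z.1) (q z.2)) ?_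
  exact (integrable_two_norm_snd q).mono'
    ((measurable_familyBonus_prod hm).comp measurable_prodMk_left).aestronglyMeasurable
    (ae_of_all _ fun z => abs_familyBonus_le (hψ x) _ _)

lemma integral_familyBonus_bddMeas (hm : ∀ a, Measurable fun x => ψ x a)
    (hψ : ∀ x a, ‖ψ x a‖ ≤ 1) : BddMeas fun x =>
    ∫ g, ∫ g', familyBonus (ψ x) (β • p g) (q g') ∂(stdGaussian (EuclideanSpace ℝ (Fin d)))
      ∂(stdGaussian (EuclideanSpace ℝ (Fin d))) := by
  simp only [integral_integral_familyBonus_eq hm hψ]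
  refine ⟨((measurable_familyBonus_prod hm).stronglyMeasurable.integral_prod_right').measurable,
    ∫ z, 2 * ‖q z.2‖ ∂((stdGaussian (EuclideanSpace ℝ (Fin d))).prod
      (stdGaussian (EuclideanSpace ℝ (Fin d)))), fun x => ?_⟩
  rw [← Real.norm_eq_abs]
  exact norm_integral_le_of_norm_le (integrable_two_norm_snd q)
    (ae_of_all _ fun z => abs_familyBonus_le (hψ x) _ _)

lemma integral_maxInner_bddMeas (hm : ∀ a, Measurable fun x => ψ x a)
    (hψ : ∀ x a, ‖ψ x a‖ ≤ 1) : BddMeas fun x =>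
    ∫ g, maxInner (ψ x) (p g) ∂(stdGaussian (EuclideanSpace ℝ (Fin d))) := by
  have h1 : Measurable fun z : X × EuclideanSpace ℝ (Fin d) => maxInner (ψ z.1) (p z.2) :=
    measurable_maxInner (fun a => (hm a).comp measurable_fst) (by fun_prop)
  refine ⟨(h1.stronglyMeasurable.integral_prod_right').measurable,
    ∫ g, ‖p g‖ ∂(stdGaussian (EuclideanSpace ℝ (Fin d))), fun x => ?_⟩
  rw [← Real.norm_eq_abs]
  exact norm_integral_le_of_norm_le (integrable_norm_clm p)
    (ae_of_all _ fun z => abs_maxInner_le (hψ x) _)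

variable {Φ : ι → EuclideanSpace ℝ (Fin d)} {κ : ι → Measure X} [∀ i, IsProbabilityMeasure (κ i)]

lemma isLinearIn_integral_familyBonus (hm : ∀ a, Measurable fun x => ψ x a)
    (hψ : ∀ x a, ‖ψ x a‖ ≤ 1)
    (hmax : ∀ u, IsLinearIn Φ fun i => ∫ x, maxInner (ψ x) u ∂(κ i)) :
    IsLinearIn Φ fun i => ∫ x, ∫ g, ∫ g', familyBonus (ψ x) (β • p g) (q g')
      ∂(stdGaussian (EuclideanSpace ℝ (Fin d))) ∂(stdGaussian (EuclideanSpace ℝ (Fin d)))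
      ∂(κ i) := by
  simp only [integral_integral_familyBonus_eq hm hψ]
  refine IsLinearIn.integral_integral (measurable_familyBonus_prod hm) (integrable_two_norm_snd q)
    (fun x z => abs_familyBonus_le (hψ x) _ _) fun z => ?_
  have hb := maxInner_bddMeas hm hψ
  exact IsLinearIn.expect_sub ((hb _).add (hb _)) (hb _)
    (IsLinearIn.expect_add (hb _) (hb _) (hmax (β • p z.1)) (hmax (q z.2)))
    (hmax (β • p z.1 + q z.2))

lemma isLinearIn_integral_maxInner (hm : ∀ a, Measurable fun x => ψ x a)
    (hψ : ∀ x a, ‖ψ x a‖ ≤ 1)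
    (hmax : ∀ u, IsLinearIn Φ fun i => ∫ x, maxInner (ψ x) u ∂(κ i)) :
    IsLinearIn Φ fun i => ∫ x, ∫ g, maxInner (ψ x) (p g)
      ∂(stdGaussian (EuclideanSpace ℝ (Fin d))) ∂(κ i) := by
  have h1 : Measurable fun z : X × EuclideanSpace ℝ (Fin d) => maxInner (ψ z.1) (p z.2) :=
    measurable_maxInner (fun a => (hm a).comp measurable_fst) (by fun_prop)
  exact IsLinearIn.integral_integral (f := fun x g => maxInner (ψ x) (p g)) h1
    (integrable_norm_clm p) (fun x g => abs_maxInner_le (hψ x) _) fun g => hmax (p g)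

/-- The value of a linear policy has a linear backup. -/
lemma isLinearIn_integral_linPolicy (hd : 1 ≤ d) (hm : ∀ a, Measurable fun x => ψ x a)
    (hψ : ∀ x a, ‖ψ x a‖ ≤ 1)
    (hmax : ∀ u, IsLinearIn Φ fun i => ∫ x, maxInner (ψ x) u ∂(κ i))
    (w₀ w : EuclideanSpace ℝ (Fin d)) :
    IsLinearIn Φ fun i => ∫ x, ∑ a, linPolicy (ψ x) w₀ a * ⟪w, ψ x a⟫ ∂(κ i) := by
  have := sphereProb_isProbabilityMeasure hd
  have hmeas : ∀ n : ℕ, Measurable fun z : X × Metric.sphere (0 : EuclideanSpace ℝ (Fin d)) 1 =>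
      maxQuotient (ψ z.1) w₀ w z.2.1 (1 / (n + 1)) := fun n =>
    ((measurable_maxInner (fun a => (hm a).comp measurable_fst) (by fun_prop)).sub
      (measurable_maxInner (fun a => (hm a).comp measurable_fst) (by fun_prop))).div_const _
  refine IsLinearIn.of_tendsto (f := fun (n : ℕ) i => ∫ x, ∫ θ, maxQuotient (ψ x) w₀ w θ.1 (1 / (n + 1))
    ∂(sphereProb d) ∂(κ i)) (fun n => ?_) fun i => ?_
  · refine IsLinearIn.integral_integral (C := fun _ => ‖w‖)
      (f := fun x (θ : Metric.sphere (0 : EuclideanSpace ℝ (Fin d)) 1) =>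
        maxQuotient (ψ x) w₀ w θ.1 (1 / (n + 1)))
      (hmeas n) (integrable_const _) (fun x θ => abs_maxQuotient_le (hψ x) _ _ _ _) fun θ => ?_
    -- For fixed `θ` and `η` the quotient is a combination of two maxima of linear functions, whose
    -- backups are linear.
    obtain ⟨v, hv⟩ := ((hmax (w₀ + ((1 : ℝ) / (n + 1)) • θ.1 + ((1 : ℝ) / (n + 1)) ^ 2 • w)).sub
      (hmax (w₀ + ((1 : ℝ) / (n + 1)) • θ.1))).const_mul (((1 : ℝ) / (n + 1)) ^ 2)⁻¹
    refine ⟨v, fun i => ?_⟩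
    rw [← hv]
    have hb := fun u => (maxInner_bddMeas hm hψ u).integrable (κ i)
    simp only [maxQuotient]
    rw [integral_div, integral_sub (hb _) (hb _), div_eq_inv_mul]
  · refine tendsto_integral_of_dominated_convergence (fun _ => ‖w‖) (fun n => ?_)
      (integrable_const _) (fun n => ae_of_all _ fun x => ?_)
      (ae_of_all _ fun x => tendsto_integral_maxQuotient hd (hψ x) w₀ w)
    · exact ((hmeas n).stronglyMeasurable.integral_prod_right').aestronglyMeasurable
    · exact BddMeas.abs_integral_le
        (fun θ : Metric.sphere (0 : EuclideanSpace ℝ (Fin d)) 1 =>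
          abs_maxQuotient_le (hψ x) w₀ w θ.1 (1 / (n + 1))) (sphereProb d)

end IntegralBounds

variable {p : Params} {ψ : X → A → EuclideanSpace ℝ (Fin p.d)}

lemma bonusAt_bddMeas (hm : ∀ a, Measurable fun x => ψ x a) (hψ : ∀ x a, ‖ψ x a‖ ≤ 1)
    (S : Matrix (Fin p.d) (Fin p.d) ℝ) : BddMeas fun x => bonusAt p (ψ x) S := by
  simp only [bonusAt_eq]
  exact ((integral_familyBonus_bddMeas hm hψ).const_mul _).add
    ((integral_maxInner_bddMeas hm hψ).const_mul _)

/-- The bonus has a linear backup. -/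
lemma isLinearIn_integral_bonusAt {Φ : ι → EuclideanSpace ℝ (Fin p.d)} {κ : ι → Measure X}
    [∀ i, IsProbabilityMeasure (κ i)] (hm : ∀ a, Measurable fun x => ψ x a)
    (hψ : ∀ x a, ‖ψ x a‖ ≤ 1)
    (hmax : ∀ u, IsLinearIn Φ fun i => ∫ x, maxInner (ψ x) u ∂(κ i))
    (S : Matrix (Fin p.d) (Fin p.d) ℝ) :
    IsLinearIn Φ fun i => ∫ x, bonusAt p (ψ x) S ∂(κ i) := by
  simp only [bonusAt_eq]
  exact IsLinearIn.expect_add ((integral_familyBonus_bddMeas hm hψ).const_mul _)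
    ((integral_maxInner_bddMeas hm hψ).const_mul _)
    (IsLinearIn.expect_const_mul _ (isLinearIn_integral_familyBonus hm hψ hmax))
    (IsLinearIn.expect_const_mul _ (isLinearIn_integral_maxInner hm hψ hmax))

end LinearBackups

/-! ### Optimism -/

section Covariance

variable {p : Params} {X A : Type*} {φ : ℕ → X → A → EuclideanSpace ℝ (Fin p.d)}

lemma smul_one_le_covMatrix (D : SampleData X A) (t h : ℕ) :
    p.lam • (1 : Matrix (Fin p.d) (Fin p.d) ℝ) ≤ covMatrix p φ D t h := by
  rw [covMatrix]
  refine le_add_of_nonneg_right (Finset.sum_nonneg fun i _ => ?_)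
  simpa using (Matrix.posSemidef_vecMulVec_self_star (sampleFeature φ D t h i).ofLp).nonneg

lemma covMatrix_one (D : SampleData X A) (h : ℕ) :
    covMatrix p φ D 1 h = p.lam • (1 : Matrix (Fin p.d) (Fin p.d) ℝ) := by
  simp [covMatrix, Params.numSamples]

end Covariance

/-- A standard basis vector lies in the coefficient ball because the features have norm at most 1.
-/
lemma one_le_of_isBoundedBy {X A : Type*} {d H : ℕ} {φ : ℕ → X → A → EuclideanSpace ℝ (Fin d)}
    {θr : ℕ → EuclideanSpace ℝ (Fin d)} {B : ℝ} (hd : 1 ≤ d) (hH : 1 ≤ H)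
    (hB : IsBoundedBy H φ θr B) : 1 ≤ B := by
  have h1 : 1 ∈ Set.Icc 1 H := ⟨le_rfl, hH⟩
  have h2 := hB.coeff_le 1 h1 (EuclideanSpace.single ⟨0, hd⟩ 1) fun x a => by
    refine (abs_real_inner_le_norm _ _).trans ?_
    rw [PiLp.norm_single, norm_one, mul_one]
    exact hB.feature_le 1 h1 x a
  rwa [PiLp.norm_single, norm_one] at h2

/-- The elements of a scaled coefficient ball. -/
lemma smul_mem_coeffBall {X A : Type*} {d : ℕ} {φ : ℕ → X → A → EuclideanSpace ℝ (Fin d)} {h : ℕ}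
    {w : EuclideanSpace ℝ (Fin d)} {c : ℝ} (hc : 0 < c) (hw : ∀ x a, |⟪φ h x a, w⟫| ≤ c) :
    c⁻¹ • w ∈ coeffBall φ h := by
  intro x a
  rw [real_inner_smul_right, abs_mul, abs_of_pos (inv_pos.2 hc), inv_mul_le_iff₀ hc, mul_one]
  exact hw x a

/-! ### Backward induction over the steps -/

section Optimism

variable {p : Params} {X A : Type*} [MeasurableSpace X] [Fintype A] [Nonempty A]
  {M : MDP p.H X A} {φ : ℕ → X → A → EuclideanSpace ℝ (Fin p.d)}
  {θr : ℕ → EuclideanSpace ℝ (Fin p.d)}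

omit [Fintype A] [Nonempty A] in
-- Completeness is stated for functions bounded by 1; positive homogeneity of the maximum extends it
-- to any bound and preserves that bound.
lemma exists_backup (hM : IsLinearBellmanComplete M φ θr) {h : ℕ} (h1 : 1 ≤ h) (h2 : h < p.H)
    {u : EuclideanSpace ℝ (Fin p.d)} {c : ℝ} (hc : 0 < c)
    (hu : ∀ x a, |⟪φ (h + 1) x a, u⟫| ≤ c) :
    ∃ w, (∀ x a, |⟪φ h x a, w⟫| ≤ c) ∧
      ∀ x a, ⟪φ h x a, w⟫ = ∫ y, maxInner (φ (h + 1) y) u ∂(M.P h a x) := by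
  obtain ⟨θ, hθ, hθ'⟩ := hM.backup h h1 h2 _ (smul_mem_coeffBall hc hu)
  refine ⟨c • θ, fun x a => ?_, fun x a => ?_⟩
  · rw [real_inner_smul_right, abs_mul, abs_of_pos hc]
    exact mul_le_of_le_one_right hc.le (hθ x a)
  · rw [real_inner_smul_right, hθ', ← integral_const_mul]
    refine integral_congr_ae (ae_of_all _ fun y => ?_)
    have h3 : (⨆ b, ⟪φ (h + 1) y b, c⁻¹ • u⟫) = maxInner (φ (h + 1) y) (c⁻¹ • u) := by
      simp only [maxInner, real_inner_comm]
    simp only [h3]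
    rw [maxInner_smul (inv_nonneg.2 hc.le), mul_inv_cancel_left₀ hc.ne']

omit [Fintype A] [Nonempty A] in
lemma isLinearIn_backup (hM : IsLinearBellmanComplete M φ θr) (hB : IsBoundedBy p.H φ θr p.B)
    {h : ℕ} (h1 : 1 ≤ h) (h2 : h < p.H) (u : EuclideanSpace ℝ (Fin p.d)) :
    IsLinearIn (fun i : X × A => φ h i.1 i.2)
      fun i => ∫ y, maxInner (φ (h + 1) y) u ∂(M.P h i.2 i.1) := by
  obtain ⟨w, -, hw⟩ := exists_backup hM h1 h2 (u := u) (c := ‖u‖ + 1) (by positivity) fun x a => by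
    have h3 := hB.feature_le (h + 1) ⟨by omega, h2⟩ x a
    have h4 := abs_real_inner_le_norm (φ (h + 1) x a) u
    nlinarith [norm_nonneg u]
  exact ⟨w, fun i => (hw i.1 i.2).symm⟩

variable {π₁ : ℕ → X → A → ℝ} {D : SampleData X A} {t : ℕ}

lemma piHat_isActionRule (hp : p.Admissible)
    (hφ : ∀ h ∈ Set.Icc 1 p.H, ∀ a, Measurable fun x => φ h x a) (hπ₁ : IsPolicy π₁) {h : ℕ}
    (hh : h ∈ Set.Icc 1 p.H) : IsActionRule (piHat p M φ π₁ D t h) := by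
  by_cases ht : t = 1
  · have : piHat p M φ π₁ D t h = π₁ h := by
      ext x a
      simp [piHat, ht]
    rw [this]
    exact hπ₁.isActionRule h
  · have : piHat p M φ π₁ D t h = fun x => linPolicy (φ h x) (wHat p M φ D t h) := by
      ext x a
      simp [piHat, ht]
    rw [this]
    exact linPolicy_isActionRule hp.d_pos (hφ h hh) _

lemma bonus_bddMeas (hφ : ∀ h ∈ Set.Icc 1 p.H, ∀ a, Measurable fun x => φ h x a)
    (hB : IsBoundedBy p.H φ θr p.B) {h : ℕ} (hh : h ∈ Set.Icc 1 p.H) :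
    BddMeas (bonus p φ D t h) :=
  bonusAt_bddMeas (hφ h hh) (hB.feature_le h hh) _

/-- After the first round, the optimistic `Q`-functions are linear. -/
lemma exists_optimisticQ_eq (hp : p.Admissible)
    (hφ : ∀ h ∈ Set.Icc 1 p.H, ∀ a, Measurable fun x => φ h x a)
    (hM : IsLinearBellmanComplete M φ θr) (hB : IsBoundedBy p.H φ θr p.B) (hπ₁ : IsPolicy π₁)
    (ht : t ≠ 1) (k : ℕ) : ∀ h, 1 ≤ h → h + k = p.H →
      ∃ w, ∀ x a, optimisticQ p M φ π₁ D t h x a = ⟪φ h x a, w⟫ := by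
  induction k with
  | zero =>
    intro h h1 hk
    obtain rfl : h = p.H := by omega
    exact ⟨θr p.H, fun x a => by
      rw [optimisticQ, bonusQ_last, hM.reward_eq p.H ⟨h1, le_rfl⟩]⟩
  | succ k ih =>
    intro h h1 hk
    have hh : h + 1 ∈ Set.Icc 1 p.H := ⟨by omega, by omega⟩
    obtain ⟨w, hw⟩ := ih (h + 1) (by omega) (by omega)
    have hrule : ∀ g ∈ Set.Icc 1 p.H, IsActionRule (piHat p M φ π₁ D t g) := fun g hg =>
      piHat_isActionRule hp hφ hπ₁ hg
    have hF : ∀ g ∈ Set.Icc 1 p.H, BddMeas (bonus p φ D t g) := fun g hg => bonus_bddMeas hφ hB hg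
    have hmax := isLinearIn_backup hM hB h1 (show h < p.H by omega)
    have hV : ∀ y, bonusV M (bonus p φ D t) (piHat p M φ π₁ D t) (h + 1) y =
        ∑ a, linPolicy (φ (h + 1) y) (wHat p M φ D t (h + 1)) a * ⟪w, φ (h + 1) y a⟫ := by
      intro y
      refine Finset.sum_congr rfl fun a _ => ?_
      rw [real_inner_comm, ← hw, optimisticQ]
      simp only [piHat, if_neg ht]
    have hlin := isLinearIn_integral_linPolicy (κ := fun i : X × A => M.P h i.2 i.1) hp.d_pos
      (hφ _ hh) (hB.feature_le _ hh) hmax (wHat p M φ D t (h + 1)) w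
    simp only [← hV] at hlin
    obtain ⟨v, hv⟩ := IsLinearIn.expect_add (bonusV_bddMeas hrule hF hh) (hF _ hh) hlin
      (isLinearIn_integral_bonusAt (hφ _ hh) (hB.feature_le _ hh) hmax
        (covMatrix p φ D t (h + 1)))
    refine ⟨θr h + v, fun x a => ?_⟩
    rw [optimisticQ, bonusQ_eq hrule hF h1 (by omega), inner_add_right,
      hM.reward_eq h ⟨h1, by omega⟩]
    exact congrArg _ (hv (x, a))

/-- Optimism of the `Q`-functions yields optimism of the value functions. -/
lemma maxInner_le_optimisticV (hp : p.Admissible) (hA : p.A = Fintype.card A)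
    (hφ : ∀ h ∈ Set.Icc 1 p.H, ∀ a, Measurable fun x => φ h x a)
    (hM : IsLinearBellmanComplete M φ θr) (hB : IsBoundedBy p.H φ θr p.B) (hπ₁ : IsPolicy π₁)
    (hD : D ∈ regressionEvent p M φ π₁) (ht : t ∈ Set.Icc 1 p.T) {h : ℕ}
    (hh : h ∈ Set.Icc 1 p.H) {w : EuclideanSpace ℝ (Fin p.d)} (hw : ‖w‖ ≤ p.lam1)
    (hQ : ∀ x a, ⟪φ h x a, w⟫ ≤ optimisticQ p M φ π₁ D t h x a + p.epsBkup * ((p.H : ℝ) - h))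
    (x : X) : maxInner (φ h x) w ≤
      optimisticV p M φ π₁ D t h x + bonus p φ D t h x + p.epsBkup * ((p.H : ℝ) + 1 - h) := by
  have hrule := piHat_isActionRule (D := D) (t := t) (M := M) hp hφ hπ₁ hh
  have hψ := hB.feature_le h hh x
  -- `V^t` averages `Q^t` over the played actions, so the bound is needed for each of these only.
  suffices hsuff : ∀ a, piHat p M φ π₁ D t h x a ≠ 0 →
      maxInner (φ h x) w - bonus p φ D t h x - p.epsBkup * ((p.H : ℝ) + 1 - h) ≤
        optimisticQ p M φ π₁ D t h x a by
    have h1 : ∑ a, piHat p M φ π₁ D t h x a *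
        (maxInner (φ h x) w - bonus p φ D t h x - p.epsBkup * ((p.H : ℝ) + 1 - h)) ≤
        optimisticV p M φ π₁ D t h x := by
      refine Finset.sum_le_sum fun a _ => ?_
      by_cases ha : piHat p M φ π₁ D t h x a = 0
      · rw [ha, zero_mul, zero_mul]
      · exact mul_le_mul_of_nonneg_left (hsuff a ha) (hrule.nonneg x a)
    rw [← Finset.sum_mul, hrule.sum_eq_one, one_mul] at h1
    linarith
  intro a ha
  have hε := hp.epsBkup_pos
  obtain ⟨b, hb⟩ := exists_maxInner_eq (φ h x) w
  -- In round 1 neither linearity of `Q^t` nor greediness of the policy is available; the bonus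
  -- covers the whole difference `⟪w, φ b - φ a⟫`.
  by_cases ht1 : t = 1
  · subst ht1
    have h1 := le_bonusAt_smul_one hp hψ b a
    rw [← covMatrix_one (φ := φ) D h] at h1
    have h2 : ⟪w, φ h x b - φ h x a⟫ ≤ p.lam1 * ‖φ h x b - φ h x a‖ :=
      (real_inner_le_norm _ _).trans (mul_le_mul_of_nonneg_right hw (norm_nonneg _))
    have h3 := hQ x a
    rw [inner_sub_right] at h2
    rw [real_inner_comm] at h3
    rw [hb, bonus]
    linarith
  · obtain ⟨v, hv⟩ := exists_optimisticQ_eq (D := D) hp hφ hM hB hπ₁ ht1 (p.H - h) h hh.1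
      (by have := hh.2; omega)
    have hamem : a ∈ argmaxSet (φ h x) (wHat p M φ D t h) := by
      by_contra hcon
      apply ha
      rw [piHat, if_neg ht1, linPolicy_of_not_mem hcon]
    obtain ⟨y, hy, hy1, hy2⟩ := exists_convex_combination hp hA hψ
      (smul_one_le_covMatrix (φ := φ) D t h) hw a
    -- The regression event is used in the direction `y - φ a` alone, where the error is at most `3
    -- ε_bkup / 4`; the remaining `ε_bkup / 4` of this step's budget is in `hy2`.
    have h1 := (abs_le.1 ((hD h hh t ht v hv (y - φ h x a)).trans hy1)).1
    have h2 : ⟪wHat p M φ D t h, y⟫ ≤ ⟪wHat p M φ D t h, φ h x a⟫ :=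
      (inner_le_maxInner_of_mem_convexHull hy _).trans (maxInner_le hamem)
    -- Linearity of both functions carries the bound from the features to their convex hull.
    have h3 : ⟪w - v, y⟫ ≤ p.epsBkup * ((p.H : ℝ) - h) := by
      refine (inner_le_maxInner_of_mem_convexHull hy _).trans (maxInner_le fun c => ?_)
      have := hQ x c
      rw [hv, real_inner_comm w, real_inner_comm v] at this
      rw [inner_sub_left]
      linarith
    rw [hv, real_inner_comm v]
    rw [real_inner_comm] at h1
    simp only [inner_sub_left, inner_sub_right] at h1 h3
    change maxInner (φ h x) w - ⟪w, y⟫ ≤ bonus p φ D t h x + p.epsBkup / 4 at hy2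
    linarith

omit [MeasurableSpace X] [Fintype A] [Nonempty A] in
-- Scaling into the coefficient ball gives `‖w‖ ≤ B (H - h + 1)`, and `h ≥ 1`.
lemma norm_le_lam1 (hp : p.Admissible) (hB : IsBoundedBy p.H φ θr p.B) {h : ℕ}
    (hh : h ∈ Set.Icc 1 p.H) {w : EuclideanSpace ℝ (Fin p.d)}
    (hw : ∀ x a, |⟪φ h x a, w⟫| ≤ (p.H : ℝ) - h + 1) : ‖w‖ ≤ p.lam1 := by
  have h1 : (1 : ℝ) ≤ h := by exact_mod_cast hh.1
  have h2 : (h : ℝ) ≤ p.H := by exact_mod_cast hh.2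
  have hc : 0 < (p.H : ℝ) - h + 1 := by linarith
  have h3 := hB.coeff_le h hh _ (smul_mem_coeffBall hc hw)
  rw [norm_smul, Real.norm_of_nonneg (inv_nonneg.2 hc.le), inv_mul_le_iff₀ hc] at h3
  refine h3.trans ?_
  rw [Params.lam1, mul_comm]
  exact mul_le_mul_of_nonneg_left (by linarith) (by linarith [hp.one_le_B])

omit [Nonempty A] in
lemma policyV_le_maxInner {π : ℕ → X → A → ℝ} (hπ : IsPolicy π) {h : ℕ}
    {w : EuclideanSpace ℝ (Fin p.d)} {x : X} (hw : ∀ a, policyQ M π h x a ≤ ⟪φ h x a, w⟫) :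
    policyV M π h x ≤ maxInner (φ h x) w := by
  calc policyV M π h x ≤ ∑ a, π h x a * maxInner (φ h x) w := by
        refine Finset.sum_le_sum fun a _ => mul_le_mul_of_nonneg_left ?_ (hπ.nonneg h x a)
        refine (hw a).trans ?_
        rw [real_inner_comm]
        exact le_maxInner _ _ _
    _ = maxInner (φ h x) w := by rw [← Finset.sum_mul, hπ.sum_eq_one, one_mul]

/-- A linear function lies between the `Q`-functions of all policies and the optimistic
`Q`-function. -/
lemma exists_linear_between (hp : p.Admissible) (hA : p.A = Fintype.card A)
    (hφ : ∀ h ∈ Set.Icc 1 p.H, ∀ a, Measurable fun x => φ h x a)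
    (hM : IsLinearBellmanComplete M φ θr) (hB : IsBoundedBy p.H φ θr p.B) (hπ₁ : IsPolicy π₁)
    (hD : D ∈ regressionEvent p M φ π₁) (ht : t ∈ Set.Icc 1 p.T) (k : ℕ) :
    ∀ h, 1 ≤ h → h + k = p.H → ∃ w : EuclideanSpace ℝ (Fin p.d),
      (∀ x a, |⟪φ h x a, w⟫| ≤ (p.H : ℝ) - h + 1) ∧
      (∀ π, IsPolicy π → ∀ x a, policyQ M π h x a ≤ ⟪φ h x a, w⟫) ∧
      ∀ x a, ⟪φ h x a, w⟫ ≤ optimisticQ p M φ π₁ D t h x a + p.epsBkup * ((p.H : ℝ) - h) := by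
  induction k with
  | zero =>
    intro h h1 hk
    obtain rfl : h = p.H := by omega
    have hh : p.H ∈ Set.Icc 1 p.H := ⟨h1, le_rfl⟩
    refine ⟨θr p.H, fun x a => ?_, fun π hπ x a => ?_, fun x a => ?_⟩
    · simpa using hM.reward_mem _ hh x a
    · rw [policyQ, bonusQ_last, hM.reward_eq _ hh]
    · rw [optimisticQ, bonusQ_last, hM.reward_eq _ hh, sub_self, mul_zero, add_zero]
  | succ k ih =>
    intro h h1 hk
    have h2 : h < p.H := by omega
    have hh : h ∈ Set.Icc 1 p.H := ⟨h1, h2.le⟩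
    have hh' : h + 1 ∈ Set.Icc 1 p.H := ⟨by omega, h2⟩
    obtain ⟨w, hw1, hw2, hw3⟩ := ih (h + 1) (by omega) (by omega)
    have hV := maxInner_le_optimisticV hp hA hφ hM hB hπ₁ hD ht hh' (norm_le_lam1 hp hB hh' hw1) hw3
    push_cast at hw1 hV
    have hcH : (h : ℝ) + 1 ≤ p.H := by exact_mod_cast h2
    -- The bound at step `h + 1` is `H - (h + 1) + 1 = H - h`; the reward at step `h` adds the
    -- missing 1.
    obtain ⟨v, hv1, hv2⟩ := exists_backup hM h1 h2 (u := w) (c := (p.H : ℝ) - h) (by linarith)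
      fun x a => (hw1 x a).trans (by linarith)
    have hmb := maxInner_bddMeas (hφ _ hh') (hB.feature_le _ hh') w
    have hrule : ∀ g ∈ Set.Icc 1 p.H, IsActionRule (piHat p M φ π₁ D t g) := fun g hg =>
      piHat_isActionRule hp hφ hπ₁ hg
    have hF : ∀ g ∈ Set.Icc 1 p.H, BddMeas (bonus p φ D t g) := fun g hg => bonus_bddMeas hφ hB hg
    refine ⟨θr h + v, fun x a => ?_, fun π hπ x a => ?_, fun x a => ?_⟩
    · rw [inner_add_right]
      exact (abs_add_le _ _).trans (by linarith [hM.reward_mem h hh x a, hv1 x a])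
    · have hrule' : ∀ g ∈ Set.Icc 1 p.H, IsActionRule (π g) := fun g _ => hπ.isActionRule g
      have hF' : ∀ g ∈ Set.Icc 1 p.H, BddMeas ((fun _ _ => 0 : ℕ → X → ℝ) g) :=
        fun g _ => BddMeas.const 0
      rw [policyQ, bonusQ_eq hrule' hF' h1 h2, inner_add_right, hM.reward_eq h hh, hv2]
      refine add_le_add_right (integral_mono
        (((bonusV_bddMeas hrule' hF' hh').add (hF' _ hh')).integrable _)
        (hmb.integrable _) fun y => ?_) _
      simp only [add_zero]
      exact policyV_le_maxInner hπ (hw2 π hπ y)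
    · rw [optimisticQ, bonusQ_eq hrule hF h1 h2, inner_add_right, hM.reward_eq h hh, hv2]
      have h3 := integral_mono (μ := M.P h a x) (hmb.integrable _)
        ((((bonusV_bddMeas hrule hF hh').add (hF _ hh')).add
          (BddMeas.const (p.epsBkup * ((p.H : ℝ) - h)))).integrable _) fun y => by
          have := hV y
          rw [optimisticV, show (p.H : ℝ) + 1 - (h + 1) = p.H - h by ring] at this
          exact this
      rw [integral_add (((bonusV_bddMeas hrule hF hh').add (hF _ hh')).integrable _)
        (integrable_const _)] at h3
      simp only [integral_const, probReal_univ, one_smul] at h3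
      linarith

end Optimism

end

/-! ### Choice of the constants and conclusion -/

theorem mainTheorem2 :
    ∃ (K₀ : ℝ) (K₁ : ℝ → ℝ → ℝ) (K₂ : ℝ → ℝ → ℝ → ℝ),
      ∀ (p : Params), K₀ ≤ p.Cpsd → K₀ ≤ p.Ccor → K₁ p.Cpsd p.Ccor ≤ p.Cphi →
        K₂ p.Cpsd p.Ccor p.Cphi ≤ p.Cthm →
        p.δ ∈ Set.Ioo (0 : ℝ) 1 → p.εfinal ∈ Set.Ioo (0 : ℝ) 1 →
      ∀ (X A : Type*) [MeasurableSpace X] [Fintype A] [Nonempty A], p.A = Fintype.card A →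
      ∀ (M : MDP p.H X A) (φ : ℕ → X → A → EuclideanSpace ℝ (Fin p.d))
        (θr : ℕ → EuclideanSpace ℝ (Fin p.d)),
        (∀ h ∈ Set.Icc 1 p.H, ∀ a, Measurable fun x => φ h x a) →
        IsLinearBellmanComplete M φ θr → IsBoundedBy p.H φ θr p.B →
      ∀ (π₁ : ℕ → X → A → ℝ), IsPolicy π₁ →
      ∀ D ∈ regressionEvent p M φ π₁,
      ∀ t ∈ Set.Icc 1 p.T, ∀ h ∈ Set.Icc 1 p.H, ∀ x : X,
        (∀ a : A, p.epsBkup * ((p.H : ℝ) - h) + optimisticQ p M φ π₁ D t h x a ≥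
          optQ M h x a) ∧
        p.epsBkup * ((p.H : ℝ) + 1 - h) + optimisticV p M φ π₁ D t h x + bonus p φ D t h x ≥
          optV M h x := by
  -- `C_cor ≥ 2` serves the cancellation against the small ball probability, `C_psd ≥ 2` gives `λ ≥
  -- 1`, and together with `C_phi ≥ C_psd` it gives `√λ ≤ β`.
  refine ⟨2, fun c _ => c, fun _ _ _ => 0, ?_⟩
  intro p hpsd hcor hphi _ hδ hε X A _ _ _ hA M φ θr hφ hM hB π₁ hπ₁ D hD t ht h hh x
  have hT : 1 ≤ p.T := ht.1.trans ht.2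
  have hH : 1 ≤ p.H := hh.1.trans hh.2
  -- For `d = 0` the number of rounds would be 0, but there is a round `t`.
  have hd : 1 ≤ p.d := by
    by_contra hcon
    have h0 : p.d = 0 := by omega
    rw [Params.T, h0] at hT
    simp at hT
  have hp : p.Admissible :=
    { A_pos := hA ▸ Fintype.card_pos
      H_pos := hH
      d_pos := hd
      T_pos := hT
      one_le_B := one_le_of_isBoundedBy hd hH hB
      δ_pos := hδ.1
      δ_lt := hδ.2
      ε_pos := hε.1
      ε_lt := hε.2
      Cpsd_ge := hpsd
      Ccor_ge := hcor
      Cphi_ge := hphi }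
  obtain ⟨w, hw1, hw2, hw3⟩ := exists_linear_between hp hA hφ hM hB hπ₁ hD ht (p.H - h) h hh.1
    (by have := hh.2; omega)
  have : Nonempty {π : ℕ → X → A → ℝ // IsPolicy π} := ⟨⟨π₁, hπ₁⟩⟩
  refine ⟨fun a => ?_, ?_⟩
  · have h1 : optQ M h x a ≤ ⟪φ h x a, w⟫ := ciSup_le fun π => hw2 π.1 π.2 x a
    linarith [hw3 x a]
  · have h1 : optV M h x ≤ maxInner (φ h x) w :=
      ciSup_le fun π => policyV_le_maxInner π.2 (hw2 π.1 π.2 x)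
    linarith [maxInner_le_optimisticV hp hA hφ hM hB hπ₁ hD ht hh (norm_le_lam1 hp hB hh hw1) hw3 x]
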